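/- \textbf{Lemma (asymptotic normality of OLS with many controls).} For each sample size $n\ge 1$ let $p=p_n$ and let outcomes $Y_i\in\mathbb R$, treatments $D_i\in\mathbb R$ and controls $W_i\in\mathbb R^{p}$, $i=1,\dots,n$, be random variables on a probability space (which may depend on $n$). Write $Y=(Y_1,\dots,Y_n)'$, $D=(D_1,\dots,D_n)'$ and let $W$ be the $n\times p$ matrix with rows $W_i'$. For coefficients $\beta\in\mathbb R$, $\gamma,\delta\in\mathbb R^{p}$ (which may depend on $n$) let $$Y_i=D_i\beta+W_i'\gamma+U_i,\qquad E[U_i\mid D_i,W]=0,$$ $$D_i=W_i'\delta+\tilde D_i,\qquad E[\tilde D_i\mid W]=0 .$$ Suppose that for some constants $K,\eta>0$, not depending on $n$ or $i$, almost surely for all $n$ and $i\le n$: (i) the pairs $(U_i,\tilde D_i)$, $i=1,\dots,n$, are independent across $i$ conditional on $W$; (ii) $E[|U_i|^{2+\eta}\mid D,W]+E[|\tilde D_i|^4\mid W]\le K$; (iii) $1/E[\tilde D_i^2\mid W]+1/E[U_i^2\mid D,W]\le K$ (with $1/0=\infty$); and (iv) $\limsup_{n\to\infty}p/n<1$. Let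 $P$ be the orthogonal projection of $\mathbb R^n$ onto the column space of $W$, let $\ddot D=(I-P)D$, and let $$\hat\beta_{OLS}=\frac{\sum_{i=1}^n\ddot D_iY_i}{\sum_{i=1}^n\ddot D_i^2},\qquad s_{OLS}^2=\frac{1}{(\ddot D'\ddot D)^2}\sum_{i=1}^n\ddot D_i^2U_i^2,\qquad s_{OLS}\ge 0$$ (a ratio with zero denominator is given the value $0$). Then, as $n\to\infty$, $$\frac{\hat\beta_{OLS}-\beta}{s_{OLS}}\ \overset{d}{\to}\ \mathcal N(0,1).$$ -/

import Mathlib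

open MeasureTheory ProbabilityTheory Filter
open scoped ENNReal

noncomputable section

/-- Conditional independence of a finite family of random variables given a sub-σ-algebra `m`:
conditional probabilities of joint events factor almost surely. On standard Borel spaces this is
`ProbabilityTheory.iCondIndepFun` (see `condIndepGiven_iff`); here the sample space is arbitrary. -/
def CondIndepGiven {Ω E ι : Type*} [MeasurableSpace E] (m : MeasurableSpace Ω)
    {mΩ : MeasurableSpace Ω} (X : ι → Ω → E) (μ : Measure Ω) : Prop :=
  ∀ (S : Finset ι) (A : ι → Set E), (∀ i ∈ S, MeasurableSet (A i)) →
    μ⟦⋂ i ∈ S, X i ⁻¹' A i | m⟧ =ᵐ[μ] ∏ i ∈ S, μ⟦X i ⁻¹' A i | m⟧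

theorem condIndepGiven_iff {Ω E ι : Type*} [MeasurableSpace E] (m : MeasurableSpace Ω)
    {mΩ : MeasurableSpace Ω} [StandardBorelSpace Ω] (hm : m ≤ mΩ) (X : ι → Ω → E)
    (hX : ∀ i, Measurable (X i)) (μ : Measure Ω) [IsFiniteMeasure μ] :
    CondIndepGiven m X μ ↔ iCondIndepFun m hm X μ := by
  rw [iCondIndepFun_iff_condExp_inter_preimage_eq_mul (fun _ => inferInstance) X hX]
  exact ⟨fun h S A hA => h S A hA, fun h S A hA => h S hA⟩

/-- `n` observations of an outcome `Y i`, a scalar treatment `D i` and a vector `W i` of `p`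
controls, on a sample space `Ω`, with the coefficients `β`, `γ` of the outcome regression and the
coefficients `δ` of the propensity score regression. The regression errors are defined from these
data below (`U`, `Dtilde`), so that the two regression equations hold by construction. -/
structure PartiallyLinearModel (Ω : Type*) [MeasurableSpace Ω] (n p : ℕ) where
  /-- outcomes -/
  Y : Ω → Fin n → ℝ
  /-- treatments -/
  D : Ω → Fin n → ℝ
  /-- controls; `W ω i` is the vector of controls of observation `i` -/
  W : Ω → Fin n → Fin p → ℝ
  /-- coefficient of interest -/
  β : ℝ
  /-- coefficients on the controls in the outcome regression -/
  γ : Fin p → ℝ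
  /-- coefficients on the controls in the propensity score regression -/
  δ : Fin p → ℝ
  measurable_Y : Measurable Y
  measurable_D : Measurable D
  measurable_W : Measurable W

namespace PartiallyLinearModel

variable {Ω : Type*} [MeasurableSpace Ω] {n p : ℕ} (M : PartiallyLinearModel Ω n p)

/-- The outcome error `U i = Y i - D i * β - W i' γ`. -/
def U (i : Fin n) (ω : Ω) : ℝ := M.Y ω i - M.D ω i * M.β - ∑ j, M.W ω i j * M.γ j

/-- The propensity score error `Dtilde i = D i - W i' δ`. -/
def Dtilde (i : Fin n) (ω : Ω) : ℝ := M.D ω i - ∑ j, M.W ω i j * M.δ j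

/-- The σ-algebra generated by the matrix `W` of all controls. -/
abbrev sigmaW : MeasurableSpace Ω := MeasurableSpace.comap M.W inferInstance

/-- The σ-algebra generated by the single treatment `D i` and the matrix `W`. -/
abbrev sigmaDiW (i : Fin n) : MeasurableSpace Ω :=
  MeasurableSpace.comap (fun ω => (M.D ω i, M.W ω)) inferInstance

/-- The σ-algebra generated by the vector `D` of all treatments and the matrix `W`. -/
abbrev sigmaDW : MeasurableSpace Ω :=
  MeasurableSpace.comap (fun ω => (M.D ω, M.W ω)) inferInstance

/-- The column space of the `n × p` matrix of controls, as a subspace of Euclidean `n`-space. -/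
def controlSpace (ω : Ω) : Submodule ℝ (EuclideanSpace ℝ (Fin n)) :=
  Submodule.span ℝ (Set.range fun j : Fin p => WithLp.toLp 2 fun i : Fin n => M.W ω i j)

/-- The sample propensity score residuals `(I - P) D`, where `P` is the orthogonal projection onto
the column space of the controls. -/
def Dddot (ω : Ω) : EuclideanSpace ℝ (Fin n) :=
  WithLp.toLp 2 (M.D ω) - (M.controlSpace ω).starProjection (WithLp.toLp 2 (M.D ω))

/-- The OLS estimator of `β`. -/
def betaOLS (ω : Ω) : ℝ := (∑ i, M.Dddot ω i * M.Y ω i) / ∑ i, M.Dddot ω i ^ 2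

/-- The square of the standard error. -/
def seOLSSq (ω : Ω) : ℝ :=
  1 / (∑ i, M.Dddot ω i ^ 2) ^ 2 * ∑ i, M.Dddot ω i ^ 2 * M.U i ω ^ 2

/-- The standard error. -/
def seOLS (ω : Ω) : ℝ := √(M.seOLSSq ω)

/-- The errors are conditionally mean zero: `E[U i | D i, W] = 0` and `E[Dtilde i | W] = 0`. -/
structure MeanZeroErrors (μ : Measure Ω) : Prop where
  integrable_U : ∀ i, Integrable (M.U i) μ
  integrable_Dtilde : ∀ i, Integrable (M.Dtilde i) μ
  condExp_U : ∀ i, μ[M.U i | M.sigmaDiW i] =ᵐ[μ] 0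
  condExp_Dtilde : ∀ i, μ[M.Dtilde i | M.sigmaW] =ᵐ[μ] 0

/-- The conditions on sampling and on the regression errors, with constants `K` and `η`. -/
structure RegularErrors (μ : Measure Ω) (K η : ℝ) : Prop where
  /-- the pairs of errors are independent across observations, conditional on the controls -/
  condIndep : CondIndepGiven M.sigmaW (fun i ω => (M.U i ω, M.Dtilde i ω)) μ
  integrable_U : ∀ i, Integrable (fun ω => |M.U i ω| ^ (2 + η)) μ
  integrable_Dtilde : ∀ i, Integrable (fun ω => |M.Dtilde i ω| ^ 4) μ
  /-- the errors have bounded conditional moments -/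
  moments : ∀ i, ∀ᵐ ω ∂μ, (μ[fun ω => |M.U i ω| ^ (2 + η) | M.sigmaDW]) ω
    + (μ[fun ω => |M.Dtilde i ω| ^ 4 | M.sigmaW]) ω ≤ K
  /-- the conditional variances are positive -/
  variance_pos : ∀ i, ∀ᵐ ω ∂μ, 0 < (μ[fun ω => M.Dtilde i ω ^ 2 | M.sigmaW]) ω
    ∧ 0 < (μ[fun ω => M.U i ω ^ 2 | M.sigmaDW]) ω
  /-- the conditional variances are bounded away from zero -/
  nondegenerate : ∀ i, ∀ᵐ ω ∂μ, 1 / (μ[fun ω => M.Dtilde i ω ^ 2 | M.sigmaW]) ω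
    + 1 / (μ[fun ω => M.U i ω ^ 2 | M.sigmaDW]) ω ≤ K

end PartiallyLinearModel

end

/-! Put `M = I - P`. Since `M` annihilates the controls, `Dddot = M Dtilde`, and `betaOLS - β` is `∑
Dddot i * U i` divided by `∑ Dddot i ^ 2`. The standard error carries the same denominator, so when
it is nonzero the studentized estimator is the self-normalized sum `∑ a i * U i / √(∑ a i ^ 2 * U i
^ 2)` with weights `a = Dddot` that are functions of `(D, W)` (`studentized_eq`). Two facts then
suffice.

Conditional independence. Mean-zero errors are assumed given `(D i, W)` only, while the weights
depend on all of `D`. Independence of the pairs `(U i, Dtilde i)` given `W` closes the gap: by weak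
union (`condExp_others_sup`), once `D j` and `W` are known the other observations say nothing more
about `U j`. Hence the `U j` behave as independent centred variables given `(D, W)`. This is
recorded abstractly in `CondIndepSystem`, used once for `Dtilde` given `W` and once for `U` given
`(D, W)`.

Design. No single weight may dominate: `∑ a i ^ 4 / (∑ a i ^ 2) ^ 2` must be small. The sum of
squares is the quadratic form `Dtilde' M Dtilde`. Its conditional mean is at least `tr M / K ≥ (n -
p) / K`, of order `n` because `p / n` stays below one, and its fluctuations are of order `√n`
(`DesignErrors.measureReal_sum_residual_sq_le`). Rows of `M` have norm at most one, so each residual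
has a bounded fourth moment and `∑ a i ^ 4` is of order `n`
(`DesignErrors.integral_sum_residual_pow_four_le`). Thus `regularDesign` has probability tending to
one. Off it the weights are set to zero, so that their bounds hold surely.

Central limit theorem. With weights standardized to conditional variance one, the errors are
truncated and recentred, at a small mean-square cost. The characteristic function is treated by the
approximation `exp (i x) ≈ (1 + i x) exp (-x ^ 2 / 2)`: the product of the factors `1 + i t b j V j`
integrates to one against anything known given `(D, W)`, and `∑ b j ^ 2 * V j ^ 2` is close to its
conditional mean (`WeightedErrors.norm_integral_exp_sub_le`). The same law of large numbers sends `∑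
b j ^ 2 * U j ^ 2` to one, which permits self-normalization
(`WeightedErrors.tendsto_integral_exp_div`). -/

noncomputable section

/-! ### Conditional expectations given a join of two σ-algebras. -/

section CondExpFromInter

variable {Ω : Type*} {m₀ : MeasurableSpace Ω} {μ : Measure Ω}

/-- The sets `s ∩ t` form a π-system generating the join, and the sets on which two integrable
functions have equal integrals are closed under complements and countable disjoint unions. Having
`univ` in `S` puts `m₁` itself in the π-system. -/
theorem condExp_sup_eq_of_forall_inter [IsFiniteMeasure μ] {m₁ m₂ : MeasurableSpace Ω} (h₁ : m₁ ≤ m₀) (h₂ : m₂ ≤ m₀)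
    {S : Set (Set Ω)} (hS : IsPiSystem S) (hm₂ : m₂ = MeasurableSpace.generateFrom S)
    (huniv : Set.univ ∈ S) {f g : Ω → ℝ} (hf : Integrable f μ) (hg : Integrable g μ)
    (hgm : StronglyMeasurable[m₁ ⊔ m₂] g)
    (h : ∀ s, MeasurableSet[m₁] s → ∀ t ∈ S, ∫ x in s ∩ t, f x ∂μ = ∫ x in s ∩ t, g x ∂μ) :
    μ[f | m₁ ⊔ m₂] =ᵐ[μ] g := by
  have hle : m₁ ⊔ m₂ ≤ m₀ := sup_le h₁ h₂
  have hgen : m₁ ⊔ m₂ = MeasurableSpace.generateFrom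
      {u | ∃ s, MeasurableSet[m₁] s ∧ ∃ t ∈ S, u = s ∩ t} := by
    apply le_antisymm
    · refine sup_le (fun s hs => ?_) ?_
      · exact MeasurableSpace.measurableSet_generateFrom ⟨s, hs, _, huniv, by simp⟩
      · rw [hm₂]
        refine MeasurableSpace.generateFrom_le fun t ht => ?_
        exact MeasurableSpace.measurableSet_generateFrom
          ⟨Set.univ, @MeasurableSet.univ _ m₁, t, ht, by simp⟩
    · refine MeasurableSpace.generateFrom_le ?_
      rintro _ ⟨s, hs, t, ht, rfl⟩
      have hs' : MeasurableSet[m₁ ⊔ m₂] s := (le_sup_left : m₁ ≤ m₁ ⊔ m₂) s hs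
      have ht' : MeasurableSet[m₁ ⊔ m₂] t := (le_sup_right : m₂ ≤ m₁ ⊔ m₂) t
        (by rw [hm₂]; exact MeasurableSpace.measurableSet_generateFrom ht)
      exact @MeasurableSet.inter _ (m₁ ⊔ m₂) _ _ hs' ht'
  have hpi : IsPiSystem {u | ∃ s, MeasurableSet[m₁] s ∧ ∃ t ∈ S, u = s ∩ t} := by
    rintro _ ⟨s, hs, t, ht, rfl⟩ _ ⟨s', hs', t', ht', rfl⟩ hne
    refine ⟨s ∩ s', @MeasurableSet.inter _ m₁ _ _ hs hs', t ∩ t', hS t ht t' ht' ?_,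
      Set.inter_inter_inter_comm _ _ _ _⟩
    rw [Set.inter_inter_inter_comm] at hne
    exact hne.mono Set.inter_subset_right
  have hU : ∫ x, f x ∂μ = ∫ x, g x ∂μ := by
    simpa using h Set.univ (@MeasurableSet.univ _ m₁) Set.univ huniv
  refine (ae_eq_condExp_of_forall_setIntegral_eq hle hf (fun _ _ _ => hg.integrableOn) ?_
    hgm.aestronglyMeasurable).symm
  intro u hu _
  induction u, hu using MeasurableSpace.induction_on_inter hgen hpi with
  | empty => simp
  | basic t ht =>
    obtain ⟨s, hs, t, ht, rfl⟩ := ht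
    exact (h s hs t ht).symm
  | compl t htm ih =>
    have hf' := integral_add_compl (hle _ htm) hf
    have hg' := integral_add_compl (hle _ htm) hg
    have := ih (measure_lt_top _ _)
    linarith
  | iUnion A hd hA ih =>
    rw [integral_iUnion (fun i => hle _ (hA i)) hd hg.integrableOn,
      integral_iUnion (fun i => hle _ (hA i)) hd hf.integrableOn]
    exact tsum_congr fun i => ih i (measure_lt_top _ _)

theorem ae_norm_condExp_indicator_le {m : MeasurableSpace Ω} {T : Set Ω} :
    ∀ᵐ x ∂μ, ‖(μ⟦T | m⟧) x‖ ≤ 1 := by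
  have : ∀ᵐ x ∂μ, |(T.indicator (fun _ => (1 : ℝ))) x| ≤ 1 :=
    ae_of_all _ fun x => by by_cases hx : x ∈ T <;> simp [hx]
  simpa using ae_bdd_abs_condExp_of_ae_bdd_abs (m := m) this

theorem integrable_condExp_indicator_mul {m : MeasurableSpace Ω} {T : Set Ω} {φ : Ω → ℝ}
    (hφ : Integrable φ μ) : Integrable (fun ω => φ ω * (μ⟦T | m⟧) ω) μ :=
  hφ.mul_bdd (c := 1) integrable_condExp.aestronglyMeasurable ae_norm_condExp_indicator_le

/-- Self-adjointness of conditional expectation: both sides equal the integral of `μ[φ | m] * μ⟦T |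
m⟧`. -/
theorem setIntegral_condExp_eq_integral_mul [IsFiniteMeasure μ] {m : MeasurableSpace Ω} (hm : m ≤ m₀) {T : Set Ω}
    (hT : MeasurableSet[m₀] T) {φ : Ω → ℝ} (hφ : Integrable φ μ) :
    ∫ x in T, (μ[φ | m]) x ∂μ = ∫ x, φ x * (μ⟦T | m⟧) x ∂μ := by
  have h1 : Integrable (T.indicator fun _ => (1 : ℝ)) μ := (integrable_const 1).indicator hT
  have hb : ∀ᵐ x ∂μ, ‖T.indicator (fun _ => (1 : ℝ)) x‖ ≤ 1 :=
    ae_of_all _ fun x => by by_cases hx : x ∈ T <;> simp [hx]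
  calc ∫ x in T, (μ[φ | m]) x ∂μ
      = ∫ x, (μ[φ | m] * T.indicator fun _ => (1 : ℝ)) x ∂μ := by
        rw [← integral_indicator hT]
        congr 1 with x
        by_cases hx : x ∈ T <;> simp [hx]
    _ = ∫ x, (μ[μ[φ | m] * (T.indicator fun _ => (1 : ℝ)) | m]) x ∂μ := (integral_condExp hm).symm
    _ = ∫ x, (μ[φ | m] * μ⟦T | m⟧) x ∂μ := by
        refine integral_congr_ae ?_
        exact condExp_mul_of_stronglyMeasurable_left stronglyMeasurable_condExp
          (integrable_condExp.mul_bdd h1.aestronglyMeasurable hb) h1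
    _ = ∫ x, (μ[φ * μ⟦T | m⟧ | m]) x ∂μ := by
        refine integral_congr_ae ?_
        exact (condExp_mul_of_stronglyMeasurable_right stronglyMeasurable_condExp
          (integrable_condExp_indicator_mul hφ) hφ).symm
    _ = ∫ x, φ x * (μ⟦T | m⟧) x ∂μ := integral_condExp hm

end CondExpFromInter

/-! ### Consequences of conditional independence. -/

namespace CondIndepGiven

variable {Ω E ι : Type*} [MeasurableSpace E] {m m₀ : MeasurableSpace Ω}
  {μ : Measure Ω} [IsProbabilityMeasure μ] {X : ι → Ω → E}

/-- The σ-algebra generated by `m` and all `X k` with `k ≠ j`. -/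
abbrev others (m : MeasurableSpace Ω) (X : ι → Ω → E) (j : ι) : MeasurableSpace Ω :=
  m ⊔ ⨆ k ∈ {k : ι | k ≠ j}, MeasurableSpace.comap (X k) inferInstance

/-- The σ-algebra generated by `m` and `X j`. -/
abbrev own (m : MeasurableSpace Ω) (X : ι → Ω → E) (j : ι) : MeasurableSpace Ω :=
  m ⊔ MeasurableSpace.comap (X j) inferInstance

theorem others_le (hm : m ≤ m₀) (hX : ∀ i, Measurable (X i)) (j : ι) : others m X j ≤ m₀ :=
  sup_le hm (iSup₂_le fun k _ => (hX k).comap_le)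

theorem own_le (hm : m ≤ m₀) (hX : ∀ i, Measurable (X i)) (j : ι) : own m X j ≤ m₀ :=
  sup_le hm (hX j).comap_le

theorem own_le_others {j k : ι} (h : k ≠ j) : own m X k ≤ others m X j :=
  sup_le_sup_left (le_iSup₂_of_le (f := fun k (_ : k ∈ {k : ι | k ≠ j}) =>
    MeasurableSpace.comap (X k) inferInstance) k h le_rfl) m

/-- It is enough to test on `C ∩ T`, with `C` in `m` and `T` a finite intersection of events of the
other variables. Factorization over `insert j S` and over `S` together give `μ⟦X j ⁻¹' A ∩ T | m⟧`
as a product of two conditional probabilities. -/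
theorem condExp_preimage_others (hm : m ≤ m₀) (hX : ∀ i, Measurable (X i))
    (h : CondIndepGiven m X μ) (j : ι) {A : Set E} (hA : MeasurableSet A) :
    μ⟦X j ⁻¹' A | others m X j⟧ =ᵐ[μ] μ⟦X j ⁻¹' A | m⟧ := by
  classical
  have hAm : MeasurableSet (X j ⁻¹' A) := hX j hA
  refine condExp_sup_eq_of_forall_inter hm (iSup₂_le fun k _ => (hX k).comap_le)
    (S := piiUnionInter (fun k => {s | MeasurableSet[MeasurableSpace.comap (X k) inferInstance] s})
      {k : ι | k ≠ j}) (isPiSystem_piiUnionInter _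
        (fun k => @MeasurableSpace.isPiSystem_measurableSet _ (MeasurableSpace.comap (X k) _)) _)
    (generateFrom_piiUnionInter_measurableSet _ _).symm ⟨∅, by simp, fun _ => ∅, by simp⟩
    ((integrable_const 1).indicator hAm) integrable_condExp
    (stronglyMeasurable_condExp.mono le_sup_left) ?_
  rintro C hC _ ⟨S, hSj, f, hf, rfl⟩
  have hjS : j ∉ S := fun hj => hSj hj rfl
  choose! B hB hBf using hf
  -- One family of sets serves both index sets: it carries `A` at `j` and the test events elsewhere.
  let A' : ι → Set E := fun k => if k = j then A else B k
  have hA' : ∀ k ∈ insert j S, MeasurableSet (A' k) := by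
    intro k hk
    by_cases hkj : k = j
    · simpa [A', hkj] using hA
    · simpa [A', hkj] using hB k ((Finset.mem_insert.1 hk).resolve_left hkj)
  have hA'S : ∀ k ∈ S, A' k = B k := fun k hk => by
    simp [A', show k ≠ j from fun h => hjS (h ▸ hk)]
  set T : Set Ω := ⋂ k ∈ S, f k with hTdef
  have hT' : T = ⋂ k ∈ S, X k ⁻¹' A' k := by
    refine Set.iInter₂_congr fun k hk => ?_
    rw [hA'S k hk, hBf k hk]
  have hTm : MeasurableSet T := by
    rw [hT']
    exact Finset.measurableSet_biInter _
      fun k hk => hX k (hA' k (Finset.mem_insert_of_mem hk))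
  have e1 : ⋂ k ∈ insert j S, X k ⁻¹' A' k = X j ⁻¹' A ∩ T := by
    rw [Finset.set_biInter_insert, hT']
    simp [A']
  have h1 := h (insert j S) A' hA'
  have h2 := h S A' (fun k hk => hA' k (Finset.mem_insert_of_mem hk))
  rw [e1, Finset.prod_insert hjS] at h1
  rw [← hT'] at h2
  have e2 : A' j = A := by simp [A']
  rw [e2] at h1
  have h3 : μ⟦X j ⁻¹' A ∩ T | m⟧ =ᵐ[μ] μ⟦X j ⁻¹' A | m⟧ * μ⟦T | m⟧ := by
    filter_upwards [h1, h2] with ω hω hω2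
    rw [hω, Pi.mul_apply, Pi.mul_apply, ← hω2]
  have hCm := hm C hC
  have hTi : Integrable (T.indicator fun _ => (1 : ℝ)) μ := (integrable_const 1).indicator hTm
  have hTb : ∀ᵐ x ∂μ, ‖T.indicator (fun _ => (1 : ℝ)) x‖ ≤ 1 :=
    ae_of_all _ fun x => by by_cases hx : x ∈ T <;> simp [hx]
  have hmul : Integrable (μ⟦X j ⁻¹' A | m⟧ * T.indicator fun _ => (1 : ℝ)) μ :=
    integrable_condExp.mul_bdd hTi.aestronglyMeasurable hTb
  calc ∫ x in C ∩ T, (X j ⁻¹' A).indicator (fun _ => (1 : ℝ)) x ∂μ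
      = ∫ x in C, (X j ⁻¹' A ∩ T).indicator (fun _ => (1 : ℝ)) x ∂μ := by
        rw [← integral_indicator (hCm.inter hTm), ← integral_indicator hCm]
        congr 1 with x
        by_cases hx : x ∈ C <;> by_cases hx' : x ∈ T <;> simp [hx, hx', Set.indicator, Set.mem_inter_iff]
    _ = ∫ x in C, (μ⟦X j ⁻¹' A ∩ T | m⟧) x ∂μ :=
        (setIntegral_condExp hm ((integrable_const 1).indicator (hAm.inter hTm)) hC).symm
    _ = ∫ x in C, (μ⟦X j ⁻¹' A | m⟧ * μ⟦T | m⟧) x ∂μ :=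
        integral_congr_ae (ae_restrict_of_ae h3)
    _ = ∫ x in C, (μ[μ⟦X j ⁻¹' A | m⟧ * T.indicator (fun _ => (1 : ℝ)) | m]) x ∂μ :=
        integral_congr_ae (ae_restrict_of_ae
          (condExp_mul_of_stronglyMeasurable_left stronglyMeasurable_condExp hmul hTi).symm)
    _ = ∫ x in C, (μ⟦X j ⁻¹' A | m⟧ * T.indicator (fun _ => (1 : ℝ))) x ∂μ :=
        setIntegral_condExp hm hmul hC
    _ = ∫ x in C ∩ T, (μ⟦X j ⁻¹' A | m⟧) x ∂μ := by
        rw [← integral_indicator (hCm.inter hTm), ← integral_indicator hCm]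
        congr 1 with x
        by_cases hx : x ∈ C <;> by_cases hx' : x ∈ T <;> simp [hx, hx', Set.indicator, Set.mem_inter_iff]

/-- The mirror image of `condExp_preimage_others`; self-adjointness exchanges the roles of `T` and
the event of `X j`. -/
theorem condExp_indicator_own (hm : m ≤ m₀) (hX : ∀ i, Measurable (X i))
    (h : CondIndepGiven m X μ) (j : ι) {T : Set Ω} (hT : MeasurableSet[others m X j] T) :
    μ⟦T | own m X j⟧ =ᵐ[μ] μ⟦T | m⟧ := by
  have hle := others_le hm hX j
  have hTm : MeasurableSet T := hle T hT
  refine condExp_sup_eq_of_forall_inter hm (hX j).comap_le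
    (S := {s | MeasurableSet[MeasurableSpace.comap (X j) inferInstance] s})
    (@MeasurableSpace.isPiSystem_measurableSet _ (MeasurableSpace.comap (X j) _))
    (@MeasurableSpace.generateFrom_measurableSet _ (MeasurableSpace.comap (X j) _)).symm
    (@MeasurableSet.univ _ (MeasurableSpace.comap (X j) _))
    ((integrable_const 1).indicator hTm) integrable_condExp
    (stronglyMeasurable_condExp.mono le_sup_left) ?_
  rintro C hC _ ⟨A, hA, rfl⟩
  have hCm := hm C hC
  have hAm : MeasurableSet (X j ⁻¹' A) := hX j hA
  have hAi : Integrable ((X j ⁻¹' A).indicator fun _ => (1 : ℝ)) μ :=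
    (integrable_const 1).indicator hAm
  have hCT : MeasurableSet[others m X j] (C ∩ T) :=
    @MeasurableSet.inter _ (others m X j) _ _ ((le_sup_left : m ≤ others m X j) C hC) hT
  have hCA : Integrable ((C ∩ X j ⁻¹' A).indicator fun _ => (1 : ℝ)) μ :=
    (integrable_const 1).indicator (hCm.inter hAm)
  calc ∫ x in C ∩ X j ⁻¹' A, T.indicator (fun _ => (1 : ℝ)) x ∂μ
      = ∫ x in C ∩ T, (X j ⁻¹' A).indicator (fun _ => (1 : ℝ)) x ∂μ := by
        rw [← integral_indicator (hCm.inter hAm), ← integral_indicator (hCm.inter hTm)]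
        congr 1 with x
        rw [Set.indicator_indicator, Set.indicator_indicator, Set.inter_right_comm]
    _ = ∫ x in C ∩ T, (μ⟦X j ⁻¹' A | others m X j⟧) x ∂μ :=
        (setIntegral_condExp hle hAi hCT).symm
    _ = ∫ x in C ∩ T, (μ⟦X j ⁻¹' A | m⟧) x ∂μ :=
        integral_congr_ae (ae_restrict_of_ae (condExp_preimage_others hm hX h j hA))
    _ = ∫ x in T, (C.indicator (μ⟦X j ⁻¹' A | m⟧)) x ∂μ := by
        rw [← integral_indicator (hCm.inter hTm), ← integral_indicator hTm]
        congr 1 with x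
        by_cases hx : x ∈ C <;> by_cases hx' : x ∈ T <;> simp [hx, hx', Set.indicator, Set.mem_inter_iff]
    _ = ∫ x in T, (μ⟦C ∩ X j ⁻¹' A | m⟧) x ∂μ := by
        refine integral_congr_ae (ae_restrict_of_ae ?_)
        rw [← Set.indicator_indicator]
        exact (condExp_indicator hAi hC).symm
    _ = ∫ x, (C ∩ X j ⁻¹' A).indicator (fun _ => (1 : ℝ)) x * (μ⟦T | m⟧) x ∂μ :=
        setIntegral_condExp_eq_integral_mul hm hTm hCA
    _ = ∫ x in C ∩ X j ⁻¹' A, (μ⟦T | m⟧) x ∂μ := by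
        rw [← integral_indicator (hCm.inter hAm)]
        congr 1 with x
        by_cases hx : x ∈ C ∩ X j ⁻¹' A <;> simp [hx]

/-- Given `m`, functions of the `j`-th variable do not depend on the other variables. -/
theorem condExp_others (hm : m ≤ m₀) (hX : ∀ i, Measurable (X i))
    (h : CondIndepGiven m X μ) (j : ι) {φ : Ω → ℝ} (hφ : Integrable φ μ)
    (hφm : StronglyMeasurable[own m X j] φ) :
    μ[φ | others m X j] =ᵐ[μ] μ[φ | m] := by
  have hle := others_le hm hX j
  have hle' := own_le hm hX j
  refine (ae_eq_condExp_of_forall_setIntegral_eq hle hφ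
    (fun _ _ _ => integrable_condExp.integrableOn) ?_
    (stronglyMeasurable_condExp.mono (le_sup_left : m ≤ others m X j)).aestronglyMeasurable).symm
  intro T hT _
  have hTm := hle T hT
  have hTi : Integrable (T.indicator fun _ => (1 : ℝ)) μ := (integrable_const 1).indicator hTm
  have hTb : ∀ᵐ x ∂μ, ‖T.indicator (fun _ => (1 : ℝ)) x‖ ≤ 1 :=
    ae_of_all _ fun x => by by_cases hx : x ∈ T <;> simp [hx]
  -- Moving the conditioning from `φ` to `T` reduces the claim to `condExp_indicator_own`, so no
  -- approximation of `φ` by simple functions is needed.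
  rw [setIntegral_condExp_eq_integral_mul hm hTm hφ]
  symm
  calc ∫ x in T, φ x ∂μ = ∫ x, (φ * T.indicator fun _ => (1 : ℝ)) x ∂μ := by
        rw [← integral_indicator hTm]
        congr 1 with x
        by_cases hx : x ∈ T <;> simp [hx]
    _ = ∫ x, (μ[φ * T.indicator (fun _ => (1 : ℝ)) | own m X j]) x ∂μ :=
        (integral_condExp hle').symm
    _ = ∫ x, φ x * (μ⟦T | own m X j⟧) x ∂μ :=
        integral_congr_ae (condExp_mul_of_stronglyMeasurable_left hφm
          (hφ.mul_bdd hTi.aestronglyMeasurable hTb) hTi)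
    _ = ∫ x, φ x * (μ⟦T | m⟧) x ∂μ := by
        refine integral_congr_ae ?_
        filter_upwards [condExp_indicator_own hm hX h j hT] with x hx
        rw [hx]

/-- Weak union: conditioning in addition on a σ-algebra `b` generated by `m` and part of the `j`-th
variable preserves conditional independence. -/
theorem condExp_others_sup (hm : m ≤ m₀) (hX : ∀ i, Measurable (X i))
    (h : CondIndepGiven m X μ) (j : ι) {b : MeasurableSpace Ω} (hb : b ≤ own m X j) (hmb : m ≤ b)
    {φ : Ω → ℝ} (hφ : Integrable φ μ) (hφm : StronglyMeasurable[own m X j] φ) :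
    μ[φ | others m X j ⊔ b] =ᵐ[μ] μ[φ | b] := by
  have hle := others_le hm hX j
  have hb0 : b ≤ m₀ := hb.trans (own_le hm hX j)
  refine condExp_sup_eq_of_forall_inter hle hb0 (S := {s | MeasurableSet[b] s})
    (@MeasurableSpace.isPiSystem_measurableSet _ b)
    (@MeasurableSpace.generateFrom_measurableSet _ b).symm
    (@MeasurableSet.univ _ b) hφ integrable_condExp
    (stronglyMeasurable_condExp.mono le_sup_right) ?_
  intro T hT B hB
  have hTm := hle T hT
  have hBm := hb0 B hB
  -- On sets of `others m X j`, functions of the `j`-th variable may be replaced by their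
  -- conditional expectation given `m`. Applied to the restrictions to `B` of `φ` and of `μ[φ | b]`,
  -- this gives the same result by the tower property.
  have key : ∀ ψ : Ω → ℝ, Integrable ψ μ → StronglyMeasurable[own m X j] ψ →
      ∫ x in T, ψ x ∂μ = ∫ x in T, (μ[ψ | m]) x ∂μ := by
    intro ψ hψ hψm
    rw [← setIntegral_condExp hle hψ hT]
    exact integral_congr_ae (ae_restrict_of_ae (condExp_others hm hX h j hψ hψm))
  have hind : ∀ ψ : Ω → ℝ, ∫ x in T ∩ B, ψ x ∂μ = ∫ x in T, B.indicator ψ x ∂μ := fun ψ => by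
    rw [← integral_indicator (hTm.inter hBm), ← integral_indicator hTm, Set.indicator_indicator]
  rw [hind, hind, key _ (hφ.indicator hBm) (hφm.indicator (hb B hB)),
    key _ (integrable_condExp.indicator hBm)
      ((stronglyMeasurable_condExp.mono hb).indicator (hb B hB))]
  refine integral_congr_ae (ae_restrict_of_ae ?_)
  have h1 : μ[B.indicator (μ[φ | b]) | m] =ᵐ[μ] μ[μ[B.indicator φ | b] | m] :=
    condExp_congr_ae (condExp_indicator hφ hB).symm
  exact (h1.trans (condExp_condExp_of_le hmb hb0)).symm

end CondIndepGiven

/-! ### Orthogonality and second moments. -/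

section Orthogonality

variable {Ω : Type*} {m : MeasurableSpace Ω} {m₀ : MeasurableSpace Ω} {μ : Measure Ω}

theorem integral_mul_eq_zero_of_condExp_eq_zero [IsFiniteMeasure μ] (hm : m ≤ m₀) {h ζ : Ω → ℝ}
    (hh : StronglyMeasurable[m] h) (hζ : Integrable ζ μ) (hi : Integrable (fun ω => h ω * ζ ω) μ)
    (h0 : μ[ζ | m] =ᵐ[μ] 0) : ∫ ω, h ω * ζ ω ∂μ = 0 := by
  rw [← integral_condExp hm]
  refine integral_eq_zero_of_ae ?_
  filter_upwards [condExp_mul_of_stronglyMeasurable_left (f := h) (g := ζ) hh hi hζ, h0]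
    with ω h1 h2
  change (μ[h * ζ | m]) ω = 0
  simp [h1, h2]

theorem integral_mul_le_of_condExp_le [IsFiniteMeasure μ] (hm : m ≤ m₀) {c ψ : Ω → ℝ} {B : ℝ}
    (hc : StronglyMeasurable[m] c) (hc0 : ∀ ω, 0 ≤ c ω) (hci : Integrable c μ)
    (hψ : Integrable ψ μ) (hi : Integrable (fun ω => c ω * ψ ω) μ) (hB : ∀ᵐ ω ∂μ, (μ[ψ | m]) ω ≤ B) :
    ∫ ω, c ω * ψ ω ∂μ ≤ B * ∫ ω, c ω ∂μ := by
  rw [← integral_condExp hm, ← integral_const_mul]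
  refine integral_mono_ae integrable_condExp (hci.const_mul B) ?_
  filter_upwards [condExp_mul_of_stronglyMeasurable_left (f := c) (g := ψ) hc hi hψ, hB]
    with ω h1 h2
  change (μ[c * ψ | m]) ω ≤ B * c ω
  rw [h1, Pi.mul_apply, mul_comm]
  exact mul_le_mul_of_nonneg_right h2 (hc0 ω)

theorem integral_sum_sq_of_orthogonal {ι : Type*} {x : ι → Ω → ℝ} (s : Finset ι)
    (hx : ∀ j ∈ s, MemLp (x j) 2 μ)
    (horth : ∀ j ∈ s, ∀ k ∈ s, j ≠ k → ∫ ω, x j ω * x k ω ∂μ = 0) :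
    ∫ ω, (∑ j ∈ s, x j ω) ^ 2 ∂μ = ∑ j ∈ s, ∫ ω, x j ω ^ 2 ∂μ := by
  classical
  induction s using Finset.induction_on with
  | empty => simp
  | insert a s ha ih =>
    have hS : MemLp (fun ω => ∑ j ∈ s, x j ω) 2 μ :=
      memLp_finsetSum s fun j hj => hx j (Finset.mem_insert_of_mem hj)
    have hXa := hx a (Finset.mem_insert_self a s)
    have hcross : ∀ j ∈ s, Integrable (fun ω => x a ω * x j ω) μ := fun j hj =>
      hXa.integrable_mul (hx j (Finset.mem_insert_of_mem hj))
    have h0 : ∫ ω, x a ω * ∑ j ∈ s, x j ω ∂μ = 0 := by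
      simp_rw [Finset.mul_sum]
      rw [integral_finsetSum _ hcross]
      refine Finset.sum_eq_zero fun j hj => ?_
      exact horth a (Finset.mem_insert_self a s) j (Finset.mem_insert_of_mem hj)
        (fun h => ha (h ▸ hj))
    have hi1 : Integrable (fun ω => x a ω ^ 2) μ := hXa.integrable_sq
    have hi2 : Integrable (fun ω => 2 * (x a ω * ∑ j ∈ s, x j ω)) μ :=
      (hXa.integrable_mul hS).const_mul 2
    have hi3 : Integrable (fun ω => (∑ j ∈ s, x j ω) ^ 2) μ := hS.integrable_sq
    rw [Finset.sum_insert ha, ← ih (fun j hj => hx j (Finset.mem_insert_of_mem hj))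
      (fun j hj k hk => horth j (Finset.mem_insert_of_mem hj) k (Finset.mem_insert_of_mem hk))]
    have : ∀ ω, (∑ j ∈ insert a s, x j ω) ^ 2
        = (x a ω ^ 2 + 2 * (x a ω * ∑ j ∈ s, x j ω)) + (∑ j ∈ s, x j ω) ^ 2 := fun ω => by
      rw [Finset.sum_insert ha]; ring
    simp_rw [this]
    rw [integral_add (f := fun ω => x a ω ^ 2 + 2 * (x a ω * ∑ j ∈ s, x j ω)) (hi1.add hi2) hi3,
      integral_add hi1 hi2, integral_const_mul, h0]
    ring

/-- This is nonnegativity of the variance of `|X|`. -/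
theorem integral_abs_le_sqrt [IsProbabilityMeasure μ] {X : Ω → ℝ} (hX : MemLp X 2 μ) :
    ∫ ω, |X ω| ∂μ ≤ √(∫ ω, X ω ^ 2 ∂μ) := by
  apply Real.le_sqrt_of_sq_le
  have h := variance_nonneg |X| μ
  rw [variance_eq_sub hX.abs] at h
  simp only [Pi.pow_apply, Pi.abs_apply, sq_abs] at h
  linarith

theorem memLp_mul_of_bound {p : ℝ≥0∞} {c ζ : Ω → ℝ} {C : ℝ} (hζ : MemLp ζ p μ)
    (hc : AEStronglyMeasurable c μ) (hb : ∀ ω, |c ω| ≤ C) : MemLp (fun ω => c ω * ζ ω) p μ := by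
  refine MemLp.of_le_mul (c := C) hζ (hc.mul hζ.1) (ae_of_all _ fun ω => ?_)
  rw [norm_mul]
  exact mul_le_mul_of_nonneg_right (hb ω) (norm_nonneg _)

end Orthogonality

/-! ### Conditionally independent systems and truncation. -/

/-- A finite family of σ-algebras `loc j` which are conditionally independent given `G`: given the
σ-algebra `rest j`, which contains `G` and all `loc k` with `k ≠ j`, the conditional expectation of
a `loc j`-measurable variable depends on `base j` alone. -/
structure CondIndepSystem {Ω ι : Type*} (G : MeasurableSpace Ω)
    (base loc rest : ι → MeasurableSpace Ω) {m₀ : MeasurableSpace Ω} (μ : Measure Ω) : Prop where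
  base_le : ∀ j, base j ≤ G
  base_le_loc : ∀ j, base j ≤ loc j
  le_rest : ∀ j, G ≤ rest j
  loc_le_rest : ∀ j k, k ≠ j → loc k ≤ rest j
  loc_le : ∀ j, loc j ≤ m₀
  rest_le : ∀ j, rest j ≤ m₀
  le : G ≤ m₀
  condExp_rest : ∀ (j : ι) (φ : Ω → ℝ), Integrable φ μ → StronglyMeasurable[loc j] φ →
    μ[φ | rest j] =ᵐ[μ] μ[φ | base j]

namespace CondIndepSystem

variable {Ω ι : Type*} {G : MeasurableSpace Ω} {base loc rest : ι → MeasurableSpace Ω}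
  {m₀ : MeasurableSpace Ω} {μ : Measure Ω} [IsProbabilityMeasure μ]

/-- Conditioning first on `rest j`, which contains `G`, leaves a `base j`-measurable function, and
`base j ≤ G`. -/
theorem condExp_eq (h : CondIndepSystem G base loc rest μ) {j : ι} {φ : Ω → ℝ}
    (hφ : Integrable φ μ) (hφm : StronglyMeasurable[loc j] φ) : μ[φ | G] =ᵐ[μ] μ[φ | base j] := by
  have h1 : μ[μ[φ | rest j] | G] =ᵐ[μ] μ[μ[φ | base j] | G] :=
    condExp_congr_ae (h.condExp_rest j φ hφ hφm)
  have h2 : μ[μ[φ | rest j] | G] =ᵐ[μ] μ[φ | G] := condExp_condExp_of_le (h.le_rest j) (h.rest_le j)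
  have h3 : μ[μ[φ | base j] | G] = μ[φ | base j] := condExp_of_stronglyMeasurable h.le
    (stronglyMeasurable_condExp.mono (h.base_le j)) integrable_condExp
  exact h2.symm.trans (h1.trans (by rw [h3]))

/-- In a cross term everything except `ζ k` is known given `rest k`, and `ζ k` is centred given
`rest k`. -/
theorem integral_sum_sq (h : CondIndepSystem G base loc rest μ) (s : Finset ι) {c ζ : ι → Ω → ℝ}
    {C : ℝ} (hc : ∀ j, StronglyMeasurable[G] (c j)) (hcb : ∀ j ω, |c j ω| ≤ C)
    (hζm : ∀ j, StronglyMeasurable[loc j] (ζ j)) (hζ : ∀ j, MemLp (ζ j) 2 μ)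
    (hζ0 : ∀ j, μ[ζ j | base j] =ᵐ[μ] 0) :
    ∫ ω, (∑ j ∈ s, c j ω * ζ j ω) ^ 2 ∂μ = ∑ j ∈ s, ∫ ω, c j ω ^ 2 * ζ j ω ^ 2 ∂μ := by
  have hL : ∀ j, MemLp (fun ω => c j ω * ζ j ω) 2 μ := fun j =>
    memLp_mul_of_bound (hζ j) ((hc j).mono h.le).aestronglyMeasurable (hcb j)
  rw [integral_sum_sq_of_orthogonal s (fun j _ => hL j)]
  · exact Finset.sum_congr rfl fun j _ => integral_congr_ae (ae_of_all _ fun ω => mul_pow _ _ _)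
  · intro j _ k _ hjk
    have hk0 : μ[ζ k | rest k] =ᵐ[μ] 0 :=
      (h.condExp_rest k (ζ k) ((hζ k).integrable one_le_two) (hζm k)).trans (hζ0 k)
    have hm1 : StronglyMeasurable[rest k] (fun ω => c j ω * ζ j ω * c k ω) :=
      (((hc j).mono (h.le_rest k)).mul ((hζm j).mono (h.loc_le_rest k j hjk))).mul
        ((hc k).mono (h.le_rest k))
    have hi := (hL j).integrable_mul (hL k)
    have heq : ∀ ω, c j ω * ζ j ω * (c k ω * ζ k ω) = c j ω * ζ j ω * c k ω * ζ k ω :=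
      fun ω => by ring
    have hi' : Integrable (fun ω => c j ω * ζ j ω * c k ω * ζ k ω) μ :=
      hi.congr (ae_of_all _ heq)
    simp_rw [heq]
    exact integral_mul_eq_zero_of_condExp_eq_zero (h.rest_le k) hm1
      ((hζ k).integrable one_le_two) hi' hk0

/-- Centred truncation of a conditionally centred variable. -/
theorem exists_bounded_approx (h : CondIndepSystem G base loc rest μ) {j : ι} {U : Ω → ℝ}
    {K η L : ℝ} (hη : 0 < η) (hL : 0 < L) (hUm : StronglyMeasurable[loc j] U)
    (hUi : Integrable (fun ω => |U ω| ^ (2 + η)) μ) (hU2 : MemLp U 2 μ)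
    (hU0 : μ[U | base j] =ᵐ[μ] 0)
    (hK : ∀ᵐ ω ∂μ, (μ[fun ω => |U ω| ^ (2 + η) | G]) ω ≤ K) :
    ∃ V : Ω → ℝ, StronglyMeasurable[loc j] V ∧ (∀ ω, |V ω| ≤ 2 * L) ∧ μ[V | base j] =ᵐ[μ] 0 ∧
      ∀ᵐ ω ∂μ, (μ[fun ω => (U ω - V ω) ^ 2 | G]) ω ≤ K * L ^ (-η) := by
  have hbase : base j ≤ m₀ := (h.base_le j).trans h.le
  set f : Ω → ℝ := fun ω => if |U ω| ≤ L then U ω else 0 with hf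
  have hfm : StronglyMeasurable[loc j] f := by
    have hT : Measurable fun u : ℝ => if |u| ≤ L then u else 0 :=
      Measurable.ite (measurableSet_le (by fun_prop) measurable_const) measurable_id
        measurable_const
    exact (hT.comp hUm.measurable).stronglyMeasurable
  have hfb : ∀ ω, |f ω| ≤ L := fun ω => by
    simp only [hf]; split_ifs with hω
    · exact hω
    · simpa using hL.le
  have hfi : MemLp f 2 μ := MemLp.of_bound (hfm.mono (h.loc_le j)).aestronglyMeasurable L
    (ae_of_all _ hfb)
  -- The clamp makes the bound hold at every point; it agrees almost surely with the conditional
  -- mean of the truncated variable.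
  set g : Ω → ℝ := fun ω => max (-L) (min L ((μ[f | base j]) ω)) with hg
  have hgm : StronglyMeasurable[base j] g := by
    have hT : Measurable fun u : ℝ => max (-L) (min L u) := by fun_prop
    exact (hT.comp (stronglyMeasurable_condExp (m := base j)).measurable).stronglyMeasurable
  have hgb : ∀ ω, |g ω| ≤ L := fun ω => by
    rw [abs_le]
    exact ⟨le_max_left _ _, max_le (by linarith) (min_le_left _ _)⟩
  have hge : g =ᵐ[μ] μ[f | base j] := by
    filter_upwards [ae_bdd_abs_condExp_of_ae_bdd_abs (m := base j) (ae_of_all μ hfb)] with ω hω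
    rw [abs_le] at hω
    simp only [hg]
    rw [min_eq_right hω.2, max_eq_right hω.1]
  have hgi : MemLp g 2 μ := MemLp.of_bound (hgm.mono hbase).aestronglyMeasurable L
    (ae_of_all _ hgb)
  have hfi1 := hfi.integrable one_le_two
  have hgi1 := hgi.integrable one_le_two
  have hUi1 := hU2.integrable one_le_two
  refine ⟨fun ω => f ω - g ω, hfm.sub (hgm.mono (h.base_le_loc j)), fun ω => ?_, ?_, ?_⟩
  · have := abs_sub (f ω) (g ω)
    linarith [hfb ω, hgb ω]
  · have h1 := condExp_sub hfi1 hgi1 (base j)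
    have h2 : μ[g | base j] = g := condExp_of_stronglyMeasurable hbase hgm hgi1
    filter_upwards [h1, hge] with ω h1 h3
    change (μ[f - g | base j]) ω = 0
    rw [h1, Pi.sub_apply, h2, h3, sub_self]
  · set w : Ω → ℝ := fun ω => U ω - f ω with hw
    have hwi : MemLp w 2 μ := hU2.sub hfi
    have hwm : StronglyMeasurable[loc j] w := hUm.sub hfm
    have hwG : μ[w | G] =ᵐ[μ] fun ω => - g ω := by
      have h1 := condExp_sub hUi1 hfi1 (base j)
      filter_upwards [h.condExp_eq (hwi.integrable one_le_two) hwm, h1, hge, hU0]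
        with ω e1 e2 e3 e4
      rw [e1]
      change (μ[U - f | base j]) ω = _
      rw [e2, Pi.sub_apply, e4, e3]
      simp
    -- The approximation error is the discarded tail `w = U - f` minus its conditional mean, because
    -- `U` is centred and so `μ[w | G] = -g`. Its conditional mean square is therefore a conditional
    -- variance, at most that of `w ^ 2`.
    have hcv : μ[fun ω => (U ω - (f ω - g ω)) ^ 2 | G] =ᵐ[μ] condVar G w μ := by
      refine condExp_congr_ae ?_
      filter_upwards [hwG] with ω hω
      rw [Pi.pow_apply, Pi.sub_apply, hω]
      ring
    -- The tail lives where `|U| > L`, and there `1 ≤ L ^ (-η) * |U| ^ η`.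
    have hw2 : ∀ ω, w ω ^ 2 ≤ L ^ (-η) * |U ω| ^ (2 + η) := by
      intro ω
      simp only [hw, hf]
      split_ifs with hω
      · simp only [sub_self, ne_eq, OfNat.ofNat_ne_zero, not_false_eq_true, zero_pow]
        positivity
      · push Not at hω
        have hpos : 0 < |U ω| := hL.trans hω
        rw [sub_zero, Real.rpow_add hpos, Real.rpow_neg hL.le, ← sq_abs]
        have h1 : L ^ η ≤ |U ω| ^ η := Real.rpow_le_rpow hL.le hω.le hη.le
        have h2 : 0 < L ^ η := Real.rpow_pos_of_pos hL _
        rw [Real.rpow_two]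
        have : (1 : ℝ) ≤ (L ^ η)⁻¹ * |U ω| ^ η := by
          rw [← inv_mul_cancel₀ h2.ne']
          exact mul_le_mul_of_nonneg_left h1 (inv_nonneg.2 h2.le)
        nlinarith [sq_nonneg (|U ω|)]
    have hmono : μ[fun ω => w ω ^ 2 | G] ≤ᵐ[μ] μ[fun ω => L ^ (-η) * |U ω| ^ (2 + η) | G] :=
      condExp_mono hwi.integrable_sq (hUi.const_mul _) (ae_of_all _ hw2)
    have hsm : μ[fun ω => L ^ (-η) * |U ω| ^ (2 + η) | G]
        =ᵐ[μ] L ^ (-η) • μ[fun ω => |U ω| ^ (2 + η) | G] := condExp_smul (L ^ (-η)) _ G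
    filter_upwards [hcv, condVar_ae_le_condExp_sq h.le hwi, hmono, hsm, hK] with ω e1 e2 e3 e4 e5
    rw [e1]
    refine e2.trans (e3.trans ?_)
    rw [e4, Pi.smul_apply, smul_eq_mul, mul_comm]
    exact mul_le_mul_of_nonneg_right e5 (Real.rpow_nonneg hL.le _)

end CondIndepSystem

/-! ### Product approximation of the exponential of a sum. -/

section CharacteristicProduct

theorem norm_prod_sub_prod_le_sum {ι : Type*} (s : Finset ι) {a b : ι → ℂ}
    (ha : ∀ j ∈ s, ‖a j‖ ≤ 1) (hb : ∀ j ∈ s, ‖b j‖ ≤ 1) :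
    ‖∏ j ∈ s, a j - ∏ j ∈ s, b j‖ ≤ ∑ j ∈ s, ‖a j - b j‖ := by
  classical
  induction s using Finset.induction_on with
  | empty => simp
  | insert i s hi ih =>
    have ha' : ∀ j ∈ s, ‖a j‖ ≤ 1 := fun j hj => ha j (Finset.mem_insert_of_mem hj)
    have hb' : ∀ j ∈ s, ‖b j‖ ≤ 1 := fun j hj => hb j (Finset.mem_insert_of_mem hj)
    rw [Finset.prod_insert hi, Finset.prod_insert hi, Finset.sum_insert hi]
    have e : a i * ∏ j ∈ s, a j - b i * ∏ j ∈ s, b j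
        = (a i - b i) * ∏ j ∈ s, a j + b i * (∏ j ∈ s, a j - ∏ j ∈ s, b j) := by ring
    have h1 : ‖∏ j ∈ s, a j‖ ≤ 1 := by
      rw [norm_prod]
      exact Finset.prod_le_one (fun _ _ => norm_nonneg _) ha'
    rw [e]
    refine (norm_add_le _ _).trans ?_
    rw [norm_mul, norm_mul]
    refine add_le_add (mul_le_of_le_one_right (norm_nonneg _) h1) ?_
    exact (mul_le_of_le_one_left (norm_nonneg _) (hb i (Finset.mem_insert_self _ _))).trans
      (ih ha' hb')

/-- The squared modulus is `1 + x ^ 2`, which is at most `exp (x ^ 2)`. -/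
theorem norm_one_add_mul_I_le (x : ℝ) : ‖1 + (x : ℂ) * Complex.I‖ ≤ Real.exp (x ^ 2 / 2) := by
  have h1 : ‖1 + (x : ℂ) * Complex.I‖ ^ 2 = 1 + x ^ 2 := by
    rw [← Complex.normSq_eq_norm_sq]
    have := Complex.normSq_add_mul_I 1 x
    simpa using this
  have h2 : Real.exp (x ^ 2 / 2) ^ 2 = Real.exp (x ^ 2) := by
    rw [← Real.exp_nat_mul]; congr 1; push_cast; ring
  have h3 : 1 + x ^ 2 ≤ Real.exp (x ^ 2) := by linarith [Real.add_one_le_exp (x ^ 2)]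
  refine (pow_le_pow_iff_left₀ (norm_nonneg _) (Real.exp_pos _).le two_ne_zero).1 ?_
  rw [h1, h2]; exact h3

/-- The second-order terms of `exp (i x)` are carried by the Gaussian factor, leaving the factor `1
+ i x`, whose products have conditional mean one when the `x`'s are centred and conditionally
independent. The remainder is cubic. -/
theorem norm_exp_mul_I_sub_le (x : ℝ) :
    ‖Complex.exp (x * Complex.I) - (1 + x * Complex.I) * Real.exp (-(x ^ 2 / 2))‖
      ≤ 17 * |x| ^ 3 := by
  have hE : ‖(Real.exp (-(x ^ 2 / 2)) : ℂ)‖ = Real.exp (-(x ^ 2 / 2)) := by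
    rw [Complex.norm_real, Real.norm_eq_abs, Real.abs_exp]
  have hT : ‖(1 + x * Complex.I) * Real.exp (-(x ^ 2 / 2))‖ ≤ 1 := by
    rw [norm_mul, hE]
    calc _ ≤ Real.exp (x ^ 2 / 2) * Real.exp (-(x ^ 2 / 2)) :=
          mul_le_mul_of_nonneg_right (norm_one_add_mul_I_le x) (Real.exp_pos _).le
      _ = 1 := by rw [← Real.exp_add]; simp
  -- For `|x| ≥ 1` both terms have modulus at most one, so the difference is at most two.
  rcases le_or_gt 1 |x| with hx | hx
  · have : (1 : ℝ) ≤ |x| ^ 3 := one_le_pow₀ hx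
    have h := norm_sub_le (Complex.exp (x * Complex.I))
      ((1 + x * Complex.I) * Real.exp (-(x ^ 2 / 2)))
    rw [Complex.norm_exp_ofReal_mul_I] at h
    linarith
  -- Factoring out `exp (-x ^ 2 / 2)` leaves `exp z - (1 + i x)` with `z = i x + x ^ 2 / 2`. In the
  -- quadratic Taylor polynomial of `exp z` the terms of order `x ^ 2` cancel. The Taylor remainder
  -- is at most `(3 / 2) ^ 3 * 4.5 ≤ 16` times `|x| ^ 3`, and the uncancelled terms account for one
  -- more.
  · set z : ℂ := x * Complex.I + x ^ 2 / 2 with hz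
    have hfac : Complex.exp (x * Complex.I) - (1 + x * Complex.I) * Real.exp (-(x ^ 2 / 2))
        = (Complex.exp z - (1 + x * Complex.I)) * Real.exp (-(x ^ 2 / 2)) := by
      rw [sub_mul]
      congr 1
      rw [hz, Complex.ofReal_exp, ← Complex.exp_add]
      congr 1; push_cast; ring
    have hE1 : Real.exp (-(x ^ 2 / 2)) ≤ 1 := Real.exp_le_one_iff.2 (by nlinarith [sq_nonneg x])
    have hx0 := abs_nonneg x
    have hx2 : |x| ^ 2 ≤ |x| := by nlinarith
    have hzn : ‖z‖ ≤ 3 / 2 * |x| := by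
      calc ‖z‖ ≤ ‖(x : ℂ) * Complex.I‖ + ‖((x : ℂ) ^ 2 / 2)‖ := norm_add_le _ _
        _ = |x| + |x| ^ 2 / 2 := by
          rw [norm_mul, Complex.norm_I, mul_one, norm_div, norm_pow, Complex.norm_real]
          simp
        _ ≤ 3 / 2 * |x| := by linarith
    have h3 := Complex.norm_exp_sub_sum_le_norm_mul_exp z 3
    have hs : ∑ m ∈ Finset.range 3, z ^ m / (m.factorial : ℂ) = 1 + z + z ^ 2 / 2 := by
      simp [Finset.sum_range_succ, Nat.factorial]
    rw [hs] at h3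
    have hexp : Real.exp ‖z‖ ≤ 4.5 := by
      have h1 : Real.exp ‖z‖ ≤ Real.exp (3 / 2) := Real.exp_le_exp.2 (by linarith)
      have h2 : Real.exp (3 / 2) ^ 2 = Real.exp 1 ^ 3 := by
        rw [← Real.exp_nat_mul, ← Real.exp_nat_mul]; congr 1; norm_num
      have h4 : Real.exp 1 ^ 3 ≤ 2.7182818286 ^ 3 :=
        pow_le_pow_left₀ (Real.exp_pos _).le Real.exp_one_lt_d9.le 3
      have h5 : Real.exp (3 / 2) ≤ 4.5 := by
        refine (pow_le_pow_iff_left₀ (Real.exp_pos _).le (by norm_num) two_ne_zero).1 ?_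
        rw [h2]; refine h4.trans (by norm_num)
      linarith
    have hb1 : ‖Complex.exp z - (1 + z + z ^ 2 / 2)‖ ≤ 16 * |x| ^ 3 := by
      refine h3.trans ?_
      have hz3 : ‖z‖ ^ 3 ≤ (3 / 2 * |x|) ^ 3 := pow_le_pow_left₀ (norm_nonneg _) hzn 3
      calc ‖z‖ ^ 3 * Real.exp ‖z‖ ≤ (3 / 2 * |x|) ^ 3 * 4.5 :=
            mul_le_mul hz3 hexp (Real.exp_pos _).le (by positivity)
        _ ≤ 16 * |x| ^ 3 := by
          have : 0 ≤ |x| ^ 3 := by positivity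
          nlinarith
    have hI : Complex.I ^ 2 = -1 := Complex.I_sq
    have hb2 : (1 + z + z ^ 2 / 2) - (1 + x * Complex.I)
        = (x : ℂ) ^ 3 * Complex.I / 2 + (x : ℂ) ^ 4 / 8 := by
      rw [hz]
      linear_combination (x : ℂ) ^ 2 / 2 * hI
    have hb3 : ‖(1 + z + z ^ 2 / 2) - (1 + x * Complex.I)‖ ≤ |x| ^ 3 := by
      rw [hb2]
      calc _ ≤ ‖(x : ℂ) ^ 3 * Complex.I / 2‖ + ‖(x : ℂ) ^ 4 / 8‖ := norm_add_le _ _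
        _ = |x| ^ 3 / 2 + |x| ^ 4 / 8 := by
          rw [norm_div, norm_mul, norm_pow, Complex.norm_I, mul_one, norm_div, norm_pow,
            Complex.norm_real]
          simp
        _ ≤ |x| ^ 3 := by
          have : |x| ^ 4 ≤ |x| ^ 3 := pow_le_pow_of_le_one hx0 hx.le (by norm_num)
          have : 0 ≤ |x| ^ 3 := by positivity
          linarith
    rw [hfac, norm_mul, hE]
    have hb4 : ‖Complex.exp z - (1 + x * Complex.I)‖ ≤ 17 * |x| ^ 3 := by
      have e : Complex.exp z - (1 + x * Complex.I) = (Complex.exp z - (1 + z + z ^ 2 / 2))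
        + ((1 + z + z ^ 2 / 2) - (1 + x * Complex.I)) := by ring
      rw [e]
      refine (norm_add_le _ _).trans ?_
      linarith
    exact (mul_le_of_le_one_right (norm_nonneg _) hE1).trans hb4

/-- All factors have modulus at most one, so the errors of the single factors add. -/
theorem norm_exp_sum_sub_prod_le {ι : Type*} (s : Finset ι) (x : ι → ℝ) :
    ‖Complex.exp ((∑ j ∈ s, x j : ℝ) * Complex.I)
      - (∏ j ∈ s, (1 + x j * Complex.I)) * Real.exp (-(∑ j ∈ s, x j ^ 2) / 2)‖
      ≤ 17 * ∑ j ∈ s, |x j| ^ 3 := by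
  have h1 : Complex.exp ((∑ j ∈ s, x j : ℝ) * Complex.I)
      = ∏ j ∈ s, Complex.exp (x j * Complex.I) := by
    rw [← Complex.exp_sum, Complex.ofReal_sum, Finset.sum_mul]
  have h2 : (∏ j ∈ s, (1 + x j * Complex.I)) * Real.exp (-(∑ j ∈ s, x j ^ 2) / 2)
      = ∏ j ∈ s, ((1 + x j * Complex.I) * Real.exp (-(x j ^ 2 / 2))) := by
    rw [Finset.prod_mul_distrib, ← Complex.ofReal_prod, ← Real.exp_sum, Finset.sum_neg_distrib,
      ← Finset.sum_div, neg_div]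
  rw [h1, h2, Finset.mul_sum]
  refine (norm_prod_sub_prod_le_sum s (fun j _ => ?_) (fun j _ => ?_)).trans
    (Finset.sum_le_sum fun j _ => norm_exp_mul_I_sub_le (x j))
  · rw [Complex.norm_exp_ofReal_mul_I]
  · rw [norm_mul, Complex.norm_real, Real.norm_eq_abs, Real.abs_exp]
    calc _ ≤ Real.exp (x j ^ 2 / 2) * Real.exp (-(x j ^ 2 / 2)) :=
          mul_le_mul_of_nonneg_right (norm_one_add_mul_I_le (x j)) (Real.exp_pos _).le
      _ = 1 := by rw [← Real.exp_add]; simp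

theorem norm_prod_one_add_mul_I_le {ι : Type*} (s : Finset ι) (x : ι → ℝ) :
    ‖∏ j ∈ s, (1 + x j * Complex.I)‖ ≤ Real.exp ((∑ j ∈ s, x j ^ 2) / 2) := by
  rw [norm_prod, Finset.sum_div, Real.exp_sum]
  exact Finset.prod_le_prod (fun _ _ => norm_nonneg _) fun j _ => norm_one_add_mul_I_le (x j)

theorem abs_exp_neg_sub_exp_neg_le {a b : ℝ} (ha : 0 ≤ a) (hb : 0 ≤ b) :
    |Real.exp (-a) - Real.exp (-b)| ≤ |a - b| := by
  wlog hab : a ≤ b generalizing a b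
  · rw [abs_sub_comm, abs_sub_comm a]; exact this hb ha (le_of_not_ge hab)
  have h1 : Real.exp (-b) = Real.exp (-a) * Real.exp (-(b - a)) := by
    rw [← Real.exp_add]; congr 1; ring
  have h2 := Real.add_one_le_exp (-(b - a))
  have h3 : Real.exp (-a) ≤ 1 := Real.exp_le_one_iff.2 (by linarith)
  have h4 : Real.exp (-b) ≤ Real.exp (-a) := Real.exp_le_exp.2 (by linarith)
  rw [abs_of_nonneg (by linarith), abs_of_nonpos (by linarith), h1]
  have h5 := Real.exp_pos (-a)
  nlinarith

theorem norm_exp_mul_I_sub_exp_mul_I_le (x y : ℝ) :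
    ‖Complex.exp (x * Complex.I) - Complex.exp (y * Complex.I)‖ ≤ |x - y| := by
  have h := Real.norm_exp_I_mul_ofReal_sub_one_le (x := x - y)
  have e : Complex.exp (x * Complex.I) - Complex.exp (y * Complex.I)
      = Complex.exp (y * Complex.I) * (Complex.exp (Complex.I * ((x - y : ℝ) : ℂ)) - 1) := by
    rw [mul_sub, ← Complex.exp_add, mul_one]; congr 2; push_cast; ring
  rw [e, norm_mul, Complex.norm_exp_ofReal_mul_I, one_mul]
  exact h

end CharacteristicProduct

/-! ### Weighted sums of conditionally independent errors. -/

/-- Conditionally centred and independent errors `U j` with bounded conditional `2 + η` moments,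
together with weights `b j` which are known given `G`. -/
structure WeightedErrors {Ω ι : Type*} [Fintype ι] (G : MeasurableSpace Ω)
    (base loc rest : ι → MeasurableSpace Ω) {m₀ : MeasurableSpace Ω} (μ : Measure Ω)
    (U b : ι → Ω → ℝ) (K η ρ : ℝ) : Prop where
  sys : CondIndepSystem G base loc rest μ
  eta_pos : 0 < η
  K_nonneg : 0 ≤ K
  measurable_U : ∀ j, StronglyMeasurable[loc j] (U j)
  integrable_U : ∀ j, Integrable (fun ω => |U j ω| ^ (2 + η)) μ
  condExp_U : ∀ j, μ[U j | base j] =ᵐ[μ] 0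
  moment : ∀ j, ∀ᵐ ω ∂μ, (μ[fun ω => |U j ω| ^ (2 + η) | G]) ω ≤ K
  measurable_b : ∀ j, StronglyMeasurable[G] (b j)
  sum_sq_b : ∀ ω, ∑ j, b j ω ^ 2 ≤ K
  sum_four_b : ∀ ω, ∑ j, b j ω ^ 4 ≤ ρ

theorem sq_le_one_add_rpow {η : ℝ} (hη : 0 < η) (u : ℝ) : u ^ 2 ≤ 1 + |u| ^ (2 + η) := by
  rcases le_or_gt |u| 1 with h | h
  · have : u ^ 2 ≤ 1 := by rw [← sq_abs]; exact pow_le_one₀ (abs_nonneg _) h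
    have := Real.rpow_nonneg (abs_nonneg u) (2 + η)
    linarith
  · have h1 : |u| ^ (2 : ℝ) ≤ |u| ^ (2 + η) := Real.rpow_le_rpow_of_exponent_le h.le (by linarith)
    rw [Real.rpow_two, sq_abs] at h1
    linarith

/-- A family of conditionally centred variables bounded by `B` approximates the errors up to
conditional mean square `κ`. -/
structure BoundedApprox {Ω ι : Type*} (G : MeasurableSpace Ω)
    (base loc : ι → MeasurableSpace Ω) {m₀ : MeasurableSpace Ω} (μ : Measure Ω)
    (U V : ι → Ω → ℝ) (B κ : ℝ) : Prop where
  kappa_pos : 0 < κ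
  kappa_le_one : κ ≤ 1
  bound_nonneg : 0 ≤ B
  measurable_V : ∀ j, StronglyMeasurable[loc j] (V j)
  abs_V_le : ∀ j ω, |V j ω| ≤ B
  condExp_V : ∀ j, μ[V j | base j] =ᵐ[μ] 0
  condExp_sub_sq : ∀ j, ∀ᵐ ω ∂μ, (μ[fun ω => (U j ω - V j ω) ^ 2 | G]) ω ≤ κ

namespace WeightedErrors

variable {Ω ι : Type*} [Fintype ι] {G : MeasurableSpace Ω} {base loc rest : ι → MeasurableSpace Ω}
  {m₀ : MeasurableSpace Ω} {μ : Measure Ω} {U b V : ι → Ω → ℝ}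
  {K η ρ B κ : ℝ}

theorem aesm_b (h : WeightedErrors G base loc rest μ U b K η ρ) (j : ι) :
    AEStronglyMeasurable (b j) μ := ((h.measurable_b j).mono h.sys.le).aestronglyMeasurable

theorem aesm_U (h : WeightedErrors G base loc rest μ U b K η ρ) (j : ι) :
    AEStronglyMeasurable (U j) μ :=
  ((h.measurable_U j).mono (h.sys.loc_le j)).aestronglyMeasurable

theorem sq_b_le (h : WeightedErrors G base loc rest μ U b K η ρ) (j : ι) (ω : Ω) :
    b j ω ^ 2 ≤ K :=
  (Finset.single_le_sum (f := fun j => b j ω ^ 2) (fun _ _ => sq_nonneg _)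
    (Finset.mem_univ j)).trans (h.sum_sq_b ω)

theorem abs_b_le (h : WeightedErrors G base loc rest μ U b K η ρ) (j : ι) (ω : Ω) :
    |b j ω| ≤ √K := Real.abs_le_sqrt (h.sq_b_le j ω)

theorem abs_sq_b_le (h : WeightedErrors G base loc rest μ U b K η ρ) (j : ι) (ω : Ω) :
    |b j ω ^ 2| ≤ K := by rw [abs_of_nonneg (sq_nonneg _)]; exact h.sq_b_le j ω

theorem aesm_V (h : WeightedErrors G base loc rest μ U b K η ρ)
    (hV : BoundedApprox G base loc μ U V B κ) (j : ι) : AEStronglyMeasurable (V j) μ :=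
  ((hV.measurable_V j).mono (h.sys.loc_le j)).aestronglyMeasurable

variable [IsProbabilityMeasure μ]

theorem integrable_sq_b (h : WeightedErrors G base loc rest μ U b K η ρ) (j : ι) :
    Integrable (fun ω => b j ω ^ 2) μ :=
  Integrable.of_bound ((h.aesm_b j).pow 2) K (ae_of_all _ (h.abs_sq_b_le j))

theorem sum_integral_sq_b_le (h : WeightedErrors G base loc rest μ U b K η ρ) :
    ∑ j, ∫ ω, b j ω ^ 2 ∂μ ≤ K := by
  rw [← integral_finsetSum _ fun j _ => h.integrable_sq_b j]
  calc _ ≤ ∫ _, K ∂μ := integral_mono (integrable_finsetSum _ fun j _ => h.integrable_sq_b j)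
        (integrable_const _) h.sum_sq_b
    _ = K := by simp

theorem memLp_U (h : WeightedErrors G base loc rest μ U b K η ρ) (j : ι) : MemLp (U j) 2 μ := by
  rw [memLp_two_iff_integrable_sq (h.aesm_U j)]
  refine Integrable.mono' ((integrable_const 1).add (h.integrable_U j)) ((h.aesm_U j).pow 2)
    (ae_of_all _ fun ω => ?_)
  rw [Real.norm_eq_abs, abs_of_nonneg (sq_nonneg _)]
  exact sq_le_one_add_rpow h.eta_pos _

theorem condExp_sq_le (h : WeightedErrors G base loc rest μ U b K η ρ) (j : ι) :
    ∀ᵐ ω ∂μ, (μ[fun ω => U j ω ^ 2 | G]) ω ≤ 1 + K := by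
  have h1 : μ[fun ω => U j ω ^ 2 | G] ≤ᵐ[μ] μ[(fun _ => (1 : ℝ)) + fun ω => |U j ω| ^ (2 + η) | G] :=
    condExp_mono (h.memLp_U j).integrable_sq ((integrable_const 1).add (h.integrable_U j))
      (ae_of_all _ fun ω => sq_le_one_add_rpow h.eta_pos _)
  have h2 := condExp_add (integrable_const (μ := μ) (1 : ℝ)) (h.integrable_U j) G
  have h3 : μ[fun _ : Ω => (1 : ℝ) | G] = fun _ => 1 := condExp_const h.sys.le 1
  filter_upwards [h1, h2, h.moment j] with ω e1 e2 e3
  refine e1.trans ?_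
  rw [e2, Pi.add_apply, h3]
  linarith

theorem memLp_V (h : WeightedErrors G base loc rest μ U b K η ρ)
    (hV : BoundedApprox G base loc μ U V B κ) (j : ι) : MemLp (V j) 2 μ :=
  MemLp.of_bound (h.aesm_V hV j) B (ae_of_all _ (hV.abs_V_le j))

/-- The differences `U j - V j` are again centred and orthogonal, so the second moment of the
weighted sum is at most `κ * ∑ E[b j ^ 2]`. -/
theorem integral_abs_sum_sub_le (h : WeightedErrors G base loc rest μ U b K η ρ)
    (hV : BoundedApprox G base loc μ U V B κ) :
    ∫ ω, |∑ j, b j ω * U j ω - ∑ j, b j ω * V j ω| ∂μ ≤ √(κ * K) := by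
  have hr : ∀ j, MemLp (fun ω => U j ω - V j ω) 2 μ := fun j => (h.memLp_U j).sub (h.memLp_V hV j)
  have hsum : ∀ ω, ∑ j, b j ω * U j ω - ∑ j, b j ω * V j ω = ∑ j, b j ω * (U j ω - V j ω) :=
    fun ω => by rw [← Finset.sum_sub_distrib]; exact Finset.sum_congr rfl fun j _ => by ring
  simp_rw [hsum]
  have hL : MemLp (fun ω => ∑ j, b j ω * (U j ω - V j ω)) 2 μ :=
    memLp_finsetSum _ fun j _ => memLp_mul_of_bound (hr j) (h.aesm_b j) (h.abs_b_le j)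
  refine (integral_abs_le_sqrt hL).trans (Real.sqrt_le_sqrt ?_)
  rw [h.sys.integral_sum_sq Finset.univ (ζ := fun j ω => U j ω - V j ω) h.measurable_b h.abs_b_le
    (fun j => (h.measurable_U j).sub (hV.measurable_V j)) hr]
  · calc ∑ j, ∫ ω, b j ω ^ 2 * (U j ω - V j ω) ^ 2 ∂μ ≤ ∑ j, κ * ∫ ω, b j ω ^ 2 ∂μ := by
          refine Finset.sum_le_sum fun j _ => ?_
          exact integral_mul_le_of_condExp_le h.sys.le ((h.measurable_b j).pow 2)
            (fun ω => sq_nonneg _) (h.integrable_sq_b j) (hr j).integrable_sq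
            ((hr j).integrable_sq.bdd_mul ((h.aesm_b j).pow 2)
              (ae_of_all _ (h.abs_sq_b_le j))) (hV.condExp_sub_sq j)
      _ = κ * ∑ j, ∫ ω, b j ω ^ 2 ∂μ := by rw [Finset.mul_sum]
      _ ≤ κ * K := mul_le_mul_of_nonneg_left h.sum_integral_sq_b_le hV.kappa_pos.le
  · intro j
    have h1 := condExp_sub ((h.memLp_U j).integrable one_le_two)
      ((h.memLp_V hV j).integrable one_le_two) (base j)
    filter_upwards [h1, h.condExp_U j, hV.condExp_V j] with ω e1 e2 e3
    change (μ[U j - V j | base j]) ω = 0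
    rw [e1, Pi.sub_apply, e2, e3]; simp

theorem integrable_abs_sq_sub_sq (h : WeightedErrors G base loc rest μ U b K η ρ)
    (hV : BoundedApprox G base loc μ U V B κ) (j : ι) : Integrable (fun ω => |U j ω ^ 2 - V j ω ^ 2|) μ :=
  ((h.memLp_U j).integrable_sq.sub (h.memLp_V hV j).integrable_sq).abs

/-- With `r = U - V` one has `|U ^ 2 - V ^ 2| ≤ r ^ 2 + 2 |r| |U|`. The cross term is split by
weighted AM-GM with weight `√κ`, which makes both resulting pieces of order `√κ`. -/
theorem condExp_abs_sq_sub_sq_le (h : WeightedErrors G base loc rest μ U b K η ρ)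
    (hV : BoundedApprox G base loc μ U V B κ) (j : ι) :
    ∀ᵐ ω ∂μ, (μ[fun ω => |U j ω ^ 2 - V j ω ^ 2| | G]) ω ≤ √κ * (3 + K) := by
  have hs : 0 < √κ := Real.sqrt_pos.2 hV.kappa_pos
  have hss : √κ * √κ = κ := Real.mul_self_sqrt hV.kappa_pos.le
  have hs1 : √κ ≤ 1 := Real.sqrt_le_one.2 hV.kappa_le_one
  have hr : MemLp (fun ω => U j ω - V j ω) 2 μ := (h.memLp_U j).sub (h.memLp_V hV j)
  have hi1 : Integrable (fun ω => (1 + (√κ)⁻¹) * (U j ω - V j ω) ^ 2) μ :=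
    hr.integrable_sq.const_mul _
  have hi2 : Integrable (fun ω => √κ * U j ω ^ 2) μ := (h.memLp_U j).integrable_sq.const_mul _
  have hpt : ∀ ω, |U j ω ^ 2 - V j ω ^ 2|
      ≤ (1 + (√κ)⁻¹) * (U j ω - V j ω) ^ 2 + √κ * U j ω ^ 2 := by
    intro ω
    set r := U j ω - V j ω
    have e : U j ω ^ 2 - V j ω ^ 2 = r * (2 * U j ω - r) := by simp only [r]; ring
    have h1 : |U j ω ^ 2 - V j ω ^ 2| ≤ r ^ 2 + 2 * |r| * |U j ω| := by
      rw [e, abs_mul]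
      have := abs_sub (2 * U j ω) r
      rw [abs_mul, abs_two] at this
      calc |r| * |2 * U j ω - r| ≤ |r| * (2 * |U j ω| + |r|) :=
            mul_le_mul_of_nonneg_left this (abs_nonneg _)
        _ = r ^ 2 + 2 * |r| * |U j ω| := by rw [← sq_abs r]; ring
    have h2 : 2 * |r| * |U j ω| ≤ (√κ)⁻¹ * r ^ 2 + √κ * U j ω ^ 2 := by
      have h3 : 0 ≤ (√κ)⁻¹ * (|r| - √κ * |U j ω|) ^ 2 := by positivity
      have h4 : (√κ)⁻¹ * (|r| - √κ * |U j ω|) ^ 2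
          = (√κ)⁻¹ * r ^ 2 + √κ * U j ω ^ 2 - 2 * |r| * |U j ω| := by
        rw [← sq_abs r, ← sq_abs (U j ω)]
        field_simp
        ring
      linarith
    linarith
  have hm := condExp_mono (m := G) (h.integrable_abs_sq_sub_sq hV j) (hi1.add hi2)
    (ae_of_all μ hpt)
  have ha := condExp_add hi1 hi2 G
  have hc1 : μ[fun ω => (1 + (√κ)⁻¹) * (U j ω - V j ω) ^ 2 | G]
      =ᵐ[μ] (1 + (√κ)⁻¹) • μ[fun ω => (U j ω - V j ω) ^ 2 | G] := condExp_smul (1 + (√κ)⁻¹) _ G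
  have hc2 : μ[fun ω => √κ * U j ω ^ 2 | G] =ᵐ[μ] √κ • μ[fun ω => U j ω ^ 2 | G] :=
    condExp_smul (√κ) _ G
  filter_upwards [hm, ha, hc1, hc2, hV.condExp_sub_sq j, h.condExp_sq_le j] with ω e1 e2 e3 e4 e5 e6
  refine e1.trans ?_
  rw [e2, Pi.add_apply, e3, e4, Pi.smul_apply, Pi.smul_apply, smul_eq_mul, smul_eq_mul]
  have h1 : (1 + (√κ)⁻¹) * (μ[fun ω => (U j ω - V j ω) ^ 2 | G]) ω ≤ (1 + (√κ)⁻¹) * κ :=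
    mul_le_mul_of_nonneg_left e5 (by positivity)
  have h2 : √κ * (μ[fun ω => U j ω ^ 2 | G]) ω ≤ √κ * (1 + K) :=
    mul_le_mul_of_nonneg_left e6 hs.le
  have h3 : (1 + (√κ)⁻¹) * κ = κ + √κ := by
    rw [add_mul, one_mul, inv_mul_eq_div, Real.div_sqrt]
  nlinarith

theorem integral_abs_sumSq_sub_le (h : WeightedErrors G base loc rest μ U b K η ρ)
    (hV : BoundedApprox G base loc μ U V B κ) :
    ∫ ω, |∑ j, b j ω ^ 2 * U j ω ^ 2 - ∑ j, b j ω ^ 2 * V j ω ^ 2| ∂μ ≤ K * (√κ * (3 + K)) := by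
  have hi := h.integrable_abs_sq_sub_sq hV
  have hbi : ∀ j, Integrable (fun ω => b j ω ^ 2 * |U j ω ^ 2 - V j ω ^ 2|) μ := fun j =>
    (hi j).bdd_mul ((h.aesm_b j).pow 2) (ae_of_all _ (h.abs_sq_b_le j))
  have hD : 0 ≤ √κ * (3 + K) := mul_nonneg (Real.sqrt_nonneg _) (by linarith [h.K_nonneg])
  calc ∫ ω, |∑ j, b j ω ^ 2 * U j ω ^ 2 - ∑ j, b j ω ^ 2 * V j ω ^ 2| ∂μ
      ≤ ∫ ω, ∑ j, b j ω ^ 2 * |U j ω ^ 2 - V j ω ^ 2| ∂μ := by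
        refine integral_mono_of_nonneg (ae_of_all _ fun ω => abs_nonneg _)
          (integrable_finsetSum _ fun j _ => hbi j) (ae_of_all _ fun ω => ?_)
        simp only
        rw [← Finset.sum_sub_distrib]
        refine (Finset.abs_sum_le_sum_abs _ _).trans (Finset.sum_le_sum fun j _ => ?_)
        rw [← mul_sub, abs_mul, abs_of_nonneg (sq_nonneg (b j ω))]
    _ = ∑ j, ∫ ω, b j ω ^ 2 * |U j ω ^ 2 - V j ω ^ 2| ∂μ := integral_finsetSum _ fun j _ => hbi j
    _ ≤ ∑ j, (√κ * (3 + K)) * ∫ ω, b j ω ^ 2 ∂μ := Finset.sum_le_sum fun j _ =>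
        integral_mul_le_of_condExp_le h.sys.le ((h.measurable_b j).pow 2)
            (fun ω => sq_nonneg _) (h.integrable_sq_b j) (hi j) (hbi j)
            (h.condExp_abs_sq_sub_sq_le hV j)
    _ = (√κ * (3 + K)) * ∑ j, ∫ ω, b j ω ^ 2 ∂μ := by rw [Finset.mul_sum]
    _ ≤ (√κ * (3 + K)) * K := mul_le_mul_of_nonneg_left h.sum_integral_sq_b_le hD
    _ = K * (√κ * (3 + K)) := mul_comm _ _

/-- A weak law of large numbers: the centred squares are orthogonal and bounded by `B ^ 2`, so the
variance of the weighted sum is at most `B ^ 4 * ∑ b j ^ 4`. Truncation is what gives the squares a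
second moment. -/
theorem integral_abs_sumSq_sub_condExp_le (h : WeightedErrors G base loc rest μ U b K η ρ)
    (hV : BoundedApprox G base loc μ U V B κ) :
    ∫ ω, |∑ j, b j ω ^ 2 * V j ω ^ 2 - ∑ j, b j ω ^ 2 * (μ[fun ω => V j ω ^ 2 | base j]) ω| ∂μ
      ≤ B ^ 2 * √ρ := by
  set ζ : ι → Ω → ℝ := fun j ω => V j ω ^ 2 - (μ[fun ω => V j ω ^ 2 | base j]) ω with hζ
  have hV2 : ∀ j ω, V j ω ^ 2 ≤ B ^ 2 := fun j ω => by
    rw [← sq_abs]; exact pow_le_pow_left₀ (abs_nonneg _) (hV.abs_V_le j ω) 2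
  have hVi : ∀ j, Integrable (fun ω => V j ω ^ 2) μ := fun j => (h.memLp_V hV j).integrable_sq
  have hζm : ∀ j, StronglyMeasurable[loc j] (ζ j) := fun j =>
    ((hV.measurable_V j).pow 2).sub (stronglyMeasurable_condExp.mono (h.sys.base_le_loc j))
  have hb0 : ∀ j, base j ≤ m₀ := fun j => (h.sys.base_le j).trans h.sys.le
  have hζb : ∀ j, ∀ᵐ ω ∂μ, |ζ j ω| ≤ B ^ 2 := fun j => by
    have h1 : 0 ≤ᵐ[μ] μ[fun ω => V j ω ^ 2 | base j] :=
      condExp_nonneg (ae_of_all _ fun ω => sq_nonneg _)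
    have h2 : μ[fun ω => V j ω ^ 2 | base j] ≤ᵐ[μ] μ[fun _ => B ^ 2 | base j] :=
      condExp_mono (hVi j) (integrable_const _) (ae_of_all _ (hV2 j))
    rw [condExp_const (hb0 j)] at h2
    filter_upwards [h1, h2] with ω e1 e2
    simp only [Pi.zero_apply] at e1
    simp only [hζ]
    rw [abs_le]
    constructor <;> linarith [hV2 j ω, sq_nonneg (V j ω)]
  have hζL : ∀ j, MemLp (ζ j) 2 μ := fun j =>
    MemLp.of_bound ((hζm j).mono (h.sys.loc_le j)).aestronglyMeasurable (B ^ 2) (hζb j)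
  have hζ0 : ∀ j, μ[ζ j | base j] =ᵐ[μ] 0 := fun j => by
    have h1 := condExp_sub (hVi j) (integrable_condExp (f := fun ω => V j ω ^ 2) (m := base j))
      (base j)
    have h2 : μ[μ[fun ω => V j ω ^ 2 | base j] | base j] = μ[fun ω => V j ω ^ 2 | base j] :=
      condExp_of_stronglyMeasurable (hb0 j) stronglyMeasurable_condExp integrable_condExp
    filter_upwards [h1] with ω e1
    change (μ[(fun ω => V j ω ^ 2) - μ[fun ω => V j ω ^ 2 | base j] | base j]) ω = 0
    rw [e1, Pi.sub_apply, h2, sub_self]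
  have hsum : ∀ ω, ∑ j, b j ω ^ 2 * V j ω ^ 2
      - ∑ j, b j ω ^ 2 * (μ[fun ω => V j ω ^ 2 | base j]) ω = ∑ j, b j ω ^ 2 * ζ j ω := fun ω => by
    rw [← Finset.sum_sub_distrib]; exact Finset.sum_congr rfl fun j _ => by simp only [hζ]; ring
  simp_rw [hsum]
  have hL : MemLp (fun ω => ∑ j, b j ω ^ 2 * ζ j ω) 2 μ :=
    memLp_finsetSum _ fun j _ => memLp_mul_of_bound (hζL j) ((h.aesm_b j).pow 2) (h.abs_sq_b_le j)
  have hfin : B ^ 2 * √ρ = √(B ^ 4 * ρ) := by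
    rw [Real.sqrt_mul (by positivity), show B ^ 4 = (B ^ 2) ^ 2 by ring,
      Real.sqrt_sq (sq_nonneg B)]
  rw [hfin]
  refine (integral_abs_le_sqrt hL).trans (Real.sqrt_le_sqrt ?_)
  rw [h.sys.integral_sum_sq Finset.univ (c := fun j ω => b j ω ^ 2)
    (fun j => (h.measurable_b j).pow 2) h.abs_sq_b_le hζm hζL hζ0]
  have hi : ∀ j, Integrable (fun ω => (b j ω ^ 2) ^ 2 * ζ j ω ^ 2) μ := fun j => by
    refine (hζL j).integrable_sq.bdd_mul (c := K ^ 2) (((h.aesm_b j).pow 2).pow 2)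
      (ae_of_all _ fun ω => ?_)
    rw [Real.norm_eq_abs, abs_pow]
    exact pow_le_pow_left₀ (abs_nonneg _) (h.abs_sq_b_le j ω) 2
  rw [← integral_finsetSum _ fun j _ => hi j]
  calc _ ≤ ∫ _, B ^ 4 * ρ ∂μ := by
        refine integral_mono_ae (integrable_finsetSum _ fun j _ => hi j) (integrable_const _) ?_
        have hall : ∀ᵐ ω ∂μ, ∀ j, |ζ j ω| ≤ B ^ 2 := ae_all_iff.2 hζb
        filter_upwards [hall] with ω hω
        calc ∑ j, (b j ω ^ 2) ^ 2 * ζ j ω ^ 2 ≤ ∑ j, B ^ 4 * b j ω ^ 4 := by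
              refine Finset.sum_le_sum fun j _ => ?_
              have : ζ j ω ^ 2 ≤ B ^ 4 := by
                rw [← sq_abs, show B ^ 4 = (B ^ 2) ^ 2 by ring]
                exact pow_le_pow_left₀ (abs_nonneg _) (hω j) 2
              rw [mul_comm, show (b j ω ^ 2) ^ 2 = b j ω ^ 4 by ring]
              exact mul_le_mul_of_nonneg_right this (by positivity)
          _ = B ^ 4 * ∑ j, b j ω ^ 4 := by rw [Finset.mul_sum]
          _ ≤ B ^ 4 * ρ := mul_le_mul_of_nonneg_left (h.sum_four_b ω) (by positivity)
    _ = B ^ 4 * ρ := by simp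

theorem abs_condVar_sub_le (h : WeightedErrors G base loc rest μ U b K η ρ)
    (hV : BoundedApprox G base loc μ U V B κ) :
    ∀ᵐ ω ∂μ, |∑ j, b j ω ^ 2 * (μ[fun ω => V j ω ^ 2 | base j]) ω
      - ∑ j, b j ω ^ 2 * (μ[fun ω => U j ω ^ 2 | G]) ω| ≤ K * (√κ * (3 + K)) := by
  have hVi : ∀ j, Integrable (fun ω => V j ω ^ 2) μ := fun j => (h.memLp_V hV j).integrable_sq
  have hUi : ∀ j, Integrable (fun ω => U j ω ^ 2) μ := fun j => (h.memLp_U j).integrable_sq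
  have hD : 0 ≤ √κ * (3 + K) := mul_nonneg (Real.sqrt_nonneg _) (by linarith [h.K_nonneg])
  have hj : ∀ j, ∀ᵐ ω ∂μ, |(μ[fun ω => V j ω ^ 2 | base j]) ω - (μ[fun ω => U j ω ^ 2 | G]) ω|
      ≤ √κ * (3 + K) := fun j => by
    have h1 := h.sys.condExp_eq (hVi j) ((hV.measurable_V j).pow 2)
    have h2 := condExp_sub (hUi j) (hVi j) G
    have h3 : μ[(fun ω => U j ω ^ 2) - fun ω => V j ω ^ 2 | G]
        ≤ᵐ[μ] μ[fun ω => |U j ω ^ 2 - V j ω ^ 2| | G] :=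
      condExp_mono ((hUi j).sub (hVi j)) (h.integrable_abs_sq_sub_sq hV j)
        (ae_of_all _ fun ω => le_abs_self _)
    have h4 := condExp_sub (hVi j) (hUi j) G
    have h5 : μ[(fun ω => V j ω ^ 2) - fun ω => U j ω ^ 2 | G]
        ≤ᵐ[μ] μ[fun ω => |U j ω ^ 2 - V j ω ^ 2| | G] :=
      condExp_mono ((hVi j).sub (hUi j)) (h.integrable_abs_sq_sub_sq hV j)
        (ae_of_all _ fun ω => by
          simp only [Pi.sub_apply]; rw [abs_sub_comm]; exact le_abs_self _)
    filter_upwards [h1, h2, h3, h4, h5, h.condExp_abs_sq_sub_sq_le hV j] with ω e1 e2 e3 e4 e5 e6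
    rw [← e1, abs_le]
    rw [e2, Pi.sub_apply] at e3
    rw [e4, Pi.sub_apply] at e5
    constructor <;> linarith
  have hall := ae_all_iff.2 hj
  filter_upwards [hall] with ω hω
  rw [← Finset.sum_sub_distrib]
  calc _ ≤ ∑ j, b j ω ^ 2 * (√κ * (3 + K)) := by
        refine (Finset.abs_sum_le_sum_abs _ _).trans (Finset.sum_le_sum fun j _ => ?_)
        rw [← mul_sub, abs_mul, abs_of_nonneg (sq_nonneg (b j ω))]
        exact mul_le_mul_of_nonneg_left (hω j) (sq_nonneg _)
    _ = (∑ j, b j ω ^ 2) * (√κ * (3 + K)) := by rw [Finset.sum_mul]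
    _ ≤ K * (√κ * (3 + K)) := mul_le_mul_of_nonneg_right (h.sum_sq_b ω) hD

end WeightedErrors

theorem norm_integral_sub_le_of_ae_le {Ω E : Type*} [NormedAddCommGroup E] [NormedSpace ℝ E]
    {m₀ : MeasurableSpace Ω} {μ : Measure Ω} {f g : Ω → E} {c : Ω → ℝ} (hf : Integrable f μ)
    (hg : Integrable g μ) (hc : Integrable c μ) (h : ∀ᵐ ω ∂μ, ‖f ω - g ω‖ ≤ c ω) :
    ‖∫ ω, f ω ∂μ - ∫ ω, g ω ∂μ‖ ≤ ∫ ω, c ω ∂μ := by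
  rw [← integral_sub hf hg]
  exact norm_integral_le_of_norm_le hc h

theorem integrable_exp_mul_I {Ω : Type*} {m₀ : MeasurableSpace Ω} {μ : Measure Ω}
    [IsFiniteMeasure μ] {X : Ω → ℝ} (hX : AEStronglyMeasurable X μ) :
    Integrable (fun ω => Complex.exp ((X ω : ℝ) * Complex.I)) μ := by
  refine Integrable.of_bound ?_ 1 (ae_of_all _ fun ω => by rw [Complex.norm_exp_ofReal_mul_I])
  have hc : Continuous fun x : ℝ => Complex.exp ((x : ℝ) * Complex.I) := by fun_prop
  exact hc.comp_aestronglyMeasurable hX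

namespace WeightedErrors

variable {Ω ι : Type*} [Fintype ι] {G : MeasurableSpace Ω} {base loc rest : ι → MeasurableSpace Ω}
  {m₀ : MeasurableSpace Ω} {μ : Measure Ω} {U b V : ι → Ω → ℝ}
  {K η ρ B κ : ℝ}

theorem abs_mul_V_le (h : WeightedErrors G base loc rest μ U b K η ρ)
    (hV : BoundedApprox G base loc μ U V B κ) (t : ℝ) (j : ι) (ω : Ω) :
    |t * b j ω * V j ω| ≤ |t| * √K * B := by
  rw [abs_mul, abs_mul]
  exact mul_le_mul (mul_le_mul_of_nonneg_left (h.abs_b_le j ω) (abs_nonneg _)) (hV.abs_V_le j ω)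
    (abs_nonneg _) (by positivity)

/-- Cauchy–Schwarz for `|b| ^ 3 = |b| * b ^ 2` bounds the sum of cubes by the square root of `∑ b ^
2 * ∑ b ^ 4`. -/
theorem sum_abs_cube_le (h : WeightedErrors G base loc rest μ U b K η ρ)
    (hV : BoundedApprox G base loc μ U V B κ) (t : ℝ) (ω : Ω) :
    ∑ j, |t * b j ω * V j ω| ^ 3 ≤ (|t| * B) ^ 3 * √(K * ρ) := by
  have h1 : (∑ j, |b j ω| * b j ω ^ 2) ^ 2 ≤ K * ρ := by
    refine (Finset.sum_mul_sq_le_sq_mul_sq _ _ _).trans ?_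
    have e1 : ∑ j, |b j ω| ^ 2 = ∑ j, b j ω ^ 2 := Finset.sum_congr rfl fun j _ => sq_abs _
    have e2 : ∑ j, (b j ω ^ 2) ^ 2 = ∑ j, b j ω ^ 4 := Finset.sum_congr rfl fun j _ => by ring
    rw [e1, e2]
    exact mul_le_mul (h.sum_sq_b ω) (h.sum_four_b ω)
      (Finset.sum_nonneg fun j _ => by positivity) h.K_nonneg
  have h2 : ∑ j, |b j ω| * b j ω ^ 2 ≤ √(K * ρ) := Real.le_sqrt_of_sq_le h1
  have hB := hV.bound_nonneg
  calc ∑ j, |t * b j ω * V j ω| ^ 3 ≤ ∑ j, (|t| * B) ^ 3 * (|b j ω| * b j ω ^ 2) := by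
        refine Finset.sum_le_sum fun j _ => ?_
        rw [abs_mul, abs_mul, ← sq_abs (b j ω)]
        calc (|t| * |b j ω| * |V j ω|) ^ 3 ≤ (|t| * |b j ω| * B) ^ 3 :=
              pow_le_pow_left₀ (by positivity)
                (mul_le_mul_of_nonneg_left (hV.abs_V_le j ω) (by positivity)) 3
          _ = _ := by ring
    _ = (|t| * B) ^ 3 * ∑ j, |b j ω| * b j ω ^ 2 := by rw [Finset.mul_sum]
    _ ≤ (|t| * B) ^ 3 * √(K * ρ) := mul_le_mul_of_nonneg_left h2 (by positivity)

variable [IsProbabilityMeasure μ]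

/-- For any `j` in `S`, all factors other than `V j` are known given `rest j`, and `V j` is centred
there. -/
theorem integral_mul_prod_eq_zero (h : WeightedErrors G base loc rest μ U b K η ρ)
    (hV : BoundedApprox G base loc μ U V B κ) (t : ℝ) {g : Ω → ℝ} (hg : StronglyMeasurable[G] g)
    (hg1 : ∀ᵐ ω ∂μ, |g ω| ≤ 1) {S : Finset ι} (hS : S.Nonempty) :
    ∫ ω, g ω * ∏ j ∈ S, (t * b j ω * V j ω) ∂μ = 0 := by
  classical
  obtain ⟨j, hj⟩ := hS
  have hm : StronglyMeasurable[rest j]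
      (fun ω => g ω * (t * b j ω) * ∏ k ∈ S.erase j, (t * b k ω * V k ω)) := by
    refine ((hg.mono (h.sys.le_rest j)).mul
      (((h.measurable_b j).mono (h.sys.le_rest j)).const_mul t)).mul ?_
    refine Finset.stronglyMeasurable_fun_prod _ fun k hk => ?_
    exact (((h.measurable_b k).mono (h.sys.le_rest j)).const_mul t).mul
      ((hV.measurable_V k).mono (h.sys.loc_le_rest j k (Finset.ne_of_mem_erase hk)))
  have heq : ∀ ω, g ω * ∏ j ∈ S, (t * b j ω * V j ω)
      = (g ω * (t * b j ω) * ∏ k ∈ S.erase j, (t * b k ω * V k ω)) * V j ω := fun ω => by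
    rw [← Finset.mul_prod_erase S _ hj]; ring
  simp_rw [heq]
  have hVi := (h.memLp_V hV j).integrable one_le_two
  refine integral_mul_eq_zero_of_condExp_eq_zero (h.sys.rest_le j) hm hVi ?_
    ((h.sys.condExp_rest j _ hVi (hV.measurable_V j)).trans (hV.condExp_V j))
  refine hVi.bdd_mul (c := 1 * (|t| * √K) * ∏ k ∈ S.erase j, (|t| * √K * B))
    (hm.mono (h.sys.rest_le j)).aestronglyMeasurable ?_
  filter_upwards [hg1] with ω hω
  rw [norm_mul, norm_mul, norm_prod]
  refine mul_le_mul (mul_le_mul hω ?_ (norm_nonneg _) zero_le_one)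
    (Finset.prod_le_prod (fun _ _ => norm_nonneg _) fun k _ => h.abs_mul_V_le hV t k ω)
    (Finset.prod_nonneg fun _ _ => norm_nonneg _) (by positivity)
  rw [Real.norm_eq_abs, abs_mul]
  exact mul_le_mul_of_nonneg_left (h.abs_b_le j ω) (abs_nonneg _)

/-- Expand the product over subsets of the index set: only the empty subset has a nonzero integral.
-/
theorem integral_prod_one_add_mul (h : WeightedErrors G base loc rest μ U b K η ρ)
    (hV : BoundedApprox G base loc μ U V B κ) (t : ℝ) {g : Ω → ℝ} (hg : StronglyMeasurable[G] g)
    (hg1 : ∀ᵐ ω ∂μ, |g ω| ≤ 1) :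
    ∫ ω, (∏ j, (1 + (t * b j ω * V j ω : ℝ) * Complex.I)) * (g ω : ℂ) ∂μ = ∫ ω, (g ω : ℂ) ∂μ := by
  classical
  have hexp : ∀ ω, (∏ j, (1 + (t * b j ω * V j ω : ℝ) * Complex.I)) * (g ω : ℂ)
      = ∑ S ∈ (Finset.univ : Finset ι).powerset,
        ((g ω * ∏ j ∈ S, (t * b j ω * V j ω) : ℝ) : ℂ) * Complex.I ^ S.card := fun ω => by
    rw [Finset.prod_one_add, Finset.sum_mul]
    refine Finset.sum_congr rfl fun S _ => ?_
    rw [Finset.prod_mul_distrib, Finset.prod_const]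
    push_cast
    ring
  simp_rw [hexp]
  have hgm : AEStronglyMeasurable g μ := (hg.mono h.sys.le).aestronglyMeasurable
  have hi : ∀ S : Finset ι, Integrable (fun ω => g ω * ∏ j ∈ S, (t * b j ω * V j ω)) μ := by
    intro S
    refine Integrable.of_bound (hgm.mul (Finset.aestronglyMeasurable_fun_prod _ fun j _ =>
      ((h.aesm_b j).const_mul t).mul (h.aesm_V hV j))) (1 * ∏ k ∈ S, (|t| * √K * B)) ?_
    filter_upwards [hg1] with ω hω
    rw [norm_mul, norm_prod]
    exact mul_le_mul hω
      (Finset.prod_le_prod (fun _ _ => norm_nonneg _) fun k _ => h.abs_mul_V_le hV t k ω)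
      (Finset.prod_nonneg fun _ _ => norm_nonneg _) zero_le_one
  rw [integral_finsetSum _ fun S _ => (hi S).ofReal.mul_const _]
  rw [Finset.sum_eq_single ∅]
  · simp
  · intro S _ hS
    rw [integral_mul_const, integral_complex_ofReal,
      h.integral_mul_prod_eq_zero hV t hg hg1 (Finset.nonempty_iff_ne_empty.2 hS)]
    simp
  · intro h; simp at h

/-- The distance from the characteristic function to a mixture of Gaussian ones. The terms in `κ`
are the price of truncation; those in `ρ` measure the influence of single weights and also depend on
the truncation bound `B`. -/
theorem norm_integral_exp_sub_le (h : WeightedErrors G base loc rest μ U b K η ρ)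
    (hV : BoundedApprox G base loc μ U V B κ) (t : ℝ) :
    ‖∫ ω, Complex.exp ((t * ∑ j, b j ω * U j ω : ℝ) * Complex.I) ∂μ
      - ∫ ω, (Real.exp (-(t ^ 2 / 2 * ∑ j, b j ω ^ 2 * (μ[fun ω => U j ω ^ 2 | G]) ω)) : ℂ) ∂μ‖
    ≤ |t| * √(κ * K) + (17 * ((|t| * B) ^ 3 * √(K * ρ))
      + Real.exp (t ^ 2 * B ^ 2 * K / 2) * (t ^ 2 / 2) * (B ^ 2 * √ρ))
      + t ^ 2 / 2 * (K * (√κ * (3 + K))) := by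
  set N : Ω → ℝ := fun ω => ∑ j, b j ω * U j ω with hN
  set NL : Ω → ℝ := fun ω => ∑ j, b j ω * V j ω with hNL
  set Q : Ω → ℝ := fun ω => ∑ j, b j ω ^ 2 * V j ω ^ 2 with hQ
  set vL : Ω → ℝ := fun ω => ∑ j, b j ω ^ 2 * (μ[fun ω => V j ω ^ 2 | base j]) ω with hvL
  set v : Ω → ℝ := fun ω => ∑ j, b j ω ^ 2 * (μ[fun ω => U j ω ^ 2 | G]) ω with hv
  have hNm : AEStronglyMeasurable N μ :=
    Finset.aestronglyMeasurable_fun_sum _ fun j _ => (h.aesm_b j).mul (h.aesm_U j)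
  have hNLm : AEStronglyMeasurable NL μ :=
    Finset.aestronglyMeasurable_fun_sum _ fun j _ => (h.aesm_b j).mul (h.aesm_V hV j)
  have hvLm : StronglyMeasurable[G] vL := Finset.stronglyMeasurable_fun_sum _ fun j _ =>
    ((h.measurable_b j).pow 2).mul (stronglyMeasurable_condExp.mono (h.sys.base_le j))
  have hvm : StronglyMeasurable[G] v := Finset.stronglyMeasurable_fun_sum _ fun j _ =>
    ((h.measurable_b j).pow 2).mul stronglyMeasurable_condExp
  have hvL0 : ∀ᵐ ω ∂μ, 0 ≤ vL ω := by
    have : ∀ j, 0 ≤ᵐ[μ] μ[fun ω => V j ω ^ 2 | base j] := fun j =>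
      condExp_nonneg (ae_of_all _ fun ω => sq_nonneg _)
    filter_upwards [ae_all_iff.2 this] with ω hω
    exact Finset.sum_nonneg fun j _ => mul_nonneg (sq_nonneg _) (hω j)
  have hv0 : ∀ᵐ ω ∂μ, 0 ≤ v ω := by
    have : ∀ j, 0 ≤ᵐ[μ] μ[fun ω => U j ω ^ 2 | G] := fun j =>
      condExp_nonneg (ae_of_all _ fun ω => sq_nonneg _)
    filter_upwards [ae_all_iff.2 this] with ω hω
    exact Finset.sum_nonneg fun j _ => mul_nonneg (sq_nonneg _) (hω j)
  have hexpG : ∀ {w : Ω → ℝ}, StronglyMeasurable[G] w →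
      StronglyMeasurable[G] fun ω => Real.exp (-(t ^ 2 / 2 * w ω)) := fun {w} hw => by
    have hc : Continuous fun x : ℝ => Real.exp (-(t ^ 2 / 2 * x)) := by fun_prop
    exact hc.comp_stronglyMeasurable hw
  have hexpb : ∀ {w : Ω → ℝ}, (∀ᵐ ω ∂μ, 0 ≤ w ω) →
      ∀ᵐ ω ∂μ, |Real.exp (-(t ^ 2 / 2 * w ω))| ≤ 1 := fun {w} hw => by
    filter_upwards [hw] with ω hω
    rw [Real.abs_exp]
    exact Real.exp_le_one_iff.2 (by have : 0 ≤ t ^ 2 / 2 * w ω := by positivity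
                                    linarith)
  have hexpi : ∀ {w : Ω → ℝ}, StronglyMeasurable[G] w → (∀ᵐ ω ∂μ, 0 ≤ w ω) →
      Integrable (fun ω => Real.exp (-(t ^ 2 / 2 * w ω))) μ := fun {w} hw hw0 =>
    Integrable.of_bound ((hexpG hw).mono h.sys.le).aestronglyMeasurable 1 (hexpb hw0)
  -- Replace the errors by their truncations.
  have step1 : ‖∫ ω, Complex.exp ((t * N ω : ℝ) * Complex.I) ∂μ
      - ∫ ω, Complex.exp ((t * NL ω : ℝ) * Complex.I) ∂μ‖ ≤ |t| * √(κ * K) := by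
    have hNNL : Integrable (fun ω => |N ω - NL ω|) μ := by
      refine Integrable.abs (Integrable.sub ?_ ?_)
      · exact integrable_finsetSum _ fun j _ => ((h.memLp_U j).integrable one_le_two).bdd_mul
          (h.aesm_b j) (ae_of_all _ (h.abs_b_le j))
      · exact integrable_finsetSum _ fun j _ => ((h.memLp_V hV j).integrable one_le_two).bdd_mul
          (h.aesm_b j) (ae_of_all _ (h.abs_b_le j))
    refine (norm_integral_sub_le_of_ae_le (integrable_exp_mul_I (hNm.const_mul t))
      (integrable_exp_mul_I (hNLm.const_mul t)) (hNNL.const_mul |t|)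
      (ae_of_all _ fun ω => ?_)).trans ?_
    · refine (norm_exp_mul_I_sub_exp_mul_I_le _ _).trans_eq ?_
      rw [← mul_sub, abs_mul]
    · rw [integral_const_mul]
      exact mul_le_mul_of_nonneg_left (h.integral_abs_sum_sub_le hV) (abs_nonneg _)
  have step2 : ‖∫ ω, Complex.exp ((t * NL ω : ℝ) * Complex.I) ∂μ
      - ∫ ω, (Real.exp (-(t ^ 2 / 2 * vL ω)) : ℂ) ∂μ‖ ≤ 17 * ((|t| * B) ^ 3 * √(K * ρ))
      + Real.exp (t ^ 2 * B ^ 2 * K / 2) * (t ^ 2 / 2) * (B ^ 2 * √ρ) := by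
    -- The exponential of `vL` is known given `G`, so the product can be inserted without changing
    -- its integral. The two integrands can then be compared pointwise.
    rw [← h.integral_prod_one_add_mul hV t (hexpG hvLm) (hexpb hvL0)]
    set x : ι → Ω → ℝ := fun j ω => t * b j ω * V j ω with hx
    -- Boundedness of `V` keeps the product uniformly bounded, so the random exponent `Q` may be
    -- exchanged for `vL` at the cost of their mean distance.
    have hT : ∀ ω, ‖∏ j, (1 + (x j ω : ℝ) * Complex.I)‖ ≤ Real.exp (t ^ 2 * B ^ 2 * K / 2) := by
      intro ω
      refine (norm_prod_one_add_mul_I_le _ _).trans (Real.exp_le_exp.2 ?_)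
      refine div_le_div_of_nonneg_right ?_ zero_le_two
      calc ∑ j, x j ω ^ 2 ≤ ∑ j, t ^ 2 * B ^ 2 * b j ω ^ 2 := by
            refine Finset.sum_le_sum fun j _ => ?_
            have : V j ω ^ 2 ≤ B ^ 2 := by
              rw [← sq_abs]; exact pow_le_pow_left₀ (abs_nonneg _) (hV.abs_V_le j ω) 2
            calc x j ω ^ 2 = t ^ 2 * b j ω ^ 2 * V j ω ^ 2 := by simp only [hx]; ring
              _ ≤ t ^ 2 * b j ω ^ 2 * B ^ 2 := mul_le_mul_of_nonneg_left this (by positivity)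
              _ = _ := by ring
        _ = t ^ 2 * B ^ 2 * ∑ j, b j ω ^ 2 := by rw [Finset.mul_sum]
        _ ≤ t ^ 2 * B ^ 2 * K := mul_le_mul_of_nonneg_left (h.sum_sq_b ω) (by positivity)
    have hTm : AEStronglyMeasurable (fun ω => ∏ j, (1 + (x j ω : ℝ) * Complex.I)) μ := by
      refine Finset.aestronglyMeasurable_fun_prod _ fun j _ => ?_
      have hc : Continuous fun y : ℝ => 1 + (y : ℂ) * Complex.I := by fun_prop
      exact hc.comp_aestronglyMeasurable (((h.aesm_b j).const_mul t).mul (h.aesm_V hV j))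
    have hQi : Integrable (fun ω => |Q ω - vL ω|) μ := by
      refine Integrable.abs (Integrable.sub ?_ ?_)
      · exact integrable_finsetSum _ fun j _ => (h.memLp_V hV j).integrable_sq.bdd_mul
          ((h.aesm_b j).pow 2) (ae_of_all _ (h.abs_sq_b_le j))
      · exact integrable_finsetSum _ fun j _ => integrable_condExp.bdd_mul
          ((h.aesm_b j).pow 2) (ae_of_all _ (h.abs_sq_b_le j))
    refine (norm_integral_sub_le_of_ae_le (integrable_exp_mul_I (hNLm.const_mul t))
      ((hexpi hvLm hvL0).ofReal.bdd_mul hTm (ae_of_all _ hT))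
      (c := fun ω => 17 * ((|t| * B) ^ 3 * √(K * ρ))
        + Real.exp (t ^ 2 * B ^ 2 * K / 2) * (t ^ 2 / 2) * |Q ω - vL ω|)
      ((integrable_const _).add (hQi.const_mul _)) ?_).trans ?_
    · filter_upwards [hvL0] with ω hω
      have hsum : t * NL ω = ∑ j, x j ω := by
        simp only [hNL, hx, Finset.mul_sum, mul_assoc]
      have hQx : ∑ j, x j ω ^ 2 = t ^ 2 * Q ω := by
        simp only [hQ, hx, Finset.mul_sum]
        exact Finset.sum_congr rfl fun j _ => by ring
      have h1 := norm_exp_sum_sub_prod_le Finset.univ (fun j => x j ω)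
      rw [← hsum, hQx] at h1
      have h2 := h.sum_abs_cube_le hV t ω
      have hQ0 : 0 ≤ Q ω := Finset.sum_nonneg fun j _ => by positivity
      have h3 : |Real.exp (-(t ^ 2 * Q ω) / 2) - Real.exp (-(t ^ 2 / 2 * vL ω))|
          ≤ t ^ 2 / 2 * |Q ω - vL ω| := by
        have e : -(t ^ 2 * Q ω) / 2 = -(t ^ 2 / 2 * Q ω) := by ring
        rw [e]
        refine (abs_exp_neg_sub_exp_neg_le (by positivity) (by positivity)).trans_eq ?_
        rw [← mul_sub, abs_mul, abs_of_nonneg (by positivity : (0 : ℝ) ≤ t ^ 2 / 2)]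
      have e : Complex.exp ((t * NL ω : ℝ) * Complex.I)
          - (∏ j, (1 + (x j ω : ℝ) * Complex.I)) * (Real.exp (-(t ^ 2 / 2 * vL ω)) : ℂ)
          = (Complex.exp ((t * NL ω : ℝ) * Complex.I)
            - (∏ j, (1 + (x j ω : ℝ) * Complex.I)) * (Real.exp (-(t ^ 2 * Q ω) / 2) : ℂ))
          + (∏ j, (1 + (x j ω : ℝ) * Complex.I))
            * ((Real.exp (-(t ^ 2 * Q ω) / 2) - Real.exp (-(t ^ 2 / 2 * vL ω)) : ℝ) : ℂ) := by
        rw [Complex.ofReal_sub]; ring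
      refine (congrArg norm e).trans_le ((norm_add_le _ _).trans (add_le_add (h1.trans ?_) ?_))
      · exact mul_le_mul_of_nonneg_left h2 (by norm_num : (0 : ℝ) ≤ 17)
      · rw [norm_mul, Complex.norm_real, Real.norm_eq_abs, mul_assoc]
        exact mul_le_mul (hT ω) h3 (abs_nonneg _) (Real.exp_pos _).le
    · rw [integral_add (integrable_const _) (hQi.const_mul _), integral_const, probReal_univ,
        one_smul, integral_const_mul]
      have hE : 0 ≤ Real.exp (t ^ 2 * B ^ 2 * K / 2) * (t ^ 2 / 2) := by positivity
      exact add_le_add le_rfl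
        (mul_le_mul_of_nonneg_left (h.integral_abs_sumSq_sub_condExp_le hV) hE)
  -- Return from the conditional variances of the truncations to those of the original errors.
  have step3 : ‖∫ ω, (Real.exp (-(t ^ 2 / 2 * vL ω)) : ℂ) ∂μ
      - ∫ ω, (Real.exp (-(t ^ 2 / 2 * v ω)) : ℂ) ∂μ‖ ≤ t ^ 2 / 2 * (K * (√κ * (3 + K))) := by
    refine (norm_integral_sub_le_of_ae_le (hexpi hvLm hvL0).ofReal (hexpi hvm hv0).ofReal
      (c := fun _ => t ^ 2 / 2 * (K * (√κ * (3 + K)))) (integrable_const _) ?_).trans ?_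
    · filter_upwards [hvL0, hv0, h.abs_condVar_sub_le hV] with ω h1 h2 h3
      change ‖((Real.exp (-(t ^ 2 / 2 * vL ω)) : ℝ) : ℂ) - (Real.exp (-(t ^ 2 / 2 * v ω)) : ℝ)‖ ≤ _
      rw [← Complex.ofReal_sub, Complex.norm_real, Real.norm_eq_abs]
      refine (abs_exp_neg_sub_exp_neg_le (by positivity) (by positivity)).trans ?_
      rw [← mul_sub, abs_mul, abs_of_nonneg (by positivity : (0 : ℝ) ≤ t ^ 2 / 2)]
      exact mul_le_mul_of_nonneg_left h3 (by positivity)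
    · simp
  have htri := norm_add_le
    (∫ ω, Complex.exp ((t * N ω : ℝ) * Complex.I) ∂μ - ∫ ω, Complex.exp ((t * NL ω : ℝ) * Complex.I) ∂μ
      + (∫ ω, Complex.exp ((t * NL ω : ℝ) * Complex.I) ∂μ
        - ∫ ω, (Real.exp (-(t ^ 2 / 2 * vL ω)) : ℂ) ∂μ))
    (∫ ω, (Real.exp (-(t ^ 2 / 2 * vL ω)) : ℂ) ∂μ - ∫ ω, (Real.exp (-(t ^ 2 / 2 * v ω)) : ℂ) ∂μ)
  have htri2 := norm_add_le
    (∫ ω, Complex.exp ((t * N ω : ℝ) * Complex.I) ∂μ - ∫ ω, Complex.exp ((t * NL ω : ℝ) * Complex.I) ∂μ)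
    (∫ ω, Complex.exp ((t * NL ω : ℝ) * Complex.I) ∂μ
        - ∫ ω, (Real.exp (-(t ^ 2 / 2 * vL ω)) : ℂ) ∂μ)
  rw [sub_add_sub_cancel] at htri2
  rw [sub_add_sub_cancel, sub_add_sub_cancel] at htri
  linarith

/-- Truncation is paid for twice, in the squares and in the conditional variances; the law of large
numbers for bounded variables gives the last term. -/
theorem integral_abs_sumSq_sub_condVar_le (h : WeightedErrors G base loc rest μ U b K η ρ)
    (hV : BoundedApprox G base loc μ U V B κ) :
    ∫ ω, |∑ j, b j ω ^ 2 * U j ω ^ 2 - ∑ j, b j ω ^ 2 * (μ[fun ω => U j ω ^ 2 | G]) ω| ∂μ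
      ≤ 2 * (K * (√κ * (3 + K))) + B ^ 2 * √ρ := by
  have hR : Integrable (fun ω => ∑ j, b j ω ^ 2 * U j ω ^ 2) μ :=
    integrable_finsetSum _ fun j _ => (h.memLp_U j).integrable_sq.bdd_mul
      ((h.aesm_b j).pow 2) (ae_of_all _ (h.abs_sq_b_le j))
  have hQ : Integrable (fun ω => ∑ j, b j ω ^ 2 * V j ω ^ 2) μ :=
    integrable_finsetSum _ fun j _ => (h.memLp_V hV j).integrable_sq.bdd_mul
      ((h.aesm_b j).pow 2) (ae_of_all _ (h.abs_sq_b_le j))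
  have hvL : Integrable (fun ω => ∑ j, b j ω ^ 2 * (μ[fun ω => V j ω ^ 2 | base j]) ω) μ :=
    integrable_finsetSum _ fun j _ => integrable_condExp.bdd_mul
      ((h.aesm_b j).pow 2) (ae_of_all _ (h.abs_sq_b_le j))
  have i1 := (hR.sub hQ).abs
  have i2 := (hQ.sub hvL).abs
  calc _ ≤ ∫ ω, (|∑ j, b j ω ^ 2 * U j ω ^ 2 - ∑ j, b j ω ^ 2 * V j ω ^ 2|
          + |∑ j, b j ω ^ 2 * V j ω ^ 2 - ∑ j, b j ω ^ 2 * (μ[fun ω => V j ω ^ 2 | base j]) ω|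
          + K * (√κ * (3 + K))) ∂μ := by
        refine integral_mono_of_nonneg (ae_of_all _ fun ω => abs_nonneg _)
          ((i1.add i2).add (integrable_const _)) ?_
        filter_upwards [h.abs_condVar_sub_le hV] with ω h1
        have h2 := abs_sub_le (∑ j, b j ω ^ 2 * U j ω ^ 2) (∑ j, b j ω ^ 2 * V j ω ^ 2)
          (∑ j, b j ω ^ 2 * (μ[fun ω => U j ω ^ 2 | G]) ω)
        have h3 := abs_sub_le (∑ j, b j ω ^ 2 * V j ω ^ 2)
          (∑ j, b j ω ^ 2 * (μ[fun ω => V j ω ^ 2 | base j]) ω)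
          (∑ j, b j ω ^ 2 * (μ[fun ω => U j ω ^ 2 | G]) ω)
        linarith
    _ ≤ 2 * (K * (√κ * (3 + K))) + B ^ 2 * √ρ := by
        have h1 := h.integral_abs_sumSq_sub_le hV
        have h2 := h.integral_abs_sumSq_sub_condExp_le hV
        have e := integral_add (i1.add i2) (integrable_const (μ := μ) (K * (√κ * (3 + K))))
        have e' := integral_add i1 i2
        simp only [Pi.sub_apply, Pi.add_apply, integral_const, probReal_univ, one_smul] at e e'
        rw [e, e']
        linarith

theorem integral_abs_sum_le (h : WeightedErrors G base loc rest μ U b K η ρ) :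
    ∫ ω, |∑ j, b j ω * U j ω| ∂μ ≤ √((1 + K) * K) := by
  have hL : MemLp (fun ω => ∑ j, b j ω * U j ω) 2 μ :=
    memLp_finsetSum _ fun j _ => memLp_mul_of_bound (h.memLp_U j) (h.aesm_b j) (h.abs_b_le j)
  refine (integral_abs_le_sqrt hL).trans (Real.sqrt_le_sqrt ?_)
  rw [h.sys.integral_sum_sq Finset.univ h.measurable_b h.abs_b_le h.measurable_U h.memLp_U
    h.condExp_U]
  calc ∑ j, ∫ ω, b j ω ^ 2 * U j ω ^ 2 ∂μ ≤ ∑ j, (1 + K) * ∫ ω, b j ω ^ 2 ∂μ := by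
        refine Finset.sum_le_sum fun j _ => ?_
        exact integral_mul_le_of_condExp_le h.sys.le ((h.measurable_b j).pow 2)
          (fun ω => sq_nonneg _) (h.integrable_sq_b j) (h.memLp_U j).integrable_sq
          ((h.memLp_U j).integrable_sq.bdd_mul ((h.aesm_b j).pow 2)
            (ae_of_all _ (h.abs_sq_b_le j))) (h.condExp_sq_le j)
    _ = (1 + K) * ∑ j, ∫ ω, b j ω ^ 2 ∂μ := by rw [Finset.mul_sum]
    _ ≤ (1 + K) * K := mul_le_mul_of_nonneg_left h.sum_integral_sq_b_le (by linarith [h.K_nonneg])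

theorem exists_boundedApprox (h : WeightedErrors G base loc rest μ U b K η ρ) {L κ : ℝ}
    (hL : 0 < L) (hκ : 0 < κ) (hκ1 : κ ≤ 1) (hLκ : K * L ^ (-η) ≤ κ) :
    ∃ V : ι → Ω → ℝ, BoundedApprox G base loc μ U V (2 * L) κ := by
  choose V h1 h2 h3 h4 using fun j => h.sys.exists_bounded_approx h.eta_pos hL (h.measurable_U j)
    (h.integrable_U j) (h.memLp_U j) (h.condExp_U j) (h.moment j)
  exact ⟨V, hκ, hκ1, by positivity, h1, h2, h3, fun j => (h4 j).mono fun ω hω => hω.trans hLκ⟩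

end WeightedErrors

/-- Here `1 / √R - 1 = (1 - R) / (√R + R)`, and the denominator is at least one because `R` and `√R`
are both at least `1 / 2`. -/
theorem abs_mul_inv_sqrt_sub_le {N R δ : ℝ} (hδ : δ ≤ 1 / 2) (hR : |R - 1| ≤ δ) :
    |N / √R - N| ≤ δ * |N| := by
  rw [abs_le] at hR
  have hR0 : 1 / 2 ≤ R := by linarith
  have hs : 1 / 2 ≤ √R := by
    apply Real.le_sqrt_of_sq_le; linarith
  have hss : √R * √R = R := Real.mul_self_sqrt (by linarith)
  have hspos : 0 < √R := by linarith
  have e : N / √R - N = N * ((1 - R) / (√R + R)) := by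
    have key : ∀ s : ℝ, 0 < s → N / s - N = N * ((1 - s * s) / (s + s * s)) := fun s hs => by
      have : s + s * s ≠ 0 := by positivity
      field_simp
      ring
    have := key _ hspos
    rwa [hss] at this
  have hden : 1 ≤ √R + R := by linarith
  rw [e, abs_mul, mul_comm, abs_div, abs_of_pos (by linarith : 0 < √R + R)]
  refine mul_le_mul_of_nonneg_right ?_ (abs_nonneg _)
  refine (div_le_self (abs_nonneg _) hden).trans ?_
  rw [abs_le]; constructor <;> linarith

/-! ### The self-normalized central limit theorem. -/

section Sequences

variable {Ω ι : ℕ → Type*} [∀ n, Fintype (ι n)] {G : ∀ n, MeasurableSpace (Ω n)}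
  {base loc rest : ∀ n, ι n → MeasurableSpace (Ω n)} {m₀ : ∀ n, MeasurableSpace (Ω n)}
  {μ : ∀ n, Measure (Ω n)} [∀ n, IsProbabilityMeasure (μ n)] {U b : ∀ n, ι n → Ω n → ℝ}
  {K η : ℝ} {ρ : ℕ → ℝ}

theorem exists_truncation_level {K η κ : ℝ} (hη : 0 < η) (hκ : 0 < κ) :
    ∃ L : ℝ, 0 < L ∧ K * L ^ (-η) ≤ κ := by
  have h : Tendsto (fun L : ℝ => K * L ^ (-η)) atTop (nhds (K * 0)) :=
    (tendsto_rpow_neg_atTop hη).const_mul K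
  rw [mul_zero] at h
  obtain ⟨L, h1, h2⟩ := ((h.eventually (gt_mem_nhds hκ)).and (eventually_gt_atTop 0)).exists
  exact ⟨L, h2, h1.le⟩

theorem WeightedErrors.tendsto_integral_exp
    (h : ∀ n, WeightedErrors (G n) (base n) (loc n) (rest n) (μ n) (U n) (b n) K η (ρ n))
    (hρ : Tendsto ρ atTop (nhds 0))
    (hv : Tendsto (fun n => (μ n).real
      {ω | ∑ j, b n j ω ^ 2 * ((μ n)[fun ω => U n j ω ^ 2 | G n]) ω ≠ 1}) atTop (nhds 0)) (t : ℝ) :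
    Tendsto (fun n => ∫ ω, Complex.exp ((t * ∑ j, b n j ω * U n j ω : ℝ) * Complex.I) ∂(μ n))
      atTop (nhds (Real.exp (-(t ^ 2 / 2)))) := by
  have hη := (h 0).eta_pos
  rw [Metric.tendsto_atTop']
  intro ε hε
  -- The order of choices matters: `κ` first, then the truncation level `L`, and only then large
  -- `n`, since the terms in `ρ n` have coefficients that grow with `L`.
  obtain ⟨κ, hκ, hκ1, hκε⟩ : ∃ κ : ℝ, 0 < κ ∧ κ ≤ 1 ∧
      |t| * √(κ * K) + t ^ 2 / 2 * (K * (√κ * (3 + K))) < ε / 3 := by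
    have hc : Continuous fun κ : ℝ => |t| * √(κ * K) + t ^ 2 / 2 * (K * (√κ * (3 + K))) := by
      fun_prop
    have h0 := (hc.tendsto 0).mono_left (nhdsWithin_le_nhds (s := Set.Ioi 0))
    simp only [zero_mul, Real.sqrt_zero, mul_zero, add_zero] at h0
    have h1 := h0.eventually (gt_mem_nhds (by positivity : 0 < ε / 3))
    obtain ⟨κ, e1, e2⟩ := (h1.and (Ioc_mem_nhdsGT (zero_lt_one (α := ℝ)))).exists
    exact ⟨κ, e2.1, e2.2, e1⟩
  obtain ⟨L, hL, hLκ⟩ := exists_truncation_level (K := K) hη hκ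
  set B := 2 * L
  have hρε : ∀ᶠ n in atTop, 17 * ((|t| * B) ^ 3 * √(K * ρ n))
      + Real.exp (t ^ 2 * B ^ 2 * K / 2) * (t ^ 2 / 2) * (B ^ 2 * √(ρ n)) < ε / 3 := by
    have hc : Continuous fun r : ℝ => 17 * ((|t| * B) ^ 3 * √(K * r))
        + Real.exp (t ^ 2 * B ^ 2 * K / 2) * (t ^ 2 / 2) * (B ^ 2 * √r) := by
      fun_prop
    have h0 := (hc.tendsto 0).comp hρ
    simp only [mul_zero, Real.sqrt_zero, add_zero] at h0
    exact h0.eventually (gt_mem_nhds (by positivity : 0 < ε / 3))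
  have hvε := hv.eventually (gt_mem_nhds (by positivity : 0 < ε / 3))
  obtain ⟨n₀, hn₀⟩ := eventually_atTop.1 (hρε.and hvε)
  refine ⟨n₀, fun n hn => ?_⟩
  obtain ⟨e1, e2⟩ := hn₀ n hn.le
  obtain ⟨V, hV⟩ := (h n).exists_boundedApprox hL hκ hκ1 hLκ
  have e3 := (h n).norm_integral_exp_sub_le hV t
  set v : Ω n → ℝ := fun ω => ∑ j, b n j ω ^ 2 * ((μ n)[fun ω => U n j ω ^ 2 | G n]) ω with hvdef
  have hvm : StronglyMeasurable v := Finset.stronglyMeasurable_fun_sum _ fun j _ =>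
    ((((h n).measurable_b j).mono (h n).sys.le).pow 2).mul
      (stronglyMeasurable_condExp.mono (h n).sys.le)
  have hv0 : ∀ᵐ ω ∂(μ n), 0 ≤ v ω := by
    have : ∀ j, 0 ≤ᵐ[μ n] (μ n)[fun ω => U n j ω ^ 2 | G n] := fun j =>
      condExp_nonneg (ae_of_all _ fun ω => sq_nonneg _)
    filter_upwards [ae_all_iff.2 this] with ω hω
    exact Finset.sum_nonneg fun j _ => mul_nonneg (sq_nonneg _) (hω j)
  have hS : MeasurableSet {ω | v ω ≠ 1} := (hvm.measurable (measurableSet_singleton 1)).compl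
  have hb : ∀ {x : ℝ}, 0 ≤ x → Real.exp (-(t ^ 2 / 2 * x)) ≤ 1 := fun {x} hx =>
    Real.exp_le_one_iff.2 (by have : 0 ≤ t ^ 2 / 2 * x := by positivity
                              linarith)
  -- Both exponentials lie in `[0, 1]` almost surely and they agree where the conditional variance
  -- equals one.
  have e4 : ‖∫ ω, ((Real.exp (-(t ^ 2 / 2 * v ω)) : ℝ) : ℂ) ∂(μ n)
      - ∫ _, ((Real.exp (-(t ^ 2 / 2)) : ℝ) : ℂ) ∂(μ n)‖ ≤ (μ n).real {ω | v ω ≠ 1} := by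
    have hi : Integrable (fun ω => Real.exp (-(t ^ 2 / 2 * v ω))) (μ n) := by
      refine Integrable.of_bound ?_ 1 ?_
      · have hc : Continuous fun x : ℝ => Real.exp (-(t ^ 2 / 2 * x)) := by fun_prop
        exact (hc.comp_stronglyMeasurable hvm).aestronglyMeasurable
      · filter_upwards [hv0] with ω hω
        rw [Real.norm_eq_abs, Real.abs_exp]
        exact hb hω
    refine (norm_integral_sub_le_of_ae_le hi.ofReal (integrable_const _)
      (c := Set.indicator {ω | v ω ≠ 1} fun _ => (1 : ℝ))
      ((integrable_const _).indicator hS) ?_).trans ?_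
    · filter_upwards [hv0] with ω hω
      by_cases hω1 : v ω = 1
      · simp [hω1]
      · rw [Set.indicator_of_mem (by exact hω1)]
        change ‖((Real.exp (-(t ^ 2 / 2 * v ω)) : ℝ) : ℂ) - (Real.exp (-(t ^ 2 / 2)) : ℝ)‖ ≤ 1
        rw [← Complex.ofReal_sub, Complex.norm_real, Real.norm_eq_abs, abs_le]
        have h1 := hb hω
        have h2 := hb zero_le_one
        rw [mul_one] at h2
        constructor <;> linarith [Real.exp_pos (-(t ^ 2 / 2 * v ω)), Real.exp_pos (-(t ^ 2 / 2))]
    · rw [integral_indicator_const _ hS]; simp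
  rw [integral_const, probReal_univ, one_smul] at e4
  rw [dist_eq_norm]
  refine (norm_sub_le_norm_sub_add_norm_sub _
    (∫ ω, ((Real.exp (-(t ^ 2 / 2 * v ω)) : ℝ) : ℂ) ∂(μ n)) _).trans_lt ?_
  linarith

/-- Off the vanishing event `v ≠ 1` the deviation from one is a deviation from `v`, which Markov's
inequality controls through `integral_abs_sumSq_sub_condVar_le`. -/
theorem WeightedErrors.tendsto_measureReal_abs_sumSq_sub_one
    (h : ∀ n, WeightedErrors (G n) (base n) (loc n) (rest n) (μ n) (U n) (b n) K η (ρ n))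
    (hρ : Tendsto ρ atTop (nhds 0))
    (hv : Tendsto (fun n => (μ n).real
      {ω | ∑ j, b n j ω ^ 2 * ((μ n)[fun ω => U n j ω ^ 2 | G n]) ω ≠ 1}) atTop (nhds 0))
    {δ : ℝ} (hδ : 0 < δ) :
    Tendsto (fun n => (μ n).real {ω | δ < |∑ j, b n j ω ^ 2 * U n j ω ^ 2 - 1|})
      atTop (nhds 0) := by
  have hη := (h 0).eta_pos
  rw [Metric.tendsto_atTop']
  intro ε hε
  obtain ⟨κ, hκ, hκ1, hκε⟩ : ∃ κ : ℝ, 0 < κ ∧ κ ≤ 1 ∧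
      2 * (K * (√κ * (3 + K))) < δ * (ε / 3) := by
    have hc : Continuous fun κ : ℝ => 2 * (K * (√κ * (3 + K))) := by fun_prop
    have h0 := (hc.tendsto 0).mono_left (nhdsWithin_le_nhds (s := Set.Ioi 0))
    simp only [zero_mul, Real.sqrt_zero, mul_zero] at h0
    have h1 := h0.eventually (gt_mem_nhds (by positivity : 0 < δ * (ε / 3)))
    obtain ⟨κ, e1, e2⟩ := (h1.and (Ioc_mem_nhdsGT (zero_lt_one (α := ℝ)))).exists
    exact ⟨κ, e2.1, e2.2, e1⟩
  obtain ⟨L, hL, hLκ⟩ := exists_truncation_level (K := K) hη hκ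
  set B := 2 * L
  have hρε : ∀ᶠ n in atTop, B ^ 2 * √(ρ n) < δ * (ε / 3) := by
    have hc : Continuous fun r : ℝ => B ^ 2 * √r := by fun_prop
    have h0 := (hc.tendsto 0).comp hρ
    simp only [mul_zero, Real.sqrt_zero] at h0
    exact h0.eventually (gt_mem_nhds (by positivity : 0 < δ * (ε / 3)))
  have hvε := hv.eventually (gt_mem_nhds (by positivity : 0 < ε / 3))
  obtain ⟨n₀, hn₀⟩ := eventually_atTop.1 (hρε.and hvε)
  refine ⟨n₀, fun n hn => ?_⟩
  obtain ⟨e1, e2⟩ := hn₀ n hn.le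
  obtain ⟨V, hV⟩ := (h n).exists_boundedApprox hL hκ hκ1 hLκ
  have e3 := (h n).integral_abs_sumSq_sub_condVar_le hV
  set v : Ω n → ℝ := fun ω => ∑ j, b n j ω ^ 2 * ((μ n)[fun ω => U n j ω ^ 2 | G n]) ω with hvdef
  set R : Ω n → ℝ := fun ω => ∑ j, b n j ω ^ 2 * U n j ω ^ 2 with hRdef
  have hR : Integrable R (μ n) :=
    integrable_finsetSum _ fun j _ => ((h n).memLp_U j).integrable_sq.bdd_mul
      (((h n).aesm_b j).pow 2) (ae_of_all _ ((h n).abs_sq_b_le j))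
  have hvi : Integrable v (μ n) :=
    integrable_finsetSum _ fun j _ => integrable_condExp.bdd_mul
      (((h n).aesm_b j).pow 2) (ae_of_all _ ((h n).abs_sq_b_le j))
  have hmk := mul_meas_ge_le_integral_of_nonneg (μ := μ n)
    (ae_of_all _ fun ω => abs_nonneg (R ω - v ω)) (hR.sub hvi).abs δ
  have hsub : (μ n).real {ω | δ < |R ω - 1|}
      ≤ (μ n).real {ω | v ω ≠ 1} + (μ n).real {ω | δ ≤ |R ω - v ω|} := by
    refine (measureReal_mono ?_).trans (measureReal_union_le _ _)
    intro ω hω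
    by_cases hv1 : v ω = 1
    · right
      have : δ < |R ω - 1| := hω
      change δ ≤ |R ω - v ω|
      rw [hv1]; exact this.le
    · left; exact hv1
  have hlt : (μ n).real {ω | δ ≤ |R ω - v ω|} < 2 * (ε / 3) := by
    have h1 : δ * (μ n).real {ω | δ ≤ |R ω - v ω|} < δ * (2 * (ε / 3)) := by
      refine hmk.trans_lt (lt_of_le_of_lt e3 ?_)
      linarith
    exact lt_of_mul_lt_mul_left h1 hδ.le
  rw [Real.dist_eq, sub_zero, abs_of_nonneg measureReal_nonneg]
  linarith

/-- Central limit theorem for self-normalized sums with conditionally known weights. -/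
theorem WeightedErrors.tendsto_integral_exp_div
    (h : ∀ n, WeightedErrors (G n) (base n) (loc n) (rest n) (μ n) (U n) (b n) K η (ρ n))
    (hρ : Tendsto ρ atTop (nhds 0))
    (hv : Tendsto (fun n => (μ n).real
      {ω | ∑ j, b n j ω ^ 2 * ((μ n)[fun ω => U n j ω ^ 2 | G n]) ω ≠ 1}) atTop (nhds 0)) (t : ℝ) :
    Tendsto (fun n => ∫ ω, Complex.exp
      ((t * ((∑ j, b n j ω * U n j ω) / √(∑ j, b n j ω ^ 2 * U n j ω ^ 2)) : ℝ) * Complex.I) ∂(μ n))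
      atTop (nhds (Real.exp (-(t ^ 2 / 2)))) := by
  have hT := WeightedErrors.tendsto_integral_exp h hρ hv t
  rw [Metric.tendsto_atTop'] at hT ⊢
  intro ε hε
  obtain ⟨δ, hδ, hδ2, hδε⟩ : ∃ δ : ℝ, 0 < δ ∧ δ ≤ 1 / 2 ∧ |t| * δ * √((1 + K) * K) < ε / 3 := by
    have hc : Continuous fun δ : ℝ => |t| * δ * √((1 + K) * K) := by fun_prop
    have h0 := (hc.tendsto 0).mono_left (nhdsWithin_le_nhds (s := Set.Ioi 0))
    simp only [zero_mul, mul_zero] at h0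
    have h1 := h0.eventually (gt_mem_nhds (by positivity : 0 < ε / 3))
    obtain ⟨δ, e1, e2⟩ := (h1.and (Ioc_mem_nhdsGT (by norm_num : (0 : ℝ) < 1 / 2))).exists
    exact ⟨δ, e2.1, e2.2, e1⟩
  have hR := (WeightedErrors.tendsto_measureReal_abs_sumSq_sub_one h hρ hv hδ).eventually
    (gt_mem_nhds (by positivity : 0 < ε / 6))
  obtain ⟨n₀, hn₀⟩ := hT (ε / 3) (by positivity)
  obtain ⟨n₁, hn₁⟩ := eventually_atTop.1 hR
  refine ⟨max n₀ n₁, fun n hn => ?_⟩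
  have e1 := hn₀ n ((le_max_left _ _).trans_lt hn)
  have e2 := hn₁ n ((le_max_right _ _).trans hn.le)
  set N : Ω n → ℝ := fun ω => ∑ j, b n j ω * U n j ω with hN
  set R : Ω n → ℝ := fun ω => ∑ j, b n j ω ^ 2 * U n j ω ^ 2 with hR
  have hbm : ∀ j, Measurable (b n j) := fun j => (((h n).measurable_b j).mono (h n).sys.le).measurable
  have hUm : ∀ j, Measurable (U n j) := fun j =>
    (((h n).measurable_U j).mono ((h n).sys.loc_le j)).measurable
  have hNm : Measurable N := Finset.measurable_fun_sum _ fun j _ => (hbm j).mul (hUm j)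
  have hRm : Measurable R :=
    Finset.measurable_fun_sum _ fun j _ => ((hbm j).pow_const 2).mul ((hUm j).pow_const 2)
  have hNi : Integrable (fun ω => |N ω|) (μ n) :=
    Integrable.abs (integrable_finsetSum _ fun j _ =>
      (((h n).memLp_U j).integrable one_le_two).bdd_mul ((h n).aesm_b j)
        (ae_of_all _ ((h n).abs_b_le j)))
  have hS : MeasurableSet {ω | δ < |R ω - 1|} :=
    measurableSet_lt measurable_const (by fun_prop)
  -- Where `R` is within `δ` of one, dividing by `√R` moves the numerator `N` by at most `δ * |N|`,
  -- and `N` is bounded in mean. Elsewhere the two exponentials differ by at most two.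
  have hdiff : ‖∫ ω, Complex.exp ((t * (N ω / √(R ω)) : ℝ) * Complex.I) ∂(μ n)
      - ∫ ω, Complex.exp ((t * N ω : ℝ) * Complex.I) ∂(μ n)‖
      ≤ 2 * (μ n).real {ω | δ < |R ω - 1|} + |t| * δ * √((1 + K) * K) := by
    have hq : Measurable fun ω => t * (N ω / √(R ω)) := by fun_prop
    refine (norm_integral_sub_le_of_ae_le (integrable_exp_mul_I hq.aestronglyMeasurable)
      (integrable_exp_mul_I (hNm.const_mul t).aestronglyMeasurable)
      (c := fun ω => Set.indicator {ω | δ < |R ω - 1|} (fun _ => (2 : ℝ)) ω + |t| * δ * |N ω|)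
      (((integrable_const _).indicator hS).add (hNi.const_mul _)) (ae_of_all _ fun ω => ?_)).trans ?_
    · by_cases hω : δ < |R ω - 1|
      · rw [Set.indicator_of_mem (by exact hω)]
        have h1 := norm_sub_le (Complex.exp ((t * (N ω / √(R ω)) : ℝ) * Complex.I))
          (Complex.exp ((t * N ω : ℝ) * Complex.I))
        rw [Complex.norm_exp_ofReal_mul_I, Complex.norm_exp_ofReal_mul_I] at h1
        have h2 : 0 ≤ |t| * δ * |N ω| := by positivity
        linarith
      · rw [Set.indicator_of_notMem (by exact hω), zero_add]
        refine (norm_exp_mul_I_sub_exp_mul_I_le _ _).trans ?_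
        rw [← mul_sub, abs_mul, mul_assoc]
        exact mul_le_mul_of_nonneg_left (abs_mul_inv_sqrt_sub_le hδ2 (not_lt.1 hω)) (abs_nonneg _)
    · rw [integral_add ((integrable_const _).indicator hS) (hNi.const_mul _), integral_const_mul,
        integral_indicator_const _ hS, smul_eq_mul, mul_comm]
      exact add_le_add le_rfl
        (mul_le_mul_of_nonneg_left (h n).integral_abs_sum_le (by positivity))
  rw [dist_eq_norm] at e1 ⊢
  refine (norm_sub_le_norm_sub_add_norm_sub _
    (∫ ω, Complex.exp ((t * N ω : ℝ) * Complex.I) ∂(μ n)) _).trans_lt ?_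
  linarith

end Sequences

/-- Convergence in distribution to the standard normal law from convergence of the characteristic
functions of variables which agree with the given ones with probability tending to one. -/
theorem tendstoInDistribution_gaussian_of_tendsto_integral_exp {Ω : ℕ → Type*}
    {m₀ : ∀ n, MeasurableSpace (Ω n)} {μ : ∀ n, Measure (Ω n)} [∀ n, IsProbabilityMeasure (μ n)]
    {S T : ∀ n, Ω n → ℝ} (hS : ∀ n, Measurable (S n)) (hT : ∀ n, Measurable (T n))
    (hST : Tendsto (fun n => (μ n).real {ω | S n ω ≠ T n ω}) atTop (nhds 0))
    (h : ∀ t : ℝ, Tendsto (fun n => ∫ ω, Complex.exp ((t * T n ω : ℝ) * Complex.I) ∂(μ n))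
      atTop (nhds (Real.exp (-(t ^ 2 / 2))))) :
    TendstoInDistribution S atTop (id : ℝ → ℝ) μ (gaussianReal 0 1) where
  forall_aemeasurable n := (hS n).aemeasurable
  tendsto := by
    refine ProbabilityMeasure.tendsto_iff_tendsto_charFun.2 fun t => ?_
    change Tendsto (fun n => charFun ((μ n).map (S n)) t) atTop
      (nhds (charFun ((gaussianReal 0 1).map id) t))
    have hlim : charFun ((gaussianReal 0 1).map id) t = (Real.exp (-(t ^ 2 / 2)) : ℂ) := by
      rw [Measure.map_id, charFun_gaussianReal]
      push_cast
      congr 1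
      simp
    have hchar : ∀ n, charFun ((μ n).map (S n)) t
        = ∫ ω, Complex.exp ((t * S n ω : ℝ) * Complex.I) ∂(μ n) := fun n => by
      rw [charFun_apply_real, integral_map (hS n).aemeasurable]
      · push_cast; rfl
      · fun_prop
    simp_rw [hchar, hlim]
    have hd : Tendsto (fun n => ∫ ω, Complex.exp ((t * S n ω : ℝ) * Complex.I) ∂(μ n)
        - ∫ ω, Complex.exp ((t * T n ω : ℝ) * Complex.I) ∂(μ n)) atTop (nhds 0) := by
      refine squeeze_zero_norm (a := fun n => 2 * (μ n).real {ω | S n ω ≠ T n ω}) (fun n => ?_)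
        (by simpa using hST.const_mul 2)
      have hA : MeasurableSet {ω | S n ω ≠ T n ω} :=
        (measurableSet_eq_fun (hS n) (hT n)).compl
      refine (norm_integral_sub_le_of_ae_le
        (integrable_exp_mul_I ((hS n).const_mul t).aestronglyMeasurable)
        (integrable_exp_mul_I ((hT n).const_mul t).aestronglyMeasurable)
        (c := Set.indicator {ω | S n ω ≠ T n ω} (fun _ => (2 : ℝ)))
        ((integrable_const _).indicator hA) (ae_of_all _ fun ω => ?_)).trans_eq ?_
      · by_cases hω : S n ω = T n ω
        · simp [hω]
        · rw [Set.indicator_of_mem (by exact hω)]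
          have h1 := norm_sub_le (Complex.exp ((t * S n ω : ℝ) * Complex.I))
            (Complex.exp ((t * T n ω : ℝ) * Complex.I))
          rw [Complex.norm_exp_ofReal_mul_I, Complex.norm_exp_ofReal_mul_I] at h1
          linarith
      · rw [integral_indicator_const _ hA, smul_eq_mul, mul_comm]
    have := hd.add (h t)
    simpa using this

/-! ### The residual projection matrix. -/

section Projection

open InnerProductSpace

variable {n p : ℕ}

/-- An explicit formula for the projection, which yields both its measurability in the controls and
the trace bound. No rank condition is needed: Gram–Schmidt vectors that vanish contribute zero. -/
theorem starProjection_span_range_eq_sum (f : Fin p → EuclideanSpace ℝ (Fin n))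
    (v : EuclideanSpace ℝ (Fin n)) :
    (Submodule.span ℝ (Set.range f)).starProjection v
      = ∑ j, (inner ℝ (gramSchmidt ℝ f j) v / ‖gramSchmidt ℝ f j‖ ^ 2) • gramSchmidt ℝ f j := by
  have hspan := span_gramSchmidt ℝ f
  apply Submodule.eq_starProjection_of_mem_of_inner_eq_zero
  · rw [← hspan]
    exact Submodule.sum_mem _ fun j _ =>
      Submodule.smul_mem _ _ (Submodule.subset_span ⟨j, rfl⟩)
  · intro w hw
    rw [← hspan] at hw
    induction hw using Submodule.span_induction with
    | mem x hx =>
      obtain ⟨i, rfl⟩ := hx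
      rw [inner_sub_left, sum_inner, Finset.sum_eq_single i]
      · rw [real_inner_smul_left, real_inner_self_eq_norm_sq, real_inner_comm]
        by_cases h0 : gramSchmidt ℝ f i = 0
        · simp [h0]
        · have : ‖gramSchmidt ℝ f i‖ ≠ 0 := norm_ne_zero_iff.2 h0
          field_simp
          ring
      · intro j _ hji
        rw [real_inner_smul_left, gramSchmidt_orthogonal ℝ f hji, mul_zero]
      · simp
    | zero => simp
    | add x y _ _ hx hy => rw [inner_add_right, hx, hy, add_zero]
    | smul a x _ hx => rw [real_inner_smul_right, hx, mul_zero]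

theorem measurable_gramSchmidt {Ω : Type*} {m : MeasurableSpace Ω}
    {f : Fin p → Ω → EuclideanSpace ℝ (Fin n)} (hf : ∀ j, Measurable (f j)) (j : Fin p) :
    Measurable fun ω => gramSchmidt ℝ (fun j => f j ω) j := by
  induction j using WellFoundedLT.induction with
  | ind j ih =>
    have : (fun ω => gramSchmidt ℝ (fun j => f j ω) j) = fun ω => f j ω
        - ∑ i ∈ Finset.Iio j, (inner ℝ (gramSchmidt ℝ (fun j => f j ω) i) (f j ω)
          / ‖gramSchmidt ℝ (fun j => f j ω) i‖ ^ 2) • gramSchmidt ℝ (fun j => f j ω) i := by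
      funext ω
      rw [gramSchmidt_def]
      simp_rw [Submodule.starProjection_singleton]
      rfl
    rw [this]
    refine (hf j).sub (Finset.measurable_fun_sum _ fun i hi => ?_)
    have hi' := ih i (Finset.mem_Iio.1 hi)
    exact ((hi'.inner (hf j)).div (hi'.norm.pow_const 2)).smul hi'

theorem measurable_starProjection_span {Ω : Type*} {m : MeasurableSpace Ω}
    {f : Fin p → Ω → EuclideanSpace ℝ (Fin n)} (hf : ∀ j, Measurable (f j))
    {v : Ω → EuclideanSpace ℝ (Fin n)} (hv : Measurable v) :
    Measurable fun ω => (Submodule.span ℝ (Set.range fun j => f j ω)).starProjection (v ω) := by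
  simp_rw [starProjection_span_range_eq_sum]
  refine Finset.measurable_fun_sum _ fun j _ => ?_
  have hj := measurable_gramSchmidt hf j
  exact ((hj.inner hv).div (hj.norm.pow_const 2)).smul hj

/-- The entries of the matrix of the projection onto the orthogonal complement of `K`. -/
def residualEntry (K : Submodule ℝ (EuclideanSpace ℝ (Fin n))) (i k : Fin n) : ℝ :=
  (EuclideanSpace.single k (1 : ℝ) - K.starProjection (EuclideanSpace.single k 1)) i

theorem euclidean_eq_sum_single (v : EuclideanSpace ℝ (Fin n)) :
    v = ∑ k, v k • EuclideanSpace.single k (1 : ℝ) := by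
  ext i
  simp [Finset.sum_apply, Pi.single_apply]

theorem sub_starProjection_apply (K : Submodule ℝ (EuclideanSpace ℝ (Fin n)))
    (v : EuclideanSpace ℝ (Fin n)) (i : Fin n) :
    (v - K.starProjection v) i = ∑ k, residualEntry K i k * v k := by
  conv_lhs => rw [euclidean_eq_sum_single v]
  rw [map_sum, ← Finset.sum_sub_distrib]
  simp only [map_smul, ← smul_sub, WithLp.ofLp_sum, Finset.sum_apply, PiLp.smul_apply, smul_eq_mul]
  exact Finset.sum_congr rfl fun k _ => mul_comm _ _

theorem residualEntry_eq_inner (K : Submodule ℝ (EuclideanSpace ℝ (Fin n))) (i k : Fin n) :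
    residualEntry K i k = inner ℝ (EuclideanSpace.single i (1 : ℝ))
      (Kᗮ.starProjection (EuclideanSpace.single k 1)) := by
  rw [EuclideanSpace.inner_single_left, Submodule.starProjection_orthogonal]
  simp [residualEntry]

theorem residualEntry_comm (K : Submodule ℝ (EuclideanSpace ℝ (Fin n))) (i k : Fin n) :
    residualEntry K i k = residualEntry K k i := by
  rw [residualEntry_eq_inner, residualEntry_eq_inner, real_inner_comm,
    Submodule.inner_starProjection_left_eq_right]

/-- The projection onto `Kᗮ` is symmetric and idempotent. -/
theorem sum_residualEntry_mul (K : Submodule ℝ (EuclideanSpace ℝ (Fin n))) (k l : Fin n) :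
    ∑ i, residualEntry K i k * residualEntry K i l = residualEntry K k l := by
  have h : ∀ i k, residualEntry K i k = (Kᗮ.starProjection (EuclideanSpace.single k (1 : ℝ))) i := by
    intro i k
    rw [residualEntry_eq_inner, EuclideanSpace.inner_single_left]; simp
  have h2 : ∑ i, residualEntry K i k * residualEntry K i l
      = inner ℝ (Kᗮ.starProjection (EuclideanSpace.single k (1 : ℝ)))
        (Kᗮ.starProjection (EuclideanSpace.single l (1 : ℝ))) := by
    simp [PiLp.inner_apply, h, mul_comm]
  rw [h2, Submodule.inner_starProjection_left_eq_right, residualEntry_eq_inner]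
  congr 1
  exact congrArg (fun T : EuclideanSpace ℝ (Fin n) →L[ℝ] EuclideanSpace ℝ (Fin n) =>
    T (EuclideanSpace.single l 1)) Kᗮ.isIdempotentElem_starProjection

theorem sum_sq_residualEntry (K : Submodule ℝ (EuclideanSpace ℝ (Fin n))) (i : Fin n) :
    ∑ k, residualEntry K i k ^ 2 = residualEntry K i i := by
  rw [← sum_residualEntry_mul K i i]
  exact Finset.sum_congr rfl fun k _ => by rw [residualEntry_comm K i k, sq]

/-- A diagonal entry is the sum of squares of its row, hence at least its own square. -/
theorem residualEntry_self_le_one (K : Submodule ℝ (EuclideanSpace ℝ (Fin n))) (i : Fin n) :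
    residualEntry K i i ≤ 1 := by
  have h := Finset.single_le_sum (f := fun k => residualEntry K i k ^ 2)
    (fun k _ => sq_nonneg _) (Finset.mem_univ i)
  rw [sum_sq_residualEntry] at h
  nlinarith

theorem residualEntry_self_nonneg (K : Submodule ℝ (EuclideanSpace ℝ (Fin n))) (i : Fin n) :
    0 ≤ residualEntry K i i := by
  rw [← sum_sq_residualEntry]
  exact Finset.sum_nonneg fun _ _ => sq_nonneg _

theorem abs_residualEntry_le_one (K : Submodule ℝ (EuclideanSpace ℝ (Fin n))) (i k : Fin n) :
    |residualEntry K i k| ≤ 1 := by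
  have h := Finset.single_le_sum (f := fun k => residualEntry K i k ^ 2)
    (fun k _ => sq_nonneg _) (Finset.mem_univ k)
  rw [sum_sq_residualEntry] at h
  exact abs_le_one_iff_mul_self_le_one.2 (by
    have := residualEntry_self_le_one K i
    nlinarith)

/-- The trace of the projection onto the span is the number of nonzero Gram–Schmidt vectors, at most
`p`. Only this inequality is needed, so collinear controls do no harm. -/
theorem sum_residualEntry_self_ge (f : Fin p → EuclideanSpace ℝ (Fin n)) :
    (n : ℝ) - p ≤ ∑ i, residualEntry (Submodule.span ℝ (Set.range f)) i i := by
  have h : ∀ i, residualEntry (Submodule.span ℝ (Set.range f)) i i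
      = 1 - ∑ j, (gramSchmidt ℝ f j i) ^ 2 / ‖gramSchmidt ℝ f j‖ ^ 2 := by
    intro i
    rw [residualEntry, starProjection_span_range_eq_sum]
    simp only [PiLp.sub_apply, WithLp.ofLp_sum, Finset.sum_apply, PiLp.smul_apply, smul_eq_mul,
      EuclideanSpace.inner_single_right]
    simp only [PiLp.single_apply, if_true]
    congr 1
    refine Finset.sum_congr rfl fun j _ => ?_
    simp
    ring
  simp_rw [h]
  rw [Finset.sum_sub_distrib, Finset.sum_comm]
  have h2 : ∀ j, ∑ i, (gramSchmidt ℝ f j i) ^ 2 / ‖gramSchmidt ℝ f j‖ ^ 2 ≤ 1 := fun j => by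
    rw [← Finset.sum_div, ← EuclideanSpace.real_norm_sq_eq]
    exact div_self_le_one _
  have h3 := Finset.sum_le_sum fun j (_ : j ∈ Finset.univ) => h2 j
  simp only [Finset.sum_const, Finset.card_univ, Fintype.card_fin, nsmul_eq_mul, mul_one] at h3 ⊢
  linarith

theorem sum_sub_starProjection_mul (K : Submodule ℝ (EuclideanSpace ℝ (Fin n)))
    (u v : EuclideanSpace ℝ (Fin n)) :
    ∑ i, (u - K.starProjection u) i * v i = ∑ i, (u - K.starProjection u) i
      * (v - K.starProjection v) i := by
  have h : inner ℝ (u - K.starProjection u) (K.starProjection v) = (0 : ℝ) :=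
    Submodule.starProjection_inner_eq_zero _ _ (Submodule.starProjection_apply_mem _ _)
  have h2 : ∑ i, (u - K.starProjection u) i * (K.starProjection v) i = 0 := by
    rw [PiLp.inner_apply] at h
    rw [← h]
    exact Finset.sum_congr rfl fun i _ => by simp [mul_comm]
  rw [← sub_eq_zero, ← Finset.sum_sub_distrib, ← h2]
  refine Finset.sum_congr rfl fun i _ => ?_
  simp only [PiLp.sub_apply]
  ring

end Projection

/-! ### Size and spread of the residualized treatment. -/

section FourthMoment

variable {Ω : Type*} {m₀ : MeasurableSpace Ω} {μ : Measure Ω}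

theorem memLp_two_mul_of_memLp_four {f g : Ω → ℝ} (hf : MemLp f 4 μ) (hg : MemLp g 4 μ) :
    MemLp (fun ω => f ω * g ω) 2 μ := by
  have h : ENNReal.HolderTriple 4 4 2 := ⟨by
    rw [← two_mul, show (4 : ℝ≥0∞) = 2 * 2 by norm_num,
      ENNReal.mul_inv (by norm_num) (by norm_num), ← mul_assoc,
      ENNReal.mul_inv_cancel (by norm_num) (by norm_num), one_mul]⟩
  exact hg.mul' hf

theorem memLp_four_iff {f : Ω → ℝ} (hf : AEStronglyMeasurable f μ) :
    MemLp f 4 μ ↔ Integrable (fun ω => |f ω| ^ 4) μ := by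
  rw [← integrable_norm_rpow_iff hf (by norm_num) (by norm_num)]
  have : ∀ ω, ‖f ω‖ ^ (4 : ℝ≥0∞).toReal = |f ω| ^ 4 := fun ω => by
    rw [Real.norm_eq_abs, show (4 : ℝ≥0∞).toReal = ((4 : ℕ) : ℝ) by norm_num, Real.rpow_natCast]
  simp_rw [this]

end FourthMoment

/-- Conditionally centred and independent errors `X j` with bounded conditional fourth moments and
conditional variances at least `τ`, with a symmetric idempotent matrix `m` known given `G`. -/
structure DesignErrors {Ω ι : Type*} [Fintype ι] (G : MeasurableSpace Ω)
    (base loc rest : ι → MeasurableSpace Ω) {m₀ : MeasurableSpace Ω} (μ : Measure Ω)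
    (X : ι → Ω → ℝ) (m : ι → ι → Ω → ℝ) (K τ : ℝ) : Prop where
  sys : CondIndepSystem G base loc rest μ
  K_nonneg : 0 ≤ K
  tau_pos : 0 < τ
  measurable_X : ∀ j, StronglyMeasurable[loc j] (X j)
  integrable_X : ∀ j, Integrable (fun ω => |X j ω| ^ 4) μ
  condExp_X : ∀ j, μ[X j | base j] =ᵐ[μ] 0
  moment : ∀ j, ∀ᵐ ω ∂μ, (μ[fun ω => |X j ω| ^ 4 | G]) ω ≤ K
  variance_ge : ∀ j, ∀ᵐ ω ∂μ, τ ≤ (μ[fun ω => X j ω ^ 2 | G]) ω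
  measurable_m : ∀ i j, StronglyMeasurable[G] (m i j)
  comm : ∀ i j ω, m i j ω = m j i ω
  sum_mul : ∀ i j ω, ∑ l, m l i ω * m l j ω = m i j ω
  abs_m_le : ∀ i j ω, |m i j ω| ≤ 1
  diag_nonneg : ∀ i ω, 0 ≤ m i i ω

namespace DesignErrors

variable {Ω ι : Type*} [Fintype ι] {G : MeasurableSpace Ω} {base loc rest : ι → MeasurableSpace Ω}
  {m₀ : MeasurableSpace Ω} {μ : Measure Ω} {X : ι → Ω → ℝ} {m : ι → ι → Ω → ℝ} {K τ : ℝ}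

theorem sum_sq_le_one (h : DesignErrors G base loc rest μ X m K τ) (i : ι) (ω : Ω) :
    ∑ k, m i k ω ^ 2 ≤ 1 := by
  have e : ∑ k, m i k ω ^ 2 = m i i ω := by
    rw [← h.sum_mul i i ω]
    exact Finset.sum_congr rfl fun k _ => by rw [h.comm i k, sq]
  rw [e]
  exact (le_abs_self _).trans (h.abs_m_le i i ω)

theorem memLp_four (h : DesignErrors G base loc rest μ X m K τ) (j : ι) : MemLp (X j) 4 μ :=
  (memLp_four_iff ((h.measurable_X j).mono (h.sys.loc_le j)).aestronglyMeasurable).2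
    (h.integrable_X j)

theorem memLp_residual (h : DesignErrors G base loc rest μ X m K τ) (i : ι) :
    MemLp (fun ω => ∑ k, m i k ω * X k ω) 4 μ :=
  memLp_finsetSum _ fun k _ => memLp_mul_of_bound (h.memLp_four k)
    ((h.measurable_m i k).mono h.sys.le).aestronglyMeasurable (h.abs_m_le i k)

/-- Idempotence turns the sum of squares into the quadratic form of `m`; symmetry folds the
off-diagonal part onto indices below `j`. Ordering the indices makes the inner sum known given `rest
j`. -/
theorem sum_residual_sq_eq [LinearOrder ι] (h : DesignErrors G base loc rest μ X m K τ) (ω : Ω) :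
    ∑ i, (∑ k, m i k ω * X k ω) ^ 2 = ∑ i, m i i ω * X i ω ^ 2
      + 2 * ∑ j, X j ω * ∑ i ∈ Finset.univ.filter (· < j), m j i ω * X i ω := by
  have e1 : ∑ i, (∑ k, m i k ω * X k ω) ^ 2 = ∑ j, ∑ k, m j k ω * X j ω * X k ω := by
    simp_rw [sq, Finset.sum_mul_sum]
    rw [Finset.sum_comm]
    refine Finset.sum_congr rfl fun j _ => ?_
    rw [Finset.sum_comm]
    refine Finset.sum_congr rfl fun k _ => ?_
    rw [← h.sum_mul j k ω, Finset.sum_mul, Finset.sum_mul]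
    exact Finset.sum_congr rfl fun i _ => by ring
  have e2 : ∀ j, ∑ k, m j k ω * X j ω * X k ω = m j j ω * X j ω ^ 2
      + (X j ω * ∑ i ∈ Finset.univ.filter (· < j), m j i ω * X i ω
        + ∑ i ∈ Finset.univ.filter (j < ·), m j i ω * X j ω * X i ω) := fun j => by
    rw [← Finset.add_sum_erase _ _ (Finset.mem_univ j)]
    have hd : Finset.univ.erase j
        = Finset.univ.filter (· < j) ∪ Finset.univ.filter (j < ·) := by
      ext i
      simp [lt_or_lt_iff_ne]
    rw [hd, Finset.sum_union (Finset.disjoint_filter.2 fun i _ h1 h2 => lt_asymm h1 h2),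
      Finset.mul_sum]
    congr 1
    · ring
    · congr 1
      exact Finset.sum_congr rfl fun i _ => by ring
  have e3 : ∑ j, ∑ i ∈ Finset.univ.filter (j < ·), m j i ω * X j ω * X i ω
      = ∑ j, X j ω * ∑ i ∈ Finset.univ.filter (· < j), m j i ω * X i ω := by
    simp_rw [Finset.mul_sum, Finset.sum_filter]
    rw [Finset.sum_comm]
    refine Finset.sum_congr rfl fun j _ => Finset.sum_congr rfl fun i _ => ?_
    split_ifs
    · rw [h.comm i j]; ring
    · rfl
  rw [e1]
  simp_rw [e2]
  rw [Finset.sum_add_distrib, Finset.sum_add_distrib, e3]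
  ring

variable [IsProbabilityMeasure μ]

theorem memLp_two (h : DesignErrors G base loc rest μ X m K τ) (j : ι) : MemLp (X j) 2 μ :=
  (h.memLp_four j).mono_exponent (by norm_num)

theorem condExp_sq_le (h : DesignErrors G base loc rest μ X m K τ) (j : ι) :
    ∀ᵐ ω ∂μ, (μ[fun ω => X j ω ^ 2 | G]) ω ≤ 1 + K := by
  have hpt : ∀ ω, X j ω ^ 2 ≤ 1 + |X j ω| ^ 4 := fun ω => by
    rw [Even.pow_abs (by decide) (X j ω), show X j ω ^ 4 = (X j ω ^ 2) ^ 2 by ring]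
    nlinarith [sq_nonneg (X j ω ^ 2 - 1), sq_nonneg (X j ω)]
  have h1 : μ[fun ω => X j ω ^ 2 | G] ≤ᵐ[μ] μ[(fun _ => (1 : ℝ)) + fun ω => |X j ω| ^ 4 | G] :=
    condExp_mono (h.memLp_two j).integrable_sq ((integrable_const 1).add (h.integrable_X j))
      (ae_of_all _ hpt)
  have h2 := condExp_add (integrable_const (μ := μ) (1 : ℝ)) (h.integrable_X j) G
  have h3 : μ[fun _ : Ω => (1 : ℝ) | G] = fun _ => 1 := condExp_const h.sys.le 1
  filter_upwards [h1, h2, h.moment j] with ω e1 e2 e3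
  refine e1.trans ?_
  rw [e2, Pi.add_apply, h3]
  linarith

theorem condExp_rest_sq_le (h : DesignErrors G base loc rest μ X m K τ) (j : ι) :
    ∀ᵐ ω ∂μ, (μ[fun ω => X j ω ^ 2 | rest j]) ω ≤ 1 + K := by
  have hi := (h.memLp_two j).integrable_sq
  have hm : StronglyMeasurable[loc j] fun ω => X j ω ^ 2 := (h.measurable_X j).pow 2
  filter_upwards [h.sys.condExp_rest j _ hi hm, h.sys.condExp_eq hi hm, h.condExp_sq_le j]
    with ω e1 e2 e3
  rw [e1, ← e2]; exact e3

theorem integral_pow_four_le (h : DesignErrors G base loc rest μ X m K τ) (j : ι) :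
    ∫ ω, |X j ω| ^ 4 ∂μ ≤ K := by
  rw [← integral_condExp h.sys.le]
  calc _ ≤ ∫ _, K ∂μ := integral_mono_ae integrable_condExp (integrable_const _) (h.moment j)
    _ = K := by simp

section Weights

variable {c : ι → Ω → ℝ}

theorem integral_sum_sq_le (h : DesignErrors G base loc rest μ X m K τ) (s : Finset ι)
    (hc : ∀ j, StronglyMeasurable[G] (c j)) (hcb : ∀ j ω, |c j ω| ≤ 1) :
    ∫ ω, (∑ j ∈ s, c j ω * X j ω) ^ 2 ∂μ ≤ (1 + K) * ∑ j ∈ s, ∫ ω, c j ω ^ 2 ∂μ := by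
  rw [h.sys.integral_sum_sq s hc hcb h.measurable_X h.memLp_two h.condExp_X, Finset.mul_sum]
  refine Finset.sum_le_sum fun j _ => ?_
  have hcm : AEStronglyMeasurable (c j) μ := ((hc j).mono h.sys.le).aestronglyMeasurable
  have hb : ∀ ω, ‖c j ω ^ 2‖ ≤ 1 := fun ω => by
    rw [Real.norm_eq_abs, abs_pow]; exact pow_le_one₀ (abs_nonneg _) (hcb j ω)
  exact integral_mul_le_of_condExp_le h.sys.le ((hc j).pow 2) (fun ω => sq_nonneg _)
    (Integrable.of_bound (hcm.pow 2) 1 (ae_of_all _ hb)) (h.memLp_two j).integrable_sq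
    ((h.memLp_two j).integrable_sq.bdd_mul (hcm.pow 2) (ae_of_all _ hb)) (h.condExp_sq_le j)

/-- A Rosenthal-type bound, by adding one term at a time. With `S` the old sum and `y` the new term,
`(S + y) ^ 4 ≤ S ^ 4 + 4 S ^ 3 y + 8 S ^ 2 y ^ 2 + 3 y ^ 4`. The term linear in `y` integrates to
zero, and each of the last two powers integrates to at most `(1 + K) ^ 2 * E[c k ^ 2]`, whence `8 +
3 = 11`. -/
theorem integral_sum_pow_four_le (h : DesignErrors G base loc rest μ X m K τ) (s : Finset ι)
    (hc : ∀ j, StronglyMeasurable[G] (c j)) (hcb : ∀ j ω, |c j ω| ≤ 1)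
    (hc2 : ∀ ω, ∑ j ∈ s, c j ω ^ 2 ≤ 1) :
    ∫ ω, (∑ j ∈ s, c j ω * X j ω) ^ 4 ∂μ ≤ 11 * (1 + K) ^ 2 * ∑ j ∈ s, ∫ ω, c j ω ^ 2 ∂μ := by
  classical
  have hcm : ∀ j, AEStronglyMeasurable (c j) μ := fun j =>
    ((hc j).mono h.sys.le).aestronglyMeasurable
  have hb2 : ∀ j ω, |c j ω ^ 2| ≤ 1 := fun j ω => by
    rw [abs_pow]; exact pow_le_one₀ (abs_nonneg _) (hcb j ω)
  have hci : ∀ j, Integrable (fun ω => c j ω ^ 2) μ := fun j =>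
    Integrable.of_bound ((hcm j).pow 2) 1 (ae_of_all _ (hb2 j))
  have hy4 : ∀ j, MemLp (fun ω => c j ω * X j ω) 4 μ := fun j =>
    memLp_mul_of_bound (h.memLp_four j) (hcm j) (hcb j)
  have hC : 0 ≤ 1 + K := by linarith [h.K_nonneg]
  induction s using Finset.induction_on with
  | empty => simp
  | insert k s hk ih =>
    have hs2 : ∀ ω, ∑ j ∈ s, c j ω ^ 2 ≤ 1 := fun ω => by
      have := hc2 ω
      rw [Finset.sum_insert hk] at this
      linarith [sq_nonneg (c k ω)]
    have ih' := ih hs2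
    set S : Ω → ℝ := fun ω => ∑ j ∈ s, c j ω * X j ω with hS
    set y : Ω → ℝ := fun ω => c k ω * X k ω with hy
    have hS4 : MemLp S 4 μ := memLp_finsetSum _ fun j _ => hy4 j
    have hSS : MemLp (fun ω => S ω * S ω) 2 μ := memLp_two_mul_of_memLp_four hS4 hS4
    have hSy : MemLp (fun ω => S ω * y ω) 2 μ := memLp_two_mul_of_memLp_four hS4 (hy4 k)
    have hyy : MemLp (fun ω => y ω * y ω) 2 μ := memLp_two_mul_of_memLp_four (hy4 k) (hy4 k)
    have hSm : StronglyMeasurable[rest k] S := by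
      refine Finset.stronglyMeasurable_fun_sum _ fun j hj => ?_
      exact ((hc j).mono (h.sys.le_rest k)).mul ((h.measurable_X j).mono
        (h.sys.loc_le_rest k j (fun e => hk (e ▸ hj))))
    have i1 : Integrable (fun ω => S ω ^ 4) μ :=
      (hSS.integrable_mul hSS).congr (ae_of_all _ fun ω => by simp only [Pi.mul_apply]; ring)
    have i2 : Integrable (fun ω => S ω ^ 3 * c k ω * X k ω) μ :=
      (hSS.integrable_mul hSy).congr (ae_of_all _ fun ω => by
        simp only [Pi.mul_apply, hy]; ring)
    have i3 : Integrable (fun ω => S ω ^ 2 * c k ω ^ 2 * X k ω ^ 2) μ :=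
      (hSy.integrable_mul hSy).congr (ae_of_all _ fun ω => by
        simp only [Pi.mul_apply, hy]; ring)
    have i4 : Integrable (fun ω => c k ω ^ 4 * |X k ω| ^ 4) μ :=
      (hyy.integrable_mul hyy).congr (ae_of_all _ fun ω => by
        simp only [Pi.mul_apply, hy]
        rw [show |X k ω| ^ 4 = (|X k ω| ^ 2) ^ 2 by ring, sq_abs]; ring)
    have z2 : ∫ ω, S ω ^ 3 * c k ω * X k ω ∂μ = 0 :=
      integral_mul_eq_zero_of_condExp_eq_zero (h.sys.rest_le k)
        ((hSm.pow 3).mul ((hc k).mono (h.sys.le_rest k))) ((h.memLp_two k).integrable one_le_two)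
        i2 ((h.sys.condExp_rest k _ ((h.memLp_two k).integrable one_le_two)
          (h.measurable_X k)).trans (h.condExp_X k))
    have hSL2 : MemLp S 2 μ := hS4.mono_exponent (by norm_num)
    have i5 : Integrable (fun ω => S ω ^ 2 * c k ω ^ 2) μ :=
      hSL2.integrable_sq.mul_bdd ((hcm k).pow 2) (ae_of_all _ (hb2 k))
    have z3 : ∫ ω, S ω ^ 2 * c k ω ^ 2 * X k ω ^ 2 ∂μ ≤ (1 + K) ^ 2 * ∫ ω, c k ω ^ 2 ∂μ := by
      have a1 := integral_mul_le_of_condExp_le (h.sys.rest_le k)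
        (c := fun ω => S ω ^ 2 * c k ω ^ 2)
        ((hSm.pow 2).mul (((hc k).mono (h.sys.le_rest k)).pow 2)) (fun ω => by positivity) i5
        (h.memLp_two k).integrable_sq i3 (h.condExp_rest_sq_le k)
      -- The weight `c k` is absorbed into the old sum before the second-moment bound; then `∑ c j ^
      -- 2 ≤ 1` leaves exactly the factor `E[c k ^ 2]`.
      have a2 := h.integral_sum_sq_le s (c := fun j ω => c k ω * c j ω)
        (fun j => (hc k).mul (hc j)) (fun j ω => by
          rw [abs_mul]; exact mul_le_one₀ (hcb k ω) (abs_nonneg _) (hcb j ω))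
      have e2 : ∀ ω, (∑ j ∈ s, c k ω * c j ω * X j ω) ^ 2 = S ω ^ 2 * c k ω ^ 2 := fun ω => by
        rw [hS, ← mul_pow, mul_comm, Finset.mul_sum]
        simp only [mul_assoc]
      simp_rw [e2] at a2
      have i6 : ∀ j, Integrable (fun ω => (c k ω * c j ω) ^ 2) μ := fun j =>
        ((hci j).bdd_mul ((hcm k).pow 2) (ae_of_all _ (hb2 k))).congr
          (ae_of_all _ fun ω => by simp only [Pi.pow_apply]; ring)
      have a3 : ∑ j ∈ s, ∫ ω, (c k ω * c j ω) ^ 2 ∂μ ≤ ∫ ω, c k ω ^ 2 ∂μ := by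
        rw [← integral_finsetSum _ fun j _ => i6 j]
        refine integral_mono (integrable_finsetSum _ fun j _ => i6 j) (hci k) fun ω => ?_
        simp only [mul_pow]
        rw [← Finset.mul_sum]
        exact mul_le_of_le_one_right (sq_nonneg _) (hs2 ω)
      calc _ ≤ (1 + K) * ∫ ω, S ω ^ 2 * c k ω ^ 2 ∂μ := a1
        _ ≤ (1 + K) * ((1 + K) * ∫ ω, c k ω ^ 2 ∂μ) :=
          mul_le_mul_of_nonneg_left (a2.trans (mul_le_mul_of_nonneg_left a3 hC)) hC
        _ = _ := by ring
    have z4 : ∫ ω, c k ω ^ 4 * |X k ω| ^ 4 ∂μ ≤ (1 + K) ^ 2 * ∫ ω, c k ω ^ 2 ∂μ := by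
      have hb4 : ∀ ω, c k ω ^ 4 ≤ c k ω ^ 2 := fun ω => by
        have h1 := hb2 k ω
        rw [abs_of_nonneg (sq_nonneg _)] at h1
        nlinarith [sq_nonneg (c k ω)]
      have i7 : Integrable (fun ω => c k ω ^ 4) μ :=
        (hci k).mono' ((hcm k).pow 4) (ae_of_all _ fun ω => by
          rw [Real.norm_eq_abs, abs_of_nonneg (by positivity)]; exact hb4 ω)
      have a1 := integral_mul_le_of_condExp_le h.sys.le (c := fun ω => c k ω ^ 4)
        ((hc k).pow 4) (fun ω => by positivity) i7 (h.integrable_X k) i4 (h.moment k)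
      have a2 : ∫ ω, c k ω ^ 4 ∂μ ≤ ∫ ω, c k ω ^ 2 ∂μ := integral_mono i7 (hci k) hb4
      have a3 : 0 ≤ ∫ ω, c k ω ^ 2 ∂μ := integral_nonneg fun ω => sq_nonneg _
      have a4 : K ≤ (1 + K) ^ 2 := by nlinarith [h.K_nonneg]
      exact a1.trans ((mul_le_mul_of_nonneg_left a2 h.K_nonneg).trans
        (mul_le_mul_of_nonneg_right a4 a3))
    have hpt : ∀ ω, (∑ j ∈ insert k s, c j ω * X j ω) ^ 4
        ≤ ((S ω ^ 4 + 4 * (S ω ^ 3 * c k ω * X k ω)) + 8 * (S ω ^ 2 * c k ω ^ 2 * X k ω ^ 2))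
          + 3 * (c k ω ^ 4 * |X k ω| ^ 4) := fun ω => by
      rw [Finset.sum_insert hk]
      change (y ω + S ω) ^ 4 ≤ _
      have e1 : c k ω ^ 4 * |X k ω| ^ 4 = y ω ^ 4 := by
        rw [show |X k ω| ^ 4 = (|X k ω| ^ 2) ^ 2 by ring, sq_abs]; simp only [hy]; ring
      have e2 : S ω ^ 2 * c k ω ^ 2 * X k ω ^ 2 = S ω ^ 2 * y ω ^ 2 := by simp only [hy]; ring
      have e3 : S ω ^ 3 * c k ω * X k ω = S ω ^ 3 * y ω := by simp only [hy]; ring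
      rw [e1, e2, e3]
      -- The mixed term is bounded by `4 S y ^ 3 ≤ 2 S ^ 2 y ^ 2 + 2 y ^ 4`.
      nlinarith [sq_nonneg (S ω * y ω - y ω ^ 2)]
    calc ∫ ω, (∑ j ∈ insert k s, c j ω * X j ω) ^ 4 ∂μ
        ≤ ∫ ω, (((S ω ^ 4 + 4 * (S ω ^ 3 * c k ω * X k ω))
          + 8 * (S ω ^ 2 * c k ω ^ 2 * X k ω ^ 2)) + 3 * (c k ω ^ 4 * |X k ω| ^ 4)) ∂μ :=
          integral_mono_of_nonneg (ae_of_all _ fun ω => by positivity)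
            (((i1.add (i2.const_mul 4)).add (i3.const_mul 8)).add (i4.const_mul 3))
            (ae_of_all _ hpt)
      _ = ((∫ ω, S ω ^ 4 ∂μ + 4 * ∫ ω, S ω ^ 3 * c k ω * X k ω ∂μ)
          + 8 * ∫ ω, S ω ^ 2 * c k ω ^ 2 * X k ω ^ 2 ∂μ)
          + 3 * ∫ ω, c k ω ^ 4 * |X k ω| ^ 4 ∂μ := by
          have h1 := integral_add i1 (i2.const_mul 4)
          have h2 := integral_add (i1.add (i2.const_mul 4)) (i3.const_mul 8)
          have h3 := integral_add ((i1.add (i2.const_mul 4)).add (i3.const_mul 8))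
            (i4.const_mul 3)
          simp only [Pi.add_apply, integral_const_mul] at h1 h2 h3
          rw [h3, h2, h1]
      _ ≤ 11 * (1 + K) ^ 2 * ∑ j ∈ insert k s, ∫ ω, c j ω ^ 2 ∂μ := by
          rw [z2, Finset.sum_insert hk, mul_add]
          linarith

end Weights

theorem integral_residual_pow_four_le (h : DesignErrors G base loc rest μ X m K τ) (i : ι) :
    ∫ ω, (∑ k, m i k ω * X k ω) ^ 4 ∂μ ≤ 11 * (1 + K) ^ 2 := by
  refine (h.integral_sum_pow_four_le Finset.univ (h.measurable_m i) (h.abs_m_le i)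
    (h.sum_sq_le_one i)).trans (mul_le_of_le_one_right (by positivity) ?_)
  have hi : ∀ k, Integrable (fun ω => m i k ω ^ 2) μ := fun k =>
    Integrable.of_bound ((((h.measurable_m i k).mono h.sys.le).aestronglyMeasurable).pow 2) 1
      (ae_of_all _ fun ω => by
        rw [Real.norm_eq_abs, abs_pow]; exact pow_le_one₀ (abs_nonneg _) (h.abs_m_le i k ω))
  rw [← integral_finsetSum _ fun k _ => hi k]
  calc _ ≤ ∫ _, (1 : ℝ) ∂μ := integral_mono (integrable_finsetSum _ fun k _ => hi k)
        (integrable_const _) (h.sum_sq_le_one i)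
    _ = 1 := by simp

theorem integral_sum_residual_pow_four_le (h : DesignErrors G base loc rest μ X m K τ) :
    ∫ ω, ∑ i, (∑ k, m i k ω * X k ω) ^ 4 ∂μ ≤ 11 * (1 + K) ^ 2 * Fintype.card ι := by
  have hi : ∀ i, Integrable (fun ω => (∑ k, m i k ω * X k ω) ^ 4) μ := fun i =>
    (((memLp_two_mul_of_memLp_four (h.memLp_residual i) (h.memLp_residual i)).integrable_mul
      (memLp_two_mul_of_memLp_four (h.memLp_residual i) (h.memLp_residual i)))).congr
      (ae_of_all _ fun ω => by simp only [Pi.mul_apply]; ring)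
  rw [integral_finsetSum _ fun i _ => hi i]
  refine (Finset.sum_le_sum fun i _ => h.integral_residual_pow_four_le i).trans_eq ?_
  rw [Finset.sum_const, Finset.card_univ, nsmul_eq_mul, mul_comm]

theorem measureReal_sum_residual_pow_four_le (h : DesignErrors G base loc rest μ X m K τ) (x : ℝ) :
    x * μ.real {ω | x ≤ ∑ i, (∑ k, m i k ω * X k ω) ^ 4}
      ≤ 11 * (1 + K) ^ 2 * Fintype.card ι := by
  refine (mul_meas_ge_le_integral_of_nonneg (ae_of_all _ fun ω =>
    Finset.sum_nonneg fun i _ => by positivity) ?_ x).trans h.integral_sum_residual_pow_four_le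
  exact integrable_finsetSum _ fun i _ =>
    (((memLp_two_mul_of_memLp_four (h.memLp_residual i) (h.memLp_residual i)).integrable_mul
      (memLp_two_mul_of_memLp_four (h.memLp_residual i) (h.memLp_residual i)))).congr
      (ae_of_all _ fun ω => by simp only [Pi.mul_apply]; ring)

/-- The centred squares are orthogonal with second moment at most `K`, and the diagonal weights are
at most one. -/
theorem integral_abs_diag_le (h : DesignErrors G base loc rest μ X m K τ) :
    ∫ ω, |∑ i, m i i ω * (X i ω ^ 2 - (μ[fun ω => X i ω ^ 2 | base i]) ω)| ∂μ
      ≤ √(K * Fintype.card ι) := by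
  have hX2 : ∀ i, MemLp (fun ω => X i ω ^ 2) 2 μ := fun i => by
    simpa only [sq] using memLp_two_mul_of_memLp_four (h.memLp_four i) (h.memLp_four i)
  set ζ : ι → Ω → ℝ := fun i ω => X i ω ^ 2 - (μ[fun ω => X i ω ^ 2 | base i]) ω with hζ
  have hb0 : ∀ j, base j ≤ m₀ := fun j => (h.sys.base_le j).trans h.sys.le
  have hζm : ∀ j, StronglyMeasurable[loc j] (ζ j) := fun j =>
    ((h.measurable_X j).pow 2).sub (stronglyMeasurable_condExp.mono (h.sys.base_le_loc j))
  have hζL : ∀ j, MemLp (ζ j) 2 μ := fun j => (hX2 j).sub ((hX2 j).condExp one_le_two)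
  have hζ0 : ∀ j, μ[ζ j | base j] =ᵐ[μ] 0 := fun j => by
    have h1 := condExp_sub ((hX2 j).integrable one_le_two)
      (integrable_condExp (f := fun ω => X j ω ^ 2) (m := base j) (μ := μ)) (base j)
    have h2 : μ[μ[fun ω => X j ω ^ 2 | base j] | base j] = μ[fun ω => X j ω ^ 2 | base j] :=
      condExp_of_stronglyMeasurable (hb0 j) stronglyMeasurable_condExp integrable_condExp
    filter_upwards [h1] with ω e1
    change (μ[(fun ω => X j ω ^ 2) - μ[fun ω => X j ω ^ 2 | base j] | base j]) ω = 0
    rw [e1, Pi.sub_apply, h2, sub_self]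
  have hmm : ∀ i, AEStronglyMeasurable (m i i) μ := fun i =>
    ((h.measurable_m i i).mono h.sys.le).aestronglyMeasurable
  have hL : MemLp (fun ω => ∑ i, m i i ω * ζ i ω) 2 μ :=
    memLp_finsetSum _ fun i _ => memLp_mul_of_bound (hζL i) (hmm i) (h.abs_m_le i i)
  refine (integral_abs_le_sqrt hL).trans (Real.sqrt_le_sqrt ?_)
  rw [h.sys.integral_sum_sq Finset.univ (c := fun i => m i i) (fun i => h.measurable_m i i)
    (fun i => h.abs_m_le i i) hζm hζL hζ0]
  have hζK : ∀ i, ∫ ω, ζ i ω ^ 2 ∂μ ≤ K := fun i => by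
    calc ∫ ω, ζ i ω ^ 2 ∂μ = ∫ ω, (condVar (base i) (fun ω => X i ω ^ 2) μ) ω ∂μ :=
          (integral_condExp (hb0 i)).symm
      _ ≤ ∫ ω, (μ[(fun ω => X i ω ^ 2) ^ 2 | base i]) ω ∂μ :=
          integral_mono_ae integrable_condVar integrable_condExp
            (condVar_ae_le_condExp_sq (hb0 i) (hX2 i))
      _ = ∫ ω, ((fun ω => X i ω ^ 2) ^ 2 : Ω → ℝ) ω ∂μ := integral_condExp (hb0 i)
      _ = ∫ ω, |X i ω| ^ 4 ∂μ := integral_congr_ae (ae_of_all _ fun ω => by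
          simp only [Pi.pow_apply]; rw [Even.pow_abs (by decide) (X i ω)]; ring)
      _ ≤ K := h.integral_pow_four_le i
  calc ∑ i, ∫ ω, m i i ω ^ 2 * ζ i ω ^ 2 ∂μ ≤ ∑ _i : ι, K := by
        refine Finset.sum_le_sum fun i _ => le_trans (integral_mono_of_nonneg
          (ae_of_all _ fun ω => by positivity) (hζL i).integrable_sq (ae_of_all _ fun ω => ?_))
          (hζK i)
        refine mul_le_of_le_one_left (sq_nonneg _) ?_
        rw [← sq_abs]
        exact pow_le_one₀ (abs_nonneg _) (h.abs_m_le i i ω)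
    _ = K * Fintype.card ι := by rw [Finset.sum_const, Finset.card_univ, nsmul_eq_mul, mul_comm]

section OffDiagonal

variable [LinearOrder ι]

/-- The summands are martingale differences in the index order: for `j < k`, the `j`-th summand and
the inner sum at `k` involve only indices below `k`. Each has second moment at most `(1 + K) ^ 2`,
because rows of `m` have norm at most one. -/
theorem integral_abs_offDiag_le (h : DesignErrors G base loc rest μ X m K τ) :
    ∫ ω, |∑ j, X j ω * ∑ i ∈ Finset.univ.filter (· < j), m j i ω * X i ω| ∂μ
      ≤ √((1 + K) ^ 2 * Fintype.card ι) := by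
  set T : ι → Ω → ℝ := fun j ω => ∑ i ∈ Finset.univ.filter (· < j), m j i ω * X i ω with hT
  have hC : 0 ≤ 1 + K := by linarith [h.K_nonneg]
  have hT4 : ∀ j, MemLp (T j) 4 μ := fun j => memLp_finsetSum _ fun k _ =>
    memLp_mul_of_bound (h.memLp_four k)
      ((h.measurable_m j k).mono h.sys.le).aestronglyMeasurable (h.abs_m_le j k)
  have hTm : ∀ j k, j ≤ k → StronglyMeasurable[rest k] (T j) := fun j k hjk => by
    refine Finset.stronglyMeasurable_fun_sum _ fun i hi => ?_
    have hij := (Finset.mem_filter.1 hi).2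
    exact ((h.measurable_m j i).mono (h.sys.le_rest k)).mul ((h.measurable_X i).mono
      (h.sys.loc_le_rest k i (hij.trans_le hjk).ne))
  have hXT : ∀ j, MemLp (fun ω => X j ω * T j ω) 2 μ := fun j =>
    memLp_two_mul_of_memLp_four (h.memLp_four j) (hT4 j)
  have hL : MemLp (fun ω => ∑ j, X j ω * T j ω) 2 μ := memLp_finsetSum _ fun j _ => hXT j
  refine (integral_abs_le_sqrt hL).trans (Real.sqrt_le_sqrt ?_)
  have horth : ∀ j k, j < k → ∫ ω, X j ω * T j ω * (X k ω * T k ω) ∂μ = 0 := fun j k hjk => by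
    have e : ∀ ω, X j ω * T j ω * (X k ω * T k ω) = X j ω * T j ω * T k ω * X k ω :=
      fun ω => by ring
    have hi := ((hXT j).integrable_mul (hXT k)).congr (ae_of_all _ e)
    simp_rw [e]
    have hXi := (h.memLp_two k).integrable one_le_two
    exact integral_mul_eq_zero_of_condExp_eq_zero (h.sys.rest_le k)
      ((((h.measurable_X j).mono (h.sys.loc_le_rest k j hjk.ne)).mul (hTm j k hjk.le)).mul
        (hTm k k le_rfl)) hXi hi
      ((h.sys.condExp_rest k _ hXi (h.measurable_X k)).trans (h.condExp_X k))
  rw [integral_sum_sq_of_orthogonal Finset.univ (x := fun j ω => X j ω * T j ω) fun j _ => hXT j]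
  · have hj : ∀ j, ∫ ω, (X j ω * T j ω) ^ 2 ∂μ ≤ (1 + K) ^ 2 := fun j => by
      have e : ∀ ω, (X j ω * T j ω) ^ 2 = T j ω ^ 2 * X j ω ^ 2 := fun ω => by ring
      have i1 : Integrable (fun ω => T j ω ^ 2 * X j ω ^ 2) μ :=
        (hXT j).integrable_sq.congr (ae_of_all _ e)
      have hT2 : MemLp (T j) 2 μ := (hT4 j).mono_exponent (by norm_num)
      simp_rw [e]
      have a1 := integral_mul_le_of_condExp_le (h.sys.rest_le j)
        (c := fun ω => T j ω ^ 2) ((hTm j j le_rfl).pow 2) (fun ω => sq_nonneg _) hT2.integrable_sq (h.memLp_two j).integrable_sq i1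
        (h.condExp_rest_sq_le j)
      have a2 := h.integral_sum_sq_le (Finset.univ.filter (· < j)) (c := fun i => m j i)
        (fun i => h.measurable_m j i) (fun i => h.abs_m_le j i)
      have hi : ∀ k, Integrable (fun ω => m j k ω ^ 2) μ := fun k =>
        Integrable.of_bound ((((h.measurable_m j k).mono h.sys.le).aestronglyMeasurable).pow 2) 1
          (ae_of_all _ fun ω => by
            rw [Real.norm_eq_abs, abs_pow]; exact pow_le_one₀ (abs_nonneg _) (h.abs_m_le j k ω))
      have a3 : ∑ i ∈ Finset.univ.filter (· < j), ∫ ω, m j i ω ^ 2 ∂μ ≤ 1 := by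
        rw [← integral_finsetSum _ fun k _ => hi k]
        calc _ ≤ ∫ _, (1 : ℝ) ∂μ := by
              refine integral_mono (integrable_finsetSum _ fun k _ => hi k)
                (integrable_const _) fun ω => ?_
              exact (Finset.sum_le_sum_of_subset_of_nonneg (Finset.filter_subset _ _)
                fun _ _ _ => sq_nonneg _).trans (h.sum_sq_le_one j ω)
          _ = 1 := by simp
      calc _ ≤ (1 + K) * ∫ ω, T j ω ^ 2 ∂μ := a1
        _ ≤ (1 + K) * ((1 + K) * 1) :=
          mul_le_mul_of_nonneg_left (a2.trans (mul_le_mul_of_nonneg_left a3 hC)) hC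
        _ = (1 + K) ^ 2 := by ring
    refine (Finset.sum_le_sum fun j _ => hj j).trans_eq ?_
    rw [Finset.sum_const, Finset.card_univ, nsmul_eq_mul, mul_comm]
  · intro j _ k _ hjk
    rcases lt_or_gt_of_ne hjk with hlt | hlt
    · exact horth j k hlt
    · rw [← horth k j hlt]
      exact integral_congr_ae (ae_of_all _ fun ω => mul_comm _ _)

/-- The conditional mean of the quadratic form is at least `τ * r`. Falling to half of that forces
the diagonal or off-diagonal fluctuation to be large, and Markov's inequality applies. -/
theorem measureReal_sum_residual_sq_le (h : DesignErrors G base loc rest μ X m K τ) {r : ℝ}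
    (hr : ∀ ω, r ≤ ∑ i, m i i ω) :
    τ * r / 2 * μ.real {ω | ∑ i, (∑ k, m i k ω * X k ω) ^ 2 ≤ τ * r / 2}
      ≤ √(K * Fintype.card ι) + 2 * √((1 + K) ^ 2 * Fintype.card ι) := by
  set Z1 : Ω → ℝ := fun ω => ∑ i, m i i ω * (X i ω ^ 2 - (μ[fun ω => X i ω ^ 2 | base i]) ω)
    with hZ1
  set Z2 : Ω → ℝ := fun ω => ∑ j, X j ω * ∑ i ∈ Finset.univ.filter (· < j), m j i ω * X i ω
    with hZ2
  have hmm : ∀ i k, AEStronglyMeasurable (m i k) μ := fun i k =>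
    ((h.measurable_m i k).mono h.sys.le).aestronglyMeasurable
  have hZ1i : Integrable Z1 μ := integrable_finsetSum _ fun i _ =>
    ((h.memLp_two i).integrable_sq.sub integrable_condExp).bdd_mul (hmm i i)
      (ae_of_all _ (h.abs_m_le i i))
  have hZ2i : Integrable Z2 μ := integrable_finsetSum _ fun j _ =>
    (h.memLp_two j).integrable_mul (memLp_finsetSum _ fun i _ =>
      memLp_mul_of_bound (h.memLp_two i) (hmm j i) (h.abs_m_le j i))
  have hY : Integrable (fun ω => |Z1 ω| + 2 * |Z2 ω|) μ := hZ1i.abs.add (hZ2i.abs.const_mul 2)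
  have hsub : μ.real {ω | ∑ i, (∑ k, m i k ω * X k ω) ^ 2 ≤ τ * r / 2}
      ≤ μ.real {ω | τ * r / 2 ≤ |Z1 ω| + 2 * |Z2 ω|} := by
    have hvar : ∀ᵐ ω ∂μ, ∀ i, τ ≤ (μ[fun ω => X i ω ^ 2 | base i]) ω := by
      refine ae_all_iff.2 fun i => ?_
      filter_upwards [h.variance_ge i, h.sys.condExp_eq (h.memLp_two i).integrable_sq
        ((h.measurable_X i).pow 2)] with ω e1 e2
      rwa [← e2]
    refine ENNReal.toReal_mono (measure_ne_top _ _) (measure_mono_ae ?_)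
    filter_upwards [hvar] with ω hω hmem
    change τ * r / 2 ≤ |Z1 ω| + 2 * |Z2 ω|
    have hmem' : ∑ i, (∑ k, m i k ω * X k ω) ^ 2 ≤ τ * r / 2 := hmem
    rw [h.sum_residual_sq_eq ω] at hmem'
    have e1 : ∑ i, m i i ω * X i ω ^ 2
        = Z1 ω + ∑ i, m i i ω * (μ[fun ω => X i ω ^ 2 | base i]) ω := by
      simp only [hZ1]
      rw [← Finset.sum_add_distrib]
      exact Finset.sum_congr rfl fun i _ => by ring
    have e2 : τ * r ≤ ∑ i, m i i ω * (μ[fun ω => X i ω ^ 2 | base i]) ω := by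
      calc τ * r ≤ τ * ∑ i, m i i ω := mul_le_mul_of_nonneg_left (hr ω) h.tau_pos.le
        _ = ∑ i, m i i ω * τ := by rw [mul_comm, Finset.sum_mul]
        _ ≤ _ := Finset.sum_le_sum fun i _ =>
            mul_le_mul_of_nonneg_left (hω i) (h.diag_nonneg i ω)
    rw [e1] at hmem'
    have h1 := neg_abs_le (Z1 ω)
    have h2 := neg_abs_le (Z2 ω)
    change Z1 ω + _ + 2 * Z2 ω ≤ _ at hmem'
    linarith
  -- For nonpositive `r` the left side is nonpositive; Markov's inequality is needed only for a
  -- positive threshold.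
  rcases le_or_gt (τ * r / 2) 0 with h0 | h0
  · exact (mul_nonpos_of_nonpos_of_nonneg h0 measureReal_nonneg).trans (by positivity)
  refine (mul_le_mul_of_nonneg_left hsub h0.le).trans ?_
  refine (mul_meas_ge_le_integral_of_nonneg (ae_of_all _ fun ω => by positivity) hY _).trans ?_
  rw [integral_add hZ1i.abs (hZ2i.abs.const_mul 2), integral_const_mul]
  exact add_le_add h.integral_abs_diag_le
    (mul_le_mul_of_nonneg_left h.integral_abs_offDiag_le zero_le_two)

end OffDiagonal

end DesignErrors

/-! ### The regression model: algebra, measurability and verification of the abstract conditions. -/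

namespace PartiallyLinearModel

open CondIndepGiven

section Algebra

variable {Ω : Type*} [MeasurableSpace Ω] {n p : ℕ} (M : PartiallyLinearModel Ω n p)

/-- The pair of errors of observation `i`. -/
def errors (i : Fin n) (ω : Ω) : ℝ × ℝ := (M.U i ω, M.Dtilde i ω)

theorem mem_controlSpace (g : Fin p → ℝ) (ω : Ω) :
    WithLp.toLp 2 (fun i => ∑ j, M.W ω i j * g j) ∈ M.controlSpace ω := by
  have e : WithLp.toLp 2 (fun i => ∑ j, M.W ω i j * g j)
      = ∑ j, g j • (WithLp.toLp 2 fun i : Fin n => M.W ω i j) := by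
    ext i
    simp [Finset.sum_apply, mul_comm]
  rw [e]
  exact Submodule.sum_mem _ fun j _ => Submodule.smul_mem _ _ (Submodule.subset_span ⟨j, rfl⟩)

/-- The part `W δ` of the treatment lies in the column space and is annihilated, so only `Dtilde`
remains. -/
theorem Dddot_apply (ω : Ω) (i : Fin n) :
    M.Dddot ω i = ∑ k, residualEntry (M.controlSpace ω) i k * M.Dtilde k ω := by
  rw [← sub_starProjection_apply (M.controlSpace ω) (WithLp.toLp 2 fun k => M.Dtilde k ω) i]
  have e : (WithLp.toLp 2 (M.D ω) : EuclideanSpace ℝ (Fin n))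
      = (WithLp.toLp 2 fun k => M.Dtilde k ω)
        + WithLp.toLp 2 (fun i => ∑ j, M.W ω i j * M.δ j) := by
    ext k
    simp [Dtilde]
  rw [Dddot, e, map_add, Submodule.starProjection_eq_self_iff.2 (M.mem_controlSpace M.δ ω),
    add_sub_add_right_eq_sub]

theorem sum_Dddot_mul_control (g : Fin p → ℝ) (ω : Ω) :
    ∑ i, M.Dddot ω i * ∑ j, M.W ω i j * g j = 0 := by
  have h := sum_sub_starProjection_mul (M.controlSpace ω) (WithLp.toLp 2 (M.D ω))
    (WithLp.toLp 2 fun i => ∑ j, M.W ω i j * g j)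
  rw [Submodule.starProjection_eq_self_iff.2 (M.mem_controlSpace g ω), sub_self] at h
  simpa [Dddot] using h

theorem sum_Dddot_mul_D (ω : Ω) : ∑ i, M.Dddot ω i * M.D ω i = ∑ i, M.Dddot ω i ^ 2 := by
  have h := sum_sub_starProjection_mul (M.controlSpace ω) (WithLp.toLp 2 (M.D ω))
    (WithLp.toLp 2 (M.D ω))
  simp_rw [sq]
  exact h

theorem sum_Dddot_mul_Y (ω : Ω) : ∑ i, M.Dddot ω i * M.Y ω i
    = M.β * ∑ i, M.Dddot ω i ^ 2 + ∑ i, M.Dddot ω i * M.U i ω := by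
  have e : ∀ i, M.Dddot ω i * M.Y ω i = M.β * (M.Dddot ω i * M.D ω i)
      + M.Dddot ω i * ∑ j, M.W ω i j * M.γ j + M.Dddot ω i * M.U i ω := fun i => by
    simp only [U]; ring
  simp_rw [e]
  rw [Finset.sum_add_distrib, Finset.sum_add_distrib, M.sum_Dddot_mul_control, ← Finset.mul_sum,
    M.sum_Dddot_mul_D, add_zero]

/-- Estimation error and standard error have the common denominator `∑ Dddot i ^ 2`, which cancels.
-/
theorem studentized_eq {ω : Ω} (hA : 0 < ∑ i, M.Dddot ω i ^ 2) :
    (M.betaOLS ω - M.β) / M.seOLS ω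
      = (∑ i, M.Dddot ω i * M.U i ω) / √(∑ i, M.Dddot ω i ^ 2 * M.U i ω ^ 2) := by
  rw [betaOLS, seOLS, seOLSSq, M.sum_Dddot_mul_Y, Real.sqrt_mul (by positivity),
    Real.sqrt_div zero_le_one, Real.sqrt_one, Real.sqrt_sq hA.le]
  set A := ∑ i, M.Dddot ω i ^ 2
  rw [add_div, mul_div_assoc, div_self hA.ne', mul_one, add_sub_cancel_left, one_div_mul_eq_div,
    div_div_div_cancel_right₀ hA.ne']

end Algebra

section Measurability

variable {Ω : Type*} {m : MeasurableSpace Ω} [mΩ : MeasurableSpace Ω] {n p : ℕ}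
  (M : PartiallyLinearModel Ω n p)

theorem measurable_W_apply (hW : Measurable[m] M.W) (i : Fin n)
    (j : Fin p) : Measurable[m] fun ω => M.W ω i j :=
  (measurable_pi_apply j).comp ((measurable_pi_apply i).comp hW)

theorem measurable_control (hW : Measurable[m] M.W) (i : Fin n)
    (g : Fin p → ℝ) : Measurable[m] fun ω => ∑ j, M.W ω i j * g j :=
  Finset.measurable_fun_sum _ fun j _ => (M.measurable_W_apply hW i j).mul_const _

theorem measurable_column (hW : Measurable[m] M.W) (j : Fin p) :
    Measurable[m] fun ω => (WithLp.toLp 2 fun i : Fin n => M.W ω i j) :=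
  (WithLp.measurable_toLp 2 _).comp (@measurable_pi_lambda _ _ _ m _ _ fun i => M.measurable_W_apply hW i j)

/-- The σ-algebra `m` is arbitrary, so that the result applies to the one generated by the controls
alone. -/
theorem measurable_residualEntry (hW : Measurable[m] M.W) (i k : Fin n) :
    Measurable[m] fun ω => residualEntry (M.controlSpace ω) i k := by
  have h := measurable_starProjection_span (fun j => M.measurable_column hW j)
    (measurable_const (a := EuclideanSpace.single k (1 : ℝ)))
  have h2 : Measurable fun v : EuclideanSpace ℝ (Fin n) =>
      (EuclideanSpace.single k (1 : ℝ) - v) i := by fun_prop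
  exact h2.comp h

theorem measurable_D_apply (hD : Measurable[m] M.D) (i : Fin n) :
    Measurable[m] fun ω => M.D ω i := (measurable_pi_apply i).comp hD

theorem measurable_Dtilde {i : Fin n}
    (hD : Measurable[m] fun ω => M.D ω i) (hW : Measurable[m] M.W) : Measurable[m] (M.Dtilde i) :=
  hD.sub (M.measurable_control hW i M.δ)

theorem measurable_D_of_Dtilde {i : Fin n}
    (hD : Measurable[m] (M.Dtilde i)) (hW : Measurable[m] M.W) :
    Measurable[m] fun ω => M.D ω i := by
  have e : (fun ω => M.D ω i) = fun ω => M.Dtilde i ω + ∑ j, M.W ω i j * M.δ j := by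
    funext ω; simp [Dtilde]
  rw [e]
  exact hD.add (M.measurable_control hW i M.δ)

theorem measurable_U (i : Fin n) : Measurable (M.U i) :=
  (((measurable_pi_apply i).comp M.measurable_Y).sub
    ((M.measurable_D_apply M.measurable_D i).mul_const _)).sub
    (M.measurable_control M.measurable_W i M.γ)

theorem measurable_Dddot (hD : Measurable[m] M.D)
    (hW : Measurable[m] M.W) (i : Fin n) : Measurable[m] fun ω => M.Dddot ω i := by
  simp_rw [Dddot_apply]
  exact Finset.measurable_fun_sum _ fun k _ => (M.measurable_residualEntry hW i k).mul
    (M.measurable_Dtilde (M.measurable_D_apply hD k) hW)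

theorem measurable_errors (i : Fin n) : Measurable (M.errors i) :=
  (M.measurable_U i).prodMk
    (M.measurable_Dtilde (M.measurable_D_apply M.measurable_D i) M.measurable_W)

theorem measurable_studentized :
    Measurable fun ω => (M.betaOLS ω - M.β) / M.seOLS ω := by
  have ha := M.measurable_Dddot M.measurable_D M.measurable_W
  have hY : ∀ i, Measurable fun ω => M.Y ω i := fun i =>
    (measurable_pi_apply i).comp M.measurable_Y
  have hA : Measurable fun ω => ∑ i, M.Dddot ω i ^ 2 :=
    Finset.measurable_fun_sum _ fun i _ => (ha i).pow_const 2
  have hb : Measurable M.betaOLS :=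
    (Finset.measurable_fun_sum _ fun i _ => (ha i).mul (hY i)).div hA
  have hs : Measurable M.seOLS :=
    ((measurable_const.div (hA.pow_const 2)).mul (Finset.measurable_fun_sum _ fun i _ =>
      ((ha i).pow_const 2).mul ((M.measurable_U i).pow_const 2))).sqrt
  exact (hb.sub_const _).div hs

theorem sigmaW_le : M.sigmaW ≤ mΩ := M.measurable_W.comap_le

theorem sigmaDW_le : M.sigmaDW ≤ mΩ := (M.measurable_D.prodMk M.measurable_W).comap_le

theorem measurable_W_sigmaW : Measurable[M.sigmaW] M.W := comap_measurable _

theorem measurable_W_sigmaDiW (i : Fin n) : Measurable[M.sigmaDiW i] M.W :=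
  measurable_snd.comp (comap_measurable fun ω => (M.D ω i, M.W ω))

theorem measurable_D_sigmaDiW (i : Fin n) : Measurable[M.sigmaDiW i] fun ω => M.D ω i :=
  measurable_fst.comp (comap_measurable fun ω => (M.D ω i, M.W ω))

theorem measurable_W_sigmaDW : Measurable[M.sigmaDW] M.W :=
  measurable_snd.comp (comap_measurable fun ω => (M.D ω, M.W ω))

theorem measurable_D_sigmaDW : Measurable[M.sigmaDW] M.D :=
  measurable_fst.comp (comap_measurable fun ω => (M.D ω, M.W ω))

theorem measurable_W_own (j : Fin n) : Measurable[own M.sigmaW M.errors j] M.W :=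
  M.measurable_W_sigmaW.mono le_sup_left le_rfl

theorem measurable_errors_own (j : Fin n) :
    Measurable[own M.sigmaW M.errors j] (M.errors j) :=
  (comap_measurable (M.errors j)).mono le_sup_right le_rfl

theorem measurable_U_own (j : Fin n) : Measurable[own M.sigmaW M.errors j] (M.U j) :=
  measurable_fst.comp (M.measurable_errors_own j)

theorem measurable_Dtilde_own (j : Fin n) : Measurable[own M.sigmaW M.errors j] (M.Dtilde j) :=
  measurable_snd.comp (M.measurable_errors_own j)

theorem sigmaDiW_le_own (j : Fin n) : M.sigmaDiW j ≤ own M.sigmaW M.errors j :=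
  ((M.measurable_D_of_Dtilde (M.measurable_Dtilde_own j) (M.measurable_W_own j)).prodMk
    (M.measurable_W_own j)).comap_le

theorem sigmaW_le_sigmaDiW (j : Fin n) : M.sigmaW ≤ M.sigmaDiW j :=
  (M.measurable_W_sigmaDiW j).comap_le

theorem sigmaDiW_le_sigmaDW (j : Fin n) : M.sigmaDiW j ≤ M.sigmaDW :=
  ((M.measurable_D_apply M.measurable_D_sigmaDW j).prodMk M.measurable_W_sigmaDW).comap_le

/-- Treatments other than `D j` are recovered from their errors and the controls. -/
theorem sigmaDW_le_others_sup (j : Fin n) :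
    M.sigmaDW ≤ others M.sigmaW M.errors j ⊔ M.sigmaDiW j := by
  have hW : Measurable[others M.sigmaW M.errors j ⊔ M.sigmaDiW j] M.W :=
    (M.measurable_W_sigmaDiW j).mono le_sup_right le_rfl
  have hD : Measurable[others M.sigmaW M.errors j ⊔ M.sigmaDiW j] M.D := by
    refine @measurable_pi_lambda _ _ _ (_ ⊔ _) _ _ fun k => ?_
    by_cases hk : k = j
    · subst hk
      exact (M.measurable_D_sigmaDiW k).mono le_sup_right le_rfl
    · exact M.measurable_D_of_Dtilde ((M.measurable_Dtilde_own k).mono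
        ((own_le_others hk).trans le_sup_left) le_rfl) hW
  exact (hD.prodMk hW).comap_le

end Measurability

section Systems

variable {Ω : Type*} [mΩ : MeasurableSpace Ω] {n p : ℕ} (M : PartiallyLinearModel Ω n p)
  {μ : Measure Ω} {K η : ℝ}

theorem condIndepSystem_design [IsProbabilityMeasure μ] (h : CondIndepGiven M.sigmaW M.errors μ) :
    CondIndepSystem M.sigmaW (fun _ => M.sigmaW) (own M.sigmaW M.errors)
      (others M.sigmaW M.errors) μ where
  base_le _ := le_rfl
  base_le_loc _ := le_sup_left
  le_rest _ := le_sup_left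
  loc_le_rest _ _ hk := own_le_others hk
  loc_le := own_le M.sigmaW_le M.measurable_errors
  rest_le := others_le M.sigmaW_le M.measurable_errors
  le := M.sigmaW_le
  condExp_rest j _ hφ hφm := condExp_others M.sigmaW_le M.measurable_errors h j hφ hφm

/-- Taking `base j` to be generated by `D j` and `W` matches the mean-zero assumption on `U j`,
although `G` contains all treatments. Weak union supplies the last field. -/
theorem condIndepSystem_outcome [IsProbabilityMeasure μ] (h : CondIndepGiven M.sigmaW M.errors μ) :
    CondIndepSystem M.sigmaDW M.sigmaDiW (own M.sigmaW M.errors)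
      (fun j => others M.sigmaW M.errors j ⊔ M.sigmaDiW j) μ where
  base_le := M.sigmaDiW_le_sigmaDW
  base_le_loc := M.sigmaDiW_le_own
  le_rest := M.sigmaDW_le_others_sup
  loc_le_rest _ _ hk := (own_le_others hk).trans le_sup_left
  loc_le := own_le M.sigmaW_le M.measurable_errors
  rest_le j := sup_le (others_le M.sigmaW_le M.measurable_errors j)
    ((M.sigmaDiW_le_sigmaDW j).trans M.sigmaDW_le)
  le := M.sigmaDW_le
  condExp_rest j _ hφ hφm := condExp_others_sup M.sigmaW_le M.measurable_errors h j
    (M.sigmaDiW_le_own j) (M.sigmaW_le_sigmaDiW j) hφ hφm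

variable {M}

theorem RegularErrors.condExp_rpow_U_le (hreg : M.RegularErrors μ K η) (j : Fin n) :
    ∀ᵐ ω ∂μ, (μ[fun ω => |M.U j ω| ^ (2 + η) | M.sigmaDW]) ω ≤ K := by
  have h0 : 0 ≤ᵐ[μ] μ[fun ω => |M.Dtilde j ω| ^ 4 | M.sigmaW] :=
    condExp_nonneg (ae_of_all _ fun ω => by positivity)
  filter_upwards [hreg.moments j, h0] with ω e1 e2
  simp only [Pi.zero_apply] at e2
  linarith

theorem RegularErrors.condExp_pow_Dtilde_le (hreg : M.RegularErrors μ K η) (j : Fin n) :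
    ∀ᵐ ω ∂μ, (μ[fun ω => |M.Dtilde j ω| ^ 4 | M.sigmaW]) ω ≤ K := by
  have h0 : 0 ≤ᵐ[μ] μ[fun ω => |M.U j ω| ^ (2 + η) | M.sigmaDW] :=
    condExp_nonneg (ae_of_all _ fun ω => by positivity)
  filter_upwards [hreg.moments j, h0] with ω e1 e2
  simp only [Pi.zero_apply] at e2
  linarith

theorem RegularErrors.variance_Dtilde_ge (hreg : M.RegularErrors μ K η) (hK : 0 < K)
    (j : Fin n) : ∀ᵐ ω ∂μ, K⁻¹ ≤ (μ[fun ω => M.Dtilde j ω ^ 2 | M.sigmaW]) ω := by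
  filter_upwards [hreg.variance_pos j, hreg.nondegenerate j] with ω e1 e2
  refine (inv_le_comm₀ e1.1 hK).1 ?_
  -- Positivity of the other variance lets its reciprocal be dropped from the bound.
  have := one_div_pos.2 e1.2
  rw [← one_div]
  linarith

theorem RegularErrors.variance_U_ge (hreg : M.RegularErrors μ K η) (hK : 0 < K)
    (j : Fin n) : ∀ᵐ ω ∂μ, K⁻¹ ≤ (μ[fun ω => M.U j ω ^ 2 | M.sigmaDW]) ω := by
  filter_upwards [hreg.variance_pos j, hreg.nondegenerate j] with ω e1 e2
  refine (inv_le_comm₀ e1.2 hK).1 ?_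
  have := one_div_pos.2 e1.1
  rw [← one_div]
  linarith

theorem designErrors [IsProbabilityMeasure μ] (hmean : M.MeanZeroErrors μ) (hreg : M.RegularErrors μ K η) (hK : 0 < K) :
    DesignErrors M.sigmaW (fun _ => M.sigmaW) (own M.sigmaW M.errors)
      (others M.sigmaW M.errors) μ M.Dtilde
      (fun i k ω => residualEntry (M.controlSpace ω) i k) K K⁻¹ where
  sys := M.condIndepSystem_design hreg.condIndep
  K_nonneg := hK.le
  tau_pos := inv_pos.2 hK
  measurable_X j := (M.measurable_Dtilde_own j).stronglyMeasurable
  integrable_X := hreg.integrable_Dtilde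
  condExp_X := hmean.condExp_Dtilde
  moment := hreg.condExp_pow_Dtilde_le
  variance_ge := hreg.variance_Dtilde_ge hK
  measurable_m i k := (M.measurable_residualEntry M.measurable_W_sigmaW i k).stronglyMeasurable
  comm i k _ := residualEntry_comm _ i k
  sum_mul i k _ := sum_residualEntry_mul _ i k
  abs_m_le i k _ := abs_residualEntry_le_one _ i k
  diag_nonneg i _ := residualEntry_self_nonneg _ i

variable (M μ)

/-- The conditional variance of `∑ i, Dddot i * U i` given the treatments and controls. -/
def scoreVariance (ω : Ω) : ℝ :=
  ∑ i, M.Dddot ω i ^ 2 * (μ[fun ω => M.U i ω ^ 2 | M.sigmaDW]) ω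

/-- The event that the residualized treatment is large but spread out over the observations. -/
def regularDesign (K r y : ℝ) : Set Ω :=
  {ω | r < ∑ i, M.Dddot ω i ^ 2 ∧ ∑ i, M.Dddot ω i ^ 4 < y
    ∧ ∀ i, K⁻¹ ≤ (μ[fun ω => M.U i ω ^ 2 | M.sigmaDW]) ω}

/-- The weights of the errors in the standardized score, put to zero off `regularDesign`. -/
def scoreWeight (K r y : ℝ) (i : Fin n) : Ω → ℝ :=
  (M.regularDesign μ K r y).indicator fun ω => M.Dddot ω i / √(M.scoreVariance μ ω)

theorem measurable_scoreVariance : Measurable[M.sigmaDW] (M.scoreVariance μ) :=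
  Finset.measurable_fun_sum _ fun i _ =>
    ((M.measurable_Dddot M.measurable_D_sigmaDW M.measurable_W_sigmaDW i).pow_const 2).mul
      stronglyMeasurable_condExp.measurable

theorem measurableSet_regularDesign (K r y : ℝ) :
    MeasurableSet[M.sigmaDW] (M.regularDesign μ K r y) := by
  have ha := M.measurable_Dddot M.measurable_D_sigmaDW M.measurable_W_sigmaDW
  have h1 : Measurable[M.sigmaDW] fun ω => ∑ i, M.Dddot ω i ^ 2 :=
    Finset.measurable_fun_sum _ fun i _ => (ha i).pow_const 2
  have h2 : Measurable[M.sigmaDW] fun ω => ∑ i, M.Dddot ω i ^ 4 :=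
    Finset.measurable_fun_sum _ fun i _ => (ha i).pow_const 4
  have h3 : MeasurableSet[M.sigmaDW]
      (⋂ i, {ω | K⁻¹ ≤ (μ[fun ω => M.U i ω ^ 2 | M.sigmaDW]) ω}) := by
    refine MeasurableSet.iInter fun i => ?_
    exact (stronglyMeasurable_condExp (m := M.sigmaDW)).measurable measurableSet_Ici
  have e : M.regularDesign μ K r y
      = ((fun ω => ∑ i, M.Dddot ω i ^ 2) ⁻¹' Set.Ioi r
        ∩ ((fun ω => ∑ i, M.Dddot ω i ^ 4) ⁻¹' Set.Iio y
        ∩ ⋂ i, {ω | K⁻¹ ≤ (μ[fun ω => M.U i ω ^ 2 | M.sigmaDW]) ω})) := by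
    ext ω
    simp [regularDesign]
  rw [e]
  exact (h1 measurableSet_Ioi).inter ((h2 measurableSet_Iio).inter h3)

variable {M μ}

theorem scoreVariance_ge {r y : ℝ} {ω : Ω} (hω : ω ∈ M.regularDesign μ K r y) :
    K⁻¹ * ∑ i, M.Dddot ω i ^ 2 ≤ M.scoreVariance μ ω := by
  rw [Finset.mul_sum]
  refine Finset.sum_le_sum fun i _ => ?_
  rw [mul_comm]
  exact mul_le_mul_of_nonneg_left (hω.2.2 i) (sq_nonneg _)

theorem scoreVariance_pos (hK : 0 < K) {r y : ℝ} (hr : 0 < r) {ω : Ω}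
    (hω : ω ∈ M.regularDesign μ K r y) : 0 < M.scoreVariance μ ω :=
  (mul_pos (inv_pos.2 hK) (hr.trans hω.1)).trans_le (scoreVariance_ge hω)

theorem sum_sq_scoreWeight_mul (hK : 0 < K) {r y : ℝ} (hr : 0 < r) {ω : Ω}
    (hω : ω ∈ M.regularDesign μ K r y) (z : Fin n → ℝ) :
    ∑ i, M.scoreWeight μ K r y i ω ^ 2 * z i
      = (∑ i, M.Dddot ω i ^ 2 * z i) / M.scoreVariance μ ω := by
  have hV := scoreVariance_pos hK hr hω
  rw [Finset.sum_div]
  refine Finset.sum_congr rfl fun i _ => ?_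
  rw [scoreWeight, Set.indicator_of_mem hω, div_pow, Real.sq_sqrt hV.le]
  ring

theorem sum_sq_scoreWeight_le (hK : 0 < K) {r y : ℝ} (hr : 0 < r) (ω : Ω) :
    ∑ i, M.scoreWeight μ K r y i ω ^ 2 ≤ K := by
  by_cases hω : ω ∈ M.regularDesign μ K r y
  · have h := sum_sq_scoreWeight_mul hK hr hω fun _ => 1
    simp only [mul_one] at h
    rw [h, div_le_iff₀ (scoreVariance_pos hK hr hω)]
    have := mul_le_mul_of_nonneg_left (scoreVariance_ge hω) hK.le
    rwa [mul_inv_cancel_left₀ hK.ne'] at this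
  · simp [scoreWeight, Set.indicator_of_notMem hω, hK.le]

/-- On `regularDesign` the score variance exceeds `r / K` while the fourth powers sum to less than
`y`; off it the weights vanish. -/
theorem sum_four_scoreWeight_le (hK : 0 < K) {r y : ℝ} (hr : 0 < r) (hy : 0 ≤ y) (ω : Ω) :
    ∑ i, M.scoreWeight μ K r y i ω ^ 4 ≤ K ^ 2 * y / r ^ 2 := by
  by_cases hω : ω ∈ M.regularDesign μ K r y
  · have hV := scoreVariance_pos hK hr hω
    have e : ∑ i, M.scoreWeight μ K r y i ω ^ 4
        = (∑ i, M.Dddot ω i ^ 4) / M.scoreVariance μ ω ^ 2 := by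
      rw [Finset.sum_div]
      refine Finset.sum_congr rfl fun i _ => ?_
      rw [scoreWeight, Set.indicator_of_mem hω, div_pow, show (4 : ℕ) = 2 * 2 by norm_num,
        pow_mul (√_), Real.sq_sqrt hV.le]
    have hr2 : K⁻¹ * r ≤ M.scoreVariance μ ω :=
      (mul_le_mul_of_nonneg_left hω.1.le (inv_pos.2 hK).le).trans (scoreVariance_ge hω)
    rw [e]
    calc _ ≤ y / (K⁻¹ * r) ^ 2 := div_le_div₀ hy hω.2.1.le (by positivity)
          (pow_le_pow_left₀ (by positivity) hr2 2)
      _ = K ^ 2 * y / r ^ 2 := by field_simp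
  · simp only [scoreWeight, Set.indicator_of_notMem hω]
    simp only [ne_eq, OfNat.ofNat_ne_zero, not_false_eq_true, zero_pow, Finset.sum_const_zero]
    positivity

theorem weightedErrors [IsProbabilityMeasure μ] (hmean : M.MeanZeroErrors μ) (hreg : M.RegularErrors μ K η) (hK : 0 < K)
    (hη : 0 < η) {r y : ℝ} (hr : 0 < r) (hy : 0 ≤ y) :
    WeightedErrors M.sigmaDW M.sigmaDiW (own M.sigmaW M.errors)
      (fun j => others M.sigmaW M.errors j ⊔ M.sigmaDiW j) μ M.U (M.scoreWeight μ K r y) K η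
      (K ^ 2 * y / r ^ 2) where
  sys := M.condIndepSystem_outcome hreg.condIndep
  eta_pos := hη
  K_nonneg := hK.le
  measurable_U j := (M.measurable_U_own j).stronglyMeasurable
  integrable_U := hreg.integrable_U
  condExp_U := hmean.condExp_U
  moment := hreg.condExp_rpow_U_le
  measurable_b j := (Measurable.indicator
    ((M.measurable_Dddot M.measurable_D_sigmaDW M.measurable_W_sigmaDW j).div
      (M.measurable_scoreVariance μ).sqrt) (M.measurableSet_regularDesign μ K r y)).stronglyMeasurable
  sum_sq_b := sum_sq_scoreWeight_le hK hr
  sum_four_b := sum_four_scoreWeight_le hK hr hy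

theorem sum_scoreWeight_mul_condVar_eq_one (hK : 0 < K) {r y : ℝ} (hr : 0 < r) {ω : Ω}
    (hω : ω ∈ M.regularDesign μ K r y) :
    ∑ i, M.scoreWeight μ K r y i ω ^ 2 * (μ[fun ω => M.U i ω ^ 2 | M.sigmaDW]) ω = 1 := by
  rw [sum_sq_scoreWeight_mul hK hr hω fun i => (μ[fun ω => M.U i ω ^ 2 | M.sigmaDW]) ω]
  exact div_self (scoreVariance_pos hK hr hω).ne'

theorem studentized_eq_scoreWeight (hK : 0 < K) {r y : ℝ} (hr : 0 < r) {ω : Ω}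
    (hω : ω ∈ M.regularDesign μ K r y) :
    (M.betaOLS ω - M.β) / M.seOLS ω = (∑ i, M.scoreWeight μ K r y i ω * M.U i ω)
      / √(∑ i, M.scoreWeight μ K r y i ω ^ 2 * M.U i ω ^ 2) := by
  have hV := scoreVariance_pos hK hr hω
  rw [M.studentized_eq (hr.trans hω.1), sum_sq_scoreWeight_mul hK hr hω fun i => M.U i ω ^ 2,
    Real.sqrt_div' _ hV.le]
  have e : ∑ i, M.scoreWeight μ K r y i ω * M.U i ω
      = (∑ i, M.Dddot ω i * M.U i ω) / √(M.scoreVariance μ ω) := by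
    rw [Finset.sum_div]
    refine Finset.sum_congr rfl fun i _ => ?_
    rw [scoreWeight, Set.indicator_of_mem hω]
    ring
  rw [e, div_div_div_cancel_right₀ (Real.sqrt_pos.2 hV).ne']

/-- The variance requirement in `regularDesign` holds almost surely, so only the two conditions on
the residuals can fail with positive probability. -/
theorem measureReal_compl_regularDesign_le [IsProbabilityMeasure μ] (hreg : M.RegularErrors μ K η) (hK : 0 < K) (r y : ℝ) :
    μ.real (M.regularDesign μ K r y)ᶜ ≤ μ.real {ω | ∑ i, M.Dddot ω i ^ 2 ≤ r}
      + μ.real {ω | y ≤ ∑ i, M.Dddot ω i ^ 4} := by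
  refine le_trans ?_ (measureReal_union_le _ _)
  refine ENNReal.toReal_mono (measure_ne_top _ _) (measure_mono_ae ?_)
  filter_upwards [ae_all_iff.2 (hreg.variance_U_ge hK)] with ω hω hmem
  by_contra hcon
  refine hmem ⟨?_, ?_, hω⟩
  · by_contra h1
    exact hcon (Or.inl (not_lt.1 h1))
  · by_contra h1
    exact hcon (Or.inr (not_lt.1 h1))

end Systems

end PartiallyLinearModel

namespace PartiallyLinearModel

variable {Ω : Type*} [MeasurableSpace Ω] {n p : ℕ} {M : PartiallyLinearModel Ω n p}
  {μ : Measure Ω} [IsProbabilityMeasure μ] {K η c : ℝ}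

theorem measureReal_sum_sq_Dddot_le (hmean : M.MeanZeroErrors μ) (hreg : M.RegularErrors μ K η)
    (hK : 0 < K) (hp : (p : ℝ) ≤ (1 - c) * n) :
    K⁻¹ * (c * n) / 2 * μ.real {ω | ∑ i, M.Dddot ω i ^ 2 ≤ K⁻¹ * (c * n) / 2}
      ≤ (√K + 2 * (1 + K)) * √n := by
  -- The trace of the residual projection is at least `n - p ≥ c * n`.
  have h := (designErrors hmean hreg hK).measureReal_sum_residual_sq_le (r := c * n) fun ω =>
    le_trans (by linarith) (sum_residualEntry_self_ge
      fun j : Fin p => (WithLp.toLp 2 fun i : Fin n => M.W ω i j))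
  rw [Fintype.card_fin, Real.sqrt_mul hK.le, Real.sqrt_mul (by positivity),
    Real.sqrt_sq (by positivity)] at h
  simp_rw [Dddot_apply]
  linarith

theorem measureReal_sum_four_Dddot_ge_le (hmean : M.MeanZeroErrors μ)
    (hreg : M.RegularErrors μ K η) (hK : 0 < K) (y : ℝ) :
    y * μ.real {ω | y ≤ ∑ i, M.Dddot ω i ^ 4} ≤ 11 * (1 + K) ^ 2 * n := by
  have h := (designErrors hmean hreg hK).measureReal_sum_residual_pow_four_le y
  rw [Fintype.card_fin] at h
  simpa only [Dddot_apply] using h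

/-- The threshold `n * √n` lies between the order `n` of `∑ Dddot i ^ 4` and the order `n ^ 2` of
`(∑ Dddot i ^ 2) ^ 2`, so this probability and the weight bound both decay like `1 / √n`. -/
theorem measureReal_compl_regularDesign_le_div_sqrt (hmean : M.MeanZeroErrors μ)
    (hreg : M.RegularErrors μ K η) (hK : 0 < K) (hc : 0 < c) (hn : 0 < n)
    (hp : (p : ℝ) ≤ (1 - c) * n) :
    μ.real (M.regularDesign μ K (c * (n + 1) / (4 * K)) (n * √n))ᶜ
      ≤ (2 * K * (√K + 2 * (1 + K)) / c + 11 * (1 + K) ^ 2) / √n := by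
  have hn1 : (1 : ℝ) ≤ n := by exact_mod_cast hn
  have hn0 : (0 : ℝ) < n := by linarith
  have hs : 0 < √(n : ℝ) := Real.sqrt_pos.2 hn0
  have hss : √(n : ℝ) * √n = n := Real.mul_self_sqrt hn0.le
  -- Since `n + 1 ≤ 2 * n` for `n ≥ 1`, this threshold is below the one given by the quadratic form
  -- bound.
  have hx : c * (n + 1) / (4 * K) ≤ K⁻¹ * (c * n) / 2 := by
    rw [div_le_iff₀ (by positivity)]
    have e : K⁻¹ * (c * n) / 2 * (4 * K) = c * (2 * n) := by field_simp; norm_num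
    rw [e]
    exact mul_le_mul_of_nonneg_left (by linarith) hc.le
  refine (measureReal_compl_regularDesign_le hreg hK _ _).trans ?_
  rw [add_div]
  refine add_le_add ?_ ?_
  · refine (measureReal_mono fun ω hω => le_trans hω hx).trans ?_
    have h := measureReal_sum_sq_Dddot_le hmean hreg hK hp
    rw [← le_div_iff₀' (by positivity)] at h
    refine h.trans_eq ?_
    rw [div_eq_div_iff (by positivity) hs.ne', mul_assoc, hss]
    field_simp
  · have h := measureReal_sum_four_Dddot_ge_le hmean hreg hK (n * √n)
    rw [← le_div_iff₀' (by positivity)] at h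
    refine h.trans_eq ?_
    field_simp

end PartiallyLinearModel

/-! ### Rates and conclusion. -/

theorem eventually_le_mul_of_limsup_lt_one {p : ℕ → ℕ}
    (hp : limsup (fun n => (p n : ℝ≥0∞) / (n : ℝ≥0∞)) atTop < 1) :
    ∃ c : ℝ, 0 < c ∧ ∀ᶠ n in atTop, (p n : ℝ) ≤ (1 - c) * n := by
  obtain ⟨q, hq, hq1⟩ := exists_between hp
  have hqt : q ≠ ∞ := (hq1.trans ENNReal.one_lt_top).ne
  refine ⟨1 - q.toReal, sub_pos.2 ?_, ?_⟩
  · simpa using (ENNReal.toReal_lt_toReal hqt ENNReal.one_ne_top).2 hq1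
  · filter_upwards [eventually_lt_of_limsup_lt hq, eventually_gt_atTop 0] with n h hn
    have h1 := ENNReal.toReal_mono hqt h.le
    rw [ENNReal.toReal_div, ENNReal.toReal_natCast, ENNReal.toReal_natCast,
      div_le_iff₀ (by exact_mod_cast hn)] at h1
    simpa using h1

theorem tendsto_div_sqrt_natCast (C : ℝ) :
    Tendsto (fun n : ℕ => C / √(n : ℝ)) atTop (nhds 0) :=
  tendsto_const_nhds.div_atTop (Real.tendsto_sqrt_atTop.comp tendsto_natCast_atTop_atTop)

theorem tendsto_mul_sqrt_div_sq {K c : ℝ} (hK : 0 < K) (hc : 0 < c) :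
    Tendsto (fun n : ℕ => K ^ 2 * (n * √(n : ℝ)) / (c * (n + 1) / (4 * K)) ^ 2) atTop
      (nhds 0) := by
  refine squeeze_zero' (Eventually.of_forall fun n => by positivity) ?_
    (tendsto_div_sqrt_natCast (16 * K ^ 4 / c ^ 2))
  filter_upwards [eventually_gt_atTop 0] with n hn
  have hn0 : (0 : ℝ) < n := by exact_mod_cast hn
  have hs : 0 < √(n : ℝ) := Real.sqrt_pos.2 hn0
  have hss : √(n : ℝ) * √n = n := Real.mul_self_sqrt hn0.le
  have e : K ^ 2 * (n * √(n : ℝ)) / (c * (n + 1) / (4 * K)) ^ 2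
      = 16 * K ^ 4 / c ^ 2 * (n * √n / (n + 1) ^ 2) := by
    field_simp
    norm_num
  rw [e, div_eq_mul_inv _ (√(n : ℝ))]
  refine mul_le_mul_of_nonneg_left ?_ (by positivity)
  rw [← one_div, div_le_div_iff₀ (by positivity) hs, mul_assoc, hss]
  nlinarith

end

theorem lemma3 {Ω : ℕ → Type*} [∀ n, MeasurableSpace (Ω n)]
    (μ : ∀ n, Measure (Ω n)) [∀ n, IsProbabilityMeasure (μ n)]
    (p : ℕ → ℕ) (M : ∀ n, PartiallyLinearModel (Ω n) n (p n))
    (hmean : ∀ n, (M n).MeanZeroErrors (μ n))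
    (K η : ℝ) (hK : 0 < K) (hη : 0 < η)
    (hreg : ∀ n, (M n).RegularErrors (μ n) K η)
    (hp : limsup (fun n => (p n : ℝ≥0∞) / (n : ℝ≥0∞)) atTop < 1) :
    TendstoInDistribution (fun n ω => ((M n).betaOLS ω - (M n).β) / (M n).seOLS ω)
      atTop (id : ℝ → ℝ) μ (gaussianReal 0 1) := by
  obtain ⟨c, hc, hpc⟩ := eventually_le_mul_of_limsup_lt_one hp
  -- Writing `n + 1` instead of `n` keeps the threshold positive at `n = 0`, so the abstract
  -- hypotheses hold for every `n`.
  set r : ℕ → ℝ := fun n => c * (n + 1) / (4 * K) with hr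
  set y : ℕ → ℝ := fun n => n * √(n : ℝ) with hy
  have hr0 : ∀ n, 0 < r n := fun n => by positivity
  have hy0 : ∀ n, 0 ≤ y n := fun n => by positivity
  have hgood : Tendsto (fun n => (μ n).real ((M n).regularDesign (μ n) K (r n) (y n))ᶜ)
      atTop (nhds 0) := by
    refine squeeze_zero' (Eventually.of_forall fun n => measureReal_nonneg) ?_
      (tendsto_div_sqrt_natCast (2 * K * (√K + 2 * (1 + K)) / c + 11 * (1 + K) ^ 2))
    filter_upwards [hpc, eventually_gt_atTop 0] with n hn hn0
    exact PartiallyLinearModel.measureReal_compl_regularDesign_le_div_sqrt (hmean n) (hreg n) hK hc hn0 hn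
  have hW := fun n => PartiallyLinearModel.weightedErrors (hmean n) (hreg n) hK hη (hr0 n) (hy0 n)
  have hb : ∀ n j, Measurable ((M n).scoreWeight (μ n) K (r n) (y n) j) := fun n j =>
    ((hW n).measurable_b j).measurable.mono (M n).sigmaDW_le le_rfl
  -- On `regularDesign` the studentized estimator equals the self-normalized sum and the
  -- standardized conditional variance is one, so both remaining goals reduce to `hgood`.
  refine tendstoInDistribution_gaussian_of_tendsto_integral_exp
    (T := fun n ω => (∑ j, (M n).scoreWeight (μ n) K (r n) (y n) j ω * (M n).U j ω)
      / √(∑ j, (M n).scoreWeight (μ n) K (r n) (y n) j ω ^ 2 * (M n).U j ω ^ 2))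
    (fun n => (M n).measurable_studentized)
    (fun n => (Finset.measurable_fun_sum _ fun j _ => (hb n j).mul ((M n).measurable_U j)).div
      (Finset.measurable_fun_sum _ fun j _ =>
        ((hb n j).pow_const 2).mul (((M n).measurable_U j).pow_const 2)).sqrt) ?_ fun t =>
    WeightedErrors.tendsto_integral_exp_div hW (tendsto_mul_sqrt_div_sq hK hc) ?_ t
  · refine squeeze_zero (fun n => measureReal_nonneg) (fun n => measureReal_mono ?_) hgood
    intro ω hω hmem
    exact hω (PartiallyLinearModel.studentized_eq_scoreWeight hK (hr0 n) hmem)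
  · refine squeeze_zero (fun n => measureReal_nonneg) (fun n => measureReal_mono ?_) hgood
    intro ω hω hmem
    exact hω (PartiallyLinearModel.sum_scoreWeight_mul_condVar_eq_one hK (hr0 n) hmem)
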